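/- Let $n\ge 2$ and let $\overline{\mathbb R}^n=\mathbb R^n\cup\{\infty\}$ be the Möbius space (the one-point compactification of $\mathbb R^n$). For a family $\Gamma$ of curves in $\overline{\mathbb R}^n$, let $$\mathsf M(\Gamma)=\inf_\rho\int_{\mathbb R^n}\rho^n\,dm ,$$ where the infimum is taken over all Borel functions $\rho:\mathbb R^n\to[0,+\infty]$ with $\int_\gamma\rho\,ds\ge 1$ for every rectifiable curve $\gamma\in\Gamma$ (curves through $\infty$ are not rectifiable and impose no condition), with $\mathsf M(\Gamma)=\infty$ if there is no such $\rho$. For $E,F,D\subset\overline{\mathbb R}^n$, let $\Delta(E,F;D)$ be the family of all curves $\gamma:[a,b]\to\overline{\mathbb R}^n$, $a<b$, with $\gamma(a)\in E$, $\gamma(b)\in F$ and $\gamma((a,b))\subset D$. Let $G\subset\overline{\mathbb R}^n$ be a domain (a nonempty connected open set) with $\partial G\neq\emptyset$. For $x,y\in G$ set $$\mu_G(x,y)=\inf_{C_{xy}}\mathsf M\bigl(\Delta(C_{xy},\partial G;G)\bigr),$$ where the infimum is taken over all curves $C_{xy}$ in $G$ joining $x$ and $y$. A point $x\in\partial G$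 satisfies the M-condition if, with $C=\overline{\mathbb R}^n\setminus G$, there is no continuum $K$ (compact connected set with at least two points) such that $x\in K\subset\{x\}\cup(\overline{\mathbb R}^n\setminus C)$ and $\mathsf M(\Delta(K,C;\overline{\mathbb R}^n\setminus C))<\infty$, i.e. if $C$ fails the continuum criterion at $x$. The domain $G$ is an M-domain if every point of $\partial G$ satisfies the M-condition. Then the following conditions are equivalent: (i) $(G,\mu_G)$ is a proper metric space, i.e. $\mu_G$ is a metric on $G$ and every closed ball $\{x\in G:\mu_G(x,a)\le r\}$, $a\in G$, $r>0$, is compact in the topology of $\mu_G$; (ii) $(G,\mu_G)$ is a complete metric space, i.e. $\mu_G$ is a metric on $G$ and every Cauchy sequence for $\mu_G$ converges; (iii) $G$ is an M-domain. -/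

import Mathlib

open scoped ENNReal unitInterval

noncomputable section

namespace ModulusMetric

/-- The Möbius space: the one-point compactification of Euclidean `n`-space. -/
abbrev MobiusSpace (n : ℕ) : Type := OnePoint (EuclideanSpace ℝ (Fin n))

/-- The integral of `ρ` with respect to arc length along a rectifiable curve `g` in Euclidean
space, computed in the arc-length parametrization of `g`. -/
def lineIntegral {n : ℕ} (ρ : EuclideanSpace ℝ (Fin n) → ℝ≥0∞)
    (g : I → EuclideanSpace ℝ (Fin n)) : ℝ≥0∞ :=
  ∫⁻ s in Set.Icc 0 (eVariationOn g Set.univ).toReal,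
    ρ (naturalParameterization g Set.univ 0 s)

/-- `ρ` is admissible for the curve family `Γ`: it is Borel and has integral at least `1` along
every rectifiable curve of `Γ`. A curve through `∞` is not rectifiable, so it imposes no
condition; for the other curves, `g` is the curve regarded as a curve in Euclidean space. -/
def Admissible {n : ℕ} (Γ : Set C(I, MobiusSpace n))
    (ρ : EuclideanSpace ℝ (Fin n) → ℝ≥0∞) : Prop :=
  Measurable ρ ∧ ∀ γ ∈ Γ, ∀ g : I → EuclideanSpace ℝ (Fin n),
    (∀ t, γ t = (g t : MobiusSpace n)) → eVariationOn g Set.univ ≠ ∞ → 1 ≤ lineIntegral ρ g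

/-- The conformal modulus of a curve family (it is `∞` if there is no admissible function). -/
def modulus {n : ℕ} (Γ : Set C(I, MobiusSpace n)) : ℝ≥0∞ :=
  ⨅ (ρ : EuclideanSpace ℝ (Fin n) → ℝ≥0∞) (_ : Admissible Γ ρ), ∫⁻ x, ρ x ^ n

/-- The family `Δ(A, B; D)` of all curves that join `A` and `B` in `D`. Only the interior of the
curve is required to lie in `D`. -/
def curvesJoining {n : ℕ} (A B D : Set (MobiusSpace n)) : Set C(I, MobiusSpace n) :=
  {γ | γ 0 ∈ A ∧ γ 1 ∈ B ∧ ∀ t ∈ Set.Ioo (0 : I) 1, γ t ∈ D}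

/-- The modulus metric `μ_G` (as an extended nonnegative number). -/
def modulusDist {n : ℕ} (G : Set (MobiusSpace n)) (x y : G) : ℝ≥0∞ :=
  ⨅ (c : C(I, MobiusSpace n)) (_ : c 0 = x ∧ c 1 = y ∧ ∀ t, c t ∈ G),
    modulus (curvesJoining (Set.range c) (frontier G) G)

/-- A continuum: a compact connected set with at least two points. -/
def IsContinuum {n : ℕ} (K : Set (MobiusSpace n)) : Prop :=
  IsCompact K ∧ IsConnected K ∧ K.Nontrivial

/-- The closed set `C` satisfies the continuum criterion at its point `x`. -/
def ContinuumCriterion {n : ℕ} (C : Set (MobiusSpace n)) (x : MobiusSpace n) : Prop :=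
  ∃ K : Set (MobiusSpace n), IsContinuum K ∧ x ∈ K ∧ K ⊆ {x} ∪ Cᶜ ∧
    modulus (curvesJoining K C Cᶜ) < ∞

/-- The boundary point `x` satisfies the M-condition relative to `G`. -/
def MCondition {n : ℕ} (G : Set (MobiusSpace n)) (x : MobiusSpace n) : Prop :=
  ¬ ContinuumCriterion Gᶜ x

/-- `G` is an M-domain. -/
def IsMDomain {n : ℕ} (G : Set (MobiusSpace n)) : Prop :=
  ∀ x ∈ frontier G, MCondition G x

/-- `d` is a (finite, point-separating) metric on `X`, and `(X, d)` is a proper metric space.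
The topology is the one of the metric `d`. -/
def IsProperMetric {X : Type*} (d : X → X → ℝ≥0∞) : Prop :=
  ∃ _ : MetricSpace X, (∀ x y : X, edist x y = d x y) ∧ ProperSpace X

/-- `d` is a (finite, point-separating) metric on `X`, and `(X, d)` is a complete metric space.
The uniformity is the one of the metric `d`. -/
def IsCompleteMetric {X : Type*} (d : X → X → ℝ≥0∞) : Prop :=
  ∃ _ : MetricSpace X, (∀ x y : X, edist x y = d x y) ∧ CompleteSpace X

end ModulusMetric

end

/-!
For a Borel weight `ρ`, let `weightedDist ρ p q` be the infimum of the `ρ`-lengths of the curves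
from `p` to `q`. The modulus of the curves joining a subset `A` of an open set `G` to `∂G` is then
the infimum of the energies `∫ ρ ^ n` of the weights for which `A` has distance at least `1` from
the complement of `G`. Two estimates control it. Thick rings have small capacity, since
`∫ ρ ^ n` is the conformally invariant energy. Conversely, a weight of small energy on a thick ring
admits a hub, a point at small weighted distance from every connected set that crosses the ring:
on almost every hyperplane slice the exponent `n` exceeds the dimension `n - 1`, so by the argument
of Morrey any two points of a cheap slice are joined by a short curve.

If `G` is not an M-domain, a continuum `K` of finite modulus ends at some `x ∈ ∂G`. The hubs of a
sequence of rings shrinking to `x` are all close to `K`, hence close to each other for `μ_G`, so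
they form a Cauchy sequence. A limit `p ∈ G` would be joined to points near `x` by curves of
arbitrarily small modulus, which forces `μ_G (p, ·) = 0`, so `μ_G` is not a complete metric.

If `G` is an M-domain and `μ_G (a, ·)` does not tend to infinity at `x ∈ ∂G`, there are curves of
bounded modulus from `a` to points tending to `x`. In each ring of a chain shrinking to `x` we keep
a crossing piece of one of these curves, choosing the curves diagonally so that the energies of
their weights on the rings are summable, and link consecutive pieces by short curves. The union is
a continuum of finite modulus at `x`, which contradicts the M-condition. Hence `μ_G` tends to
infinity at `∂G`, and closed balls are compact.
-/

open scoped ENNReal unitInterval NNReal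
open MeasureTheory Set Filter Topology

noncomputable section

namespace ModulusMetric

local notation "𝔼" n:max => EuclideanSpace ℝ (Fin n)

/-! ### Changes of variables -/

lemma lintegral_comp_add_smul {V : Type*} [NormedAddCommGroup V] [NormedSpace ℝ V]
    [MeasurableSpace V] [BorelSpace V] [FiniteDimensional ℝ V] (μ : Measure V)
    [μ.IsAddHaarMeasure] (f : V → ℝ≥0∞) (b : V) {r : ℝ} (hr : r ≠ 0) :
    ∫⁻ w, f (b + r • w) ∂μ =
      ENNReal.ofReal |(r ^ Module.finrank ℝ V)⁻¹| * ∫⁻ w, f w ∂μ := by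
  have hemb : MeasurableEmbedding fun w : V => r • w :=
    (MeasurableEquiv.smul₀ r hr).measurableEmbedding
  have hmap : ∫⁻ w, f (b + r • w) ∂μ = ∫⁻ w, f (b + w) ∂(μ.map fun w => r • w) :=
    (hemb.lintegral_map fun w => f (b + w)).symm
  rw [hmap, Measure.map_addHaar_smul μ hr, lintegral_smul_measure, smul_eq_mul,
    lintegral_add_left_eq_self f b]

lemma setLIntegral_Icc_add_mul {r : ℝ} (hr : 0 < r) (a x y : ℝ) (f : ℝ → ℝ≥0∞) :
    ∫⁻ s in Icc (a + r * x) (a + r * y), f s =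
      ENNReal.ofReal r * ∫⁻ s in Icc x y, f (a + r * s) := by
  have hind : ∀ s, (Icc (a + r * x) (a + r * y)).indicator f (a + r • s) =
      (Icc x y).indicator (fun s => f (a + r * s)) s := fun s => by
    simp [indicator, mul_le_mul_iff_right₀ hr]
  have hchange := lintegral_comp_add_smul volume
    ((Icc (a + r * x) (a + r * y)).indicator f) a hr.ne'
  simp only [hind, Module.finrank_self, pow_one] at hchange
  rw [lintegral_indicator measurableSet_Icc, lintegral_indicator measurableSet_Icc,
    abs_of_pos (inv_pos.2 hr)] at hchange
  rw [hchange, ← mul_assoc, ← ENNReal.ofReal_mul hr.le, mul_inv_cancel₀ hr.ne',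
    ENNReal.ofReal_one, one_mul]

lemma setLIntegral_Icc_comp_sub_left (L : ℝ) (f : ℝ → ℝ≥0∞) :
    ∫⁻ s in Icc 0 L, f (L - s) = ∫⁻ s in Icc 0 L, f s := by
  simpa using (Measure.measurePreserving_sub_left volume L).setLIntegral_comp_preimage_emb
    (MeasurableEquiv.subLeft L).measurableEmbedding f (Icc 0 L)

lemma restrict_uIcc_le_map_restrict_Icc {u : ℝ → ℝ} (hu : LipschitzWith 1 u) {L : ℝ}
    (hL : 0 ≤ L) :
    volume.restrict (uIcc (u 0) (u L)) ≤ (volume.restrict (Icc 0 L)).map u := by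
  have hmeas : Measurable u := hu.continuous.measurable
  refine Measure.le_iff.2 fun B hB => ?_
  rw [Measure.map_apply hmeas hB, Measure.restrict_apply hB, Measure.restrict_apply (hmeas hB)]
  have hsub : B ∩ uIcc (u 0) (u L) ⊆ u '' (u ⁻¹' B ∩ Icc 0 L) := by
    rintro y ⟨hyB, hy⟩
    obtain ⟨s, hs, rfl⟩ := intermediate_value_uIcc hu.continuous.continuousOn hy
    rw [uIcc_of_le hL] at hs
    exact ⟨s, ⟨hyB, hs⟩, rfl⟩
  refine (measure_mono hsub).trans ?_
  simpa [hausdorffMeasure_real] using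
    hu.hausdorffMeasure_image_le (d := 1) zero_le_one (u ⁻¹' B ∩ Icc 0 L)

lemma setLIntegral_uIcc_le_setLIntegral_comp {u : ℝ → ℝ} (hu : LipschitzWith 1 u) {L : ℝ}
    (hL : 0 ≤ L) {f : ℝ → ℝ≥0∞} (hf : Measurable f) :
    ∫⁻ v in uIcc (u 0) (u L), f v ≤ ∫⁻ s in Icc 0 L, f (u s) := by
  rw [← lintegral_map hf hu.continuous.measurable]
  exact lintegral_mono' (restrict_uIcc_le_map_restrict_Icc hu hL) le_rfl

/-! ### The distance defined by a weight -/

section WeightedDist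

variable {X : Type*} [PseudoMetricSpace X]

/-- The infimum of the `ρ`-lengths of the curves from `p` to `q`. A curve is a `1`-Lipschitz
map on `ℝ`, of which only the restriction to `[0, L]` matters; its speed may be less than `1`, so
the integral is an upper bound for the arc length integral. -/
def weightedDist (ρ : X → ℝ≥0∞) (p q : X) : ℝ≥0∞ :=
  ⨅ (L : ℝ) (c : ℝ → X) (_ : 0 ≤ L ∧ LipschitzWith 1 c ∧ c 0 = p ∧ c L = q),
    ∫⁻ s in Icc 0 L, ρ (c s)

/-- The open ball of `weightedDist ρ`. -/
def weightedBall (ρ : X → ℝ≥0∞) (p : X) (ε : ℝ≥0∞) : Set X := {z | weightedDist ρ p z < ε}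

variable {ρ ρ' : X → ℝ≥0∞} {p q : X} {ε : ℝ≥0∞}

lemma le_weightedDist_iff {a : ℝ≥0∞} : a ≤ weightedDist ρ p q ↔
    ∀ (L : ℝ) (c : ℝ → X), 0 ≤ L → LipschitzWith 1 c → c 0 = p → c L = q →
      a ≤ ∫⁻ s in Icc 0 L, ρ (c s) := by
  simp only [weightedDist, le_iInf_iff, and_imp]

lemma weightedDist_lt_iff : weightedDist ρ p q < ε ↔
    ∃ (L : ℝ) (c : ℝ → X), 0 ≤ L ∧ LipschitzWith 1 c ∧ c 0 = p ∧ c L = q ∧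
      ∫⁻ s in Icc 0 L, ρ (c s) < ε := by
  simp only [weightedDist, iInf_lt_iff, exists_prop, and_assoc]

lemma weightedDist_le {L : ℝ} {c : ℝ → X} (hL : 0 ≤ L) (hc : LipschitzWith 1 c) :
    weightedDist ρ (c 0) (c L) ≤ ∫⁻ s in Icc 0 L, ρ (c s) :=
  le_weightedDist_iff.1 le_rfl L c hL hc rfl rfl

lemma weightedDist_le_setLIntegral {c : ℝ → X} {a b : ℝ} (hab : a ≤ b)
    (hc : LipschitzOnWith 1 c (Icc a b)) :
    weightedDist ρ (c a) (c b) ≤ ∫⁻ s in Icc a b, ρ (c s) := by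
  set c' : ℝ → X := IccExtend hab ((Icc a b).domRestrict c)
  have hc' : LipschitzWith 1 c' :=
    (hc.to_restrict.comp (LipschitzWith.projIcc hab)).weaken (one_mul 1).le
  have hshift : LipschitzWith 1 fun s => c' (a + s) := by
    simpa [Function.comp_def] using hc'.comp (isometry_add_left a).lipschitz
  have heq : EqOn c' c (Icc a b) := fun s hs => by simp [c', IccExtend_of_mem hab _ hs]
  calc weightedDist ρ (c a) (c b)
      ≤ ∫⁻ s in Icc 0 (b - a), ρ (c' (a + s)) := by
        simpa [heq (left_mem_Icc.2 hab), heq (right_mem_Icc.2 hab)] using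
          weightedDist_le (ρ := ρ) (sub_nonneg.2 hab) hshift
    _ = ∫⁻ s in Icc a b, ρ (c' s) := by
        simpa using (setLIntegral_Icc_add_mul one_pos a 0 (b - a) fun s => ρ (c' s)).symm
    _ = ∫⁻ s in Icc a b, ρ (c s) :=
        setLIntegral_congr_fun measurableSet_Icc fun s hs => congrArg ρ (heq hs)

lemma weightedDist_mono (h : ρ ≤ ρ') (p q : X) : weightedDist ρ p q ≤ weightedDist ρ' p q :=
  le_weightedDist_iff.2 fun L c hL hc h0 h1 => by
    subst h0 h1
    exact (weightedDist_le hL hc).trans (lintegral_mono fun s => h _)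

@[simp] lemma weightedDist_self (ρ : X → ℝ≥0∞) (p : X) : weightedDist ρ p p = 0 := by
  simpa using weightedDist_le (ρ := ρ) (L := 0) (c := fun _ => p) le_rfl (LipschitzWith.const' p)

lemma weightedDist_comm (ρ : X → ℝ≥0∞) (p q : X) :
    weightedDist ρ p q = weightedDist ρ q p := by
  suffices hle : ∀ p q, weightedDist ρ p q ≤ weightedDist ρ q p from
    le_antisymm (hle _ _) (hle _ _)
  refine fun p q => le_weightedDist_iff.2 fun L c hL hc h0 h1 => ?_
  have hrev : LipschitzWith 1 fun s => c (L - s) := by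
    simpa [Function.comp_def] using hc.comp (IsometryEquiv.subLeft L).isometry.lipschitz
  calc weightedDist ρ p q ≤ ∫⁻ s in Icc 0 L, ρ (c (L - s)) := by
        simpa [h0, h1] using weightedDist_le (ρ := ρ) hL hrev
    _ = ∫⁻ s in Icc 0 L, ρ (c s) := setLIntegral_Icc_comp_sub_left L fun s => ρ (c s)

lemma lipschitzWith_ite_le {K : ℝ≥0} {c₁ c₂ : ℝ → X} (h₁ : LipschitzWith K c₁)
    (h₂ : LipschitzWith K c₂) {a : ℝ} (h : c₁ a = c₂ a) :
    LipschitzWith K fun s => if s ≤ a then c₁ s else c₂ s := by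
  refine LipschitzWith.of_dist_le_mul fun x y => ?_
  wlog hxy : x ≤ y generalizing x y
  · rw [dist_comm, dist_comm x]
    exact this y x (le_of_not_ge hxy)
  rcases le_or_gt y a with hy | hy
  · simpa [hy, hxy.trans hy] using h₁.dist_le_mul x y
  rcases le_or_gt x a with hx | hx
  · simp only [hx, hy.not_ge, if_true, if_false]
    calc dist (c₁ x) (c₂ y) ≤ dist (c₁ x) (c₁ a) + dist (c₂ a) (c₂ y) :=
          h ▸ dist_triangle _ _ _
      _ ≤ K * dist x a + K * dist a y := add_le_add (h₁.dist_le_mul _ _) (h₂.dist_le_mul _ _)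
      _ = K * dist x y := by
          rw [← mul_add, dist_add_dist_of_mem_segment]
          rw [segment_eq_Icc hxy]
          exact ⟨hx, hy.le⟩
  · simpa [hx.not_ge, hy.not_ge] using h₂.dist_le_mul x y

lemma weightedDist_le_add {c₁ c₂ : ℝ → X} (hc₁ : LipschitzWith 1 c₁) (hc₂ : LipschitzWith 1 c₂)
    {L₁ L₂ : ℝ} (hL₁ : 0 ≤ L₁) (hL₂ : 0 ≤ L₂) (h : c₁ L₁ = c₂ 0) :
    weightedDist ρ (c₁ 0) (c₂ L₂) ≤
      (∫⁻ s in Icc 0 L₁, ρ (c₁ s)) + ∫⁻ s in Icc 0 L₂, ρ (c₂ s) := by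
  have hshift : LipschitzWith 1 fun s => c₂ (s - L₁) := by
    simpa [Function.comp_def] using hc₂.comp (IsometryEquiv.subRight L₁).isometry.lipschitz
  set c : ℝ → X := fun s => if s ≤ L₁ then c₁ s else c₂ (s - L₁)
  have hc : LipschitzWith 1 c := lipschitzWith_ite_le hc₁ hshift (by simp [h])
  have hleft : EqOn c c₁ (Icc 0 L₁) := fun s hs => if_pos hs.2
  have hright : EqOn c (fun s => c₂ (s - L₁)) (Icc L₁ (L₁ + L₂)) := fun s hs => by
    rcases hs.1.eq_or_lt with rfl | hlt
    · simp [c, h]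
    · exact if_neg hlt.not_ge
  calc weightedDist ρ (c₁ 0) (c₂ L₂)
      = weightedDist ρ (c 0) (c (L₁ + L₂)) := by
        rw [hleft (left_mem_Icc.2 hL₁), hright (right_mem_Icc.2 (by linarith))]
        simp
    _ ≤ ∫⁻ s in Icc 0 (L₁ + L₂), ρ (c s) := weightedDist_le (by positivity) hc
    _ ≤ (∫⁻ s in Icc 0 L₁, ρ (c s)) + ∫⁻ s in Icc L₁ (L₁ + L₂), ρ (c s) := by
        rw [← Icc_union_Icc_eq_Icc hL₁ (by linarith : L₁ ≤ L₁ + L₂)]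
        exact lintegral_union_le _ _ _
    _ = (∫⁻ s in Icc 0 L₁, ρ (c₁ s)) + ∫⁻ s in Icc L₁ (L₁ + L₂), ρ (c₂ (s - L₁)) := by
        congr 1
        · exact setLIntegral_congr_fun measurableSet_Icc fun s hs => congrArg ρ (hleft hs)
        · exact setLIntegral_congr_fun measurableSet_Icc fun s hs => congrArg ρ (hright hs)
    _ = _ := by
        congr 1
        simpa using setLIntegral_Icc_add_mul one_pos L₁ 0 L₂ fun s => ρ (c₂ (s - L₁))

lemma weightedDist_triangle (ρ : X → ℝ≥0∞) (p q z : X) :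
    weightedDist ρ p z ≤ weightedDist ρ p q + weightedDist ρ q z := by
  refine ENNReal.le_of_forall_pos_le_add fun ε hε hfin => ?_
  have hε2 : (ε : ℝ≥0∞) / 2 ≠ 0 := by simpa using hε.ne'
  obtain ⟨hpq, hqz⟩ := ENNReal.add_lt_top.1 hfin
  obtain ⟨L₁, c₁, hL₁, hc₁, rfl, hc₁q, hlen₁⟩ :=
    weightedDist_lt_iff.1 (ENNReal.lt_add_right hpq.ne hε2)
  obtain ⟨L₂, c₂, hL₂, hc₂, hc₂q, rfl, hlen₂⟩ :=
    weightedDist_lt_iff.1 (ENNReal.lt_add_right hqz.ne hε2)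
  calc weightedDist ρ (c₁ 0) (c₂ L₂)
      ≤ (∫⁻ s in Icc 0 L₁, ρ (c₁ s)) + ∫⁻ s in Icc 0 L₂, ρ (c₂ s) :=
        weightedDist_le_add hc₁ hc₂ hL₁ hL₂ (hc₁q.trans hc₂q.symm)
    _ ≤ (weightedDist ρ (c₁ 0) q + ε / 2) + (weightedDist ρ q (c₂ L₂) + ε / 2) :=
        add_le_add hlen₁.le hlen₂.le
    _ = _ := by rw [add_add_add_comm, ENNReal.add_halves]

lemma weightedDist_triangle_right (ρ : X → ℝ≥0∞) (p q z : X) :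
    weightedDist ρ p q ≤ weightedDist ρ p z + weightedDist ρ q z :=
  weightedDist_comm ρ z q ▸ weightedDist_triangle ρ p z q

lemma weightedDist_triangle_left (ρ : X → ℝ≥0∞) (p q z : X) :
    weightedDist ρ p q ≤ weightedDist ρ z p + weightedDist ρ z q :=
  weightedDist_comm ρ p z ▸ weightedDist_triangle ρ p z q

lemma joinedIn_weightedBall (h : q ∈ weightedBall ρ p ε) : JoinedIn (weightedBall ρ p ε) p q := by
  obtain ⟨L, c, hL, hc, rfl, rfl, hlen⟩ := weightedDist_lt_iff.1 h
  refine JoinedIn.ofLine (f := fun t : ℝ => c (t * L))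
    (hc.continuous.comp (by fun_prop)).continuousOn (by simp) (by simp) ?_
  rintro _ ⟨t, ht, rfl⟩
  calc weightedDist ρ (c 0) (c (t * L))
      ≤ ∫⁻ s in Icc 0 (t * L), ρ (c s) := weightedDist_le (mul_nonneg ht.1 hL) hc
    _ ≤ ∫⁻ s in Icc 0 L, ρ (c s) :=
        lintegral_mono_set (Icc_subset_Icc_right (mul_le_of_le_one_left hL ht.2))
    _ < ε := hlen

lemma weightedBall_subset_of_le_on (hle : ∀ z ∈ weightedBall ρ' p ε, ρ z ≤ ρ' z) :
    weightedBall ρ' p ε ⊆ weightedBall ρ p ε := by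
  intro q hq
  obtain ⟨L, c, hL, hc, rfl, rfl, hlen⟩ := weightedDist_lt_iff.1 hq
  refine ((weightedDist_le hL hc).trans ?_).trans_lt hlen
  refine setLIntegral_mono' measurableSet_Icc fun s hs => hle _ ?_
  exact ((weightedDist_le hs.1 hc).trans
    (lintegral_mono_set (Icc_subset_Icc_right hs.2))).trans_lt hlen

lemma const_mul_weightedDist_le {a : ℝ≥0∞} (ha : a ≠ ∞) (ρ : X → ℝ≥0∞) (p q : X) :
    a * weightedDist ρ p q ≤ weightedDist (fun z => a * ρ z) p q := by
  refine le_weightedDist_iff.2 fun L c hL hc h0 h1 => ?_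
  subst h0 h1
  rw [lintegral_const_mul' _ _ ha]
  gcongr
  exact weightedDist_le hL hc

lemma weightedDist_comp_le {Y : Type*} [PseudoMetricSpace Y] {φ : Y → X} {r : ℝ} (hr : 0 < r)
    (hφ : ∀ x y, dist (φ x) (φ y) ≤ r * dist x y) (x y : Y) :
    weightedDist ρ (φ x) (φ y) ≤ weightedDist (fun w => ENNReal.ofReal r * ρ (φ w)) x y := by
  refine le_weightedDist_iff.2 fun L c hL hc h0 h1 => ?_
  have hlip : LipschitzWith 1 fun s : ℝ => φ (c (r⁻¹ * s)) :=
    LipschitzWith.of_dist_le_mul fun a b => by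
      have hc_le := hc.dist_le_mul (r⁻¹ * a) (r⁻¹ * b)
      simp only [NNReal.coe_one, one_mul] at hc_le ⊢
      calc dist (φ (c (r⁻¹ * a))) (φ (c (r⁻¹ * b)))
          ≤ r * dist (r⁻¹ * a) (r⁻¹ * b) := (hφ _ _).trans (by gcongr)
        _ = dist a b := by
            rw [Real.dist_eq, ← mul_sub, abs_mul, abs_of_pos (inv_pos.2 hr), Real.dist_eq,
              mul_inv_cancel_left₀ hr.ne']
  calc weightedDist ρ (φ x) (φ y)
      ≤ ∫⁻ s in Icc 0 (r * L), ρ (φ (c (r⁻¹ * s))) := by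
        simpa [inv_mul_cancel_left₀ hr.ne', h0, h1] using
          weightedDist_le (ρ := ρ) (by positivity : 0 ≤ r * L) hlip
    _ = ENNReal.ofReal r * ∫⁻ s in Icc 0 L, ρ (φ (c s)) := by
        simpa [inv_mul_cancel_left₀ hr.ne'] using
          setLIntegral_Icc_add_mul hr 0 0 L fun s => ρ (φ (c (r⁻¹ * s)))
    _ ≤ ∫⁻ s in Icc 0 L, ENNReal.ofReal r * ρ (φ (c s)) := lintegral_const_mul_le _ _

lemma weightedDist_comp_line_le {φ : ℝ → X} {r : ℝ} (hr : 0 < r)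
    (hφ : ∀ a b, dist (φ a) (φ b) ≤ r * dist a b) {a b : ℝ} (hab : a ≤ b) :
    weightedDist ρ (φ a) (φ b) ≤ ENNReal.ofReal r * ∫⁻ t in Icc a b, ρ (φ t) :=
  calc weightedDist ρ (φ a) (φ b)
      ≤ weightedDist (fun t => ENNReal.ofReal r * ρ (φ t)) a b := weightedDist_comp_le hr hφ a b
    _ ≤ ∫⁻ t in Icc a b, ENNReal.ofReal r * ρ (φ t) :=
        weightedDist_le_setLIntegral (c := id) hab LipschitzWith.id.lipschitzOnWith
    _ = _ := lintegral_const_mul' _ _ ENNReal.ofReal_ne_top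

lemma weightedDist_le_segment {E : Type*} [SeminormedAddCommGroup E] [NormedSpace ℝ E]
    {ρ : E → ℝ≥0∞} {p q : E} {r : ℝ} (hr : 0 < r) (h : ‖q - p‖ ≤ r) :
    weightedDist ρ p q ≤ ENNReal.ofReal r * ∫⁻ t in Icc (0 : ℝ) 1, ρ (p + t • (q - p)) := by
  have hφ : ∀ a b : ℝ, dist (p + a • (q - p)) (p + b • (q - p)) ≤ r * dist a b := fun a b => by
    rw [dist_add_left, dist_eq_norm, ← sub_smul, norm_smul, mul_comm, dist_eq_norm a b]
    gcongr
  simpa using weightedDist_comp_line_le (ρ := ρ) hr hφ zero_le_one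

end WeightedDist

/-! ### Arc length -/

section Variation

variable {α E : Type*} [LinearOrder α] [PseudoEMetricSpace E]

lemma variationOnFromTo_sub {f : α → E} (hf : LocallyBoundedVariationOn f univ) (a : α) {b c : α}
    (hbc : b ≤ c) :
    variationOnFromTo f univ a c - variationOnFromTo f univ a b =
      (eVariationOn f (Icc b c)).toReal := by
  rw [← variationOnFromTo.add hf (mem_univ a) (mem_univ b) (mem_univ c), add_sub_cancel_left,
    variationOnFromTo.eq_of_le f univ hbc, univ_inter]

lemma continuous_variationOnFromTo [TopologicalSpace α] [OrderTopology α] {f : α → E}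
    (hfc : Continuous f) (hf : BoundedVariationOn f univ) (a : α) :
    Continuous (variationOnFromTo f univ a) := by
  refine continuous_iff_continuousAt.2 fun x => continuousAt_iff_continuous_left_right.2
    ⟨?_, hf.continuousWithinAt_variationOnFromTo_Ici hfc.continuousWithinAt⟩
  have hzero : Tendsto (fun y => (eVariationOn f (univ ∩ Icc y x)).toReal) (𝓝[≤] x) (𝓝 0) :=
    (ENNReal.tendsto_toReal ENNReal.zero_ne_top).comp
      ((hf.tendsto_eVariationOn_Icc_zero_left hfc.continuousWithinAt).mono_left
        (nhdsWithin_mono _ (subset_univ _)))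
  have hlim := (tendsto_const_nhds (x := variationOnFromTo f univ a x)).sub hzero
  rw [sub_zero] at hlim
  refine hlim.congr' ?_
  filter_upwards [self_mem_nhdsWithin] with y hy
  rw [univ_inter, ← variationOnFromTo_sub hf.locallyBoundedVariationOn a hy, sub_sub_cancel]

lemma eVariationOn_Icc_le_of_lipschitzWith {K : ℝ≥0} {c : ℝ → E} (hc : LipschitzWith K c)
    (a b : ℝ) : eVariationOn c (Icc a b) ≤ K * ENNReal.ofReal (b - a) := by
  rcases le_or_gt a b with hab | hab
  · have hid : eVariationOn (id : ℝ → ℝ) (Icc a b) = ENNReal.ofReal (b - a) := by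
      rw [← inter_self (Icc a b)]
      exact monotoneOn_id.eVariationOn_eq (left_mem_Icc.2 hab) (right_mem_Icc.2 hab)
    exact hid ▸ hc.lipschitzOnWith.comp_eVariationOn_le (mapsTo_univ _ _)
  · simp [Icc_eq_empty hab.not_ge]

lemma lipschitzWith_variationOnFromTo {K : ℝ≥0} {c : ℝ → E} (hc : LipschitzWith K c) (a : ℝ) :
    LipschitzWith K (variationOnFromTo c univ a) := by
  refine LipschitzWith.of_dist_le_mul fun x y => ?_
  wlog hxy : x ≤ y generalizing x y
  · rw [dist_comm, dist_comm x]
    exact this y x (le_of_not_ge hxy)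
  rw [dist_comm, dist_comm x, Real.dist_eq, Real.dist_eq,
    variationOnFromTo_sub (hc.locallyBoundedVariationOn _) a hxy,
    abs_of_nonneg ENNReal.toReal_nonneg, abs_of_nonneg (sub_nonneg.2 hxy)]
  calc (eVariationOn c (Icc x y)).toReal
      ≤ ((K : ℝ≥0∞) * ENNReal.ofReal (y - x)).toReal :=
        ENNReal.toReal_mono (by finiteness) (eVariationOn_Icc_le_of_lipschitzWith hc x y)
    _ = K * (y - x) := by simp [ENNReal.toReal_ofReal (sub_nonneg.2 hxy)]

lemma lipschitzOnWith_one_of_hasUnitSpeedOn {c : ℝ → E} {s : Set ℝ} (hc : HasUnitSpeedOn c s) :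
    LipschitzOnWith 1 c s := by
  intro x hx y hy
  wlog hxy : x ≤ y generalizing x y
  · rw [edist_comm, edist_comm x]
    exact this hy hx (le_of_not_ge hxy)
  calc edist (c x) (c y) ≤ eVariationOn c (s ∩ Icc x y) :=
        eVariationOn.edist_le _ ⟨hx, le_rfl, hxy⟩ ⟨hy, hxy, le_rfl⟩
    _ = ENNReal.ofReal (y - x) := by simpa using hc hx hy
    _ = (1 : ℝ≥0) * edist x y := by
        rw [edist_comm, edist_dist, Real.dist_eq, abs_of_nonneg (sub_nonneg.2 hxy),
          ENNReal.coe_one, one_mul]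

end Variation

section NaturalParameterization

variable {E : Type*} [MetricSpace E] {g : I → E}

lemma Icc_zero_one_eq_univ : Icc (0 : I) 1 = univ := Icc_bot_top

lemma variationOnFromTo_zero_one :
    variationOnFromTo g univ 0 1 = (eVariationOn g univ).toReal := by
  rw [variationOnFromTo.eq_of_le g univ zero_le_one, univ_inter, Icc_zero_one_eq_univ]

lemma range_variationOnFromTo (hgc : Continuous g) (hg : BoundedVariationOn g univ) :
    range (variationOnFromTo g univ 0) = Icc 0 (eVariationOn g univ).toReal := by
  have hmono := variationOnFromTo.monotoneOn hg.locallyBoundedVariationOn (mem_univ (0 : I))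
  have hzero : variationOnFromTo g univ 0 0 = 0 := variationOnFromTo.self _ _ _
  apply Subset.antisymm
  · rintro _ ⟨t, rfl⟩
    rw [← hzero, ← variationOnFromTo_zero_one]
    exact ⟨hmono (mem_univ _) (mem_univ _) t.2.1, hmono (mem_univ _) (mem_univ _) t.2.2⟩
  · rw [← variationOnFromTo_zero_one, ← hzero]
    exact (intermediate_value_Icc zero_le_one
      (continuous_variationOnFromTo hgc hg 0).continuousOn).trans (image_subset_range _ _)

lemma lipschitzOnWith_naturalParameterization (hgc : Continuous g)
    (hg : BoundedVariationOn g univ) :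
    LipschitzOnWith 1 (naturalParameterization g univ 0)
      (Icc 0 (eVariationOn g univ).toReal) := by
  rw [← range_variationOnFromTo hgc hg, ← image_univ]
  exact lipschitzOnWith_one_of_hasUnitSpeedOn
    (has_unit_speed_naturalParameterization g hg.locallyBoundedVariationOn (mem_univ 0))

lemma naturalParameterization_variationOnFromTo (hg : BoundedVariationOn g univ) (t : I) :
    naturalParameterization g univ 0 (variationOnFromTo g univ 0 t) = g t :=
  edist_eq_zero.1 <| edist_naturalParameterization_eq_zero hg.locallyBoundedVariationOn
    (mem_univ 0) (mem_univ t)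

lemma image_mul_Icc_zero {L : ℝ} (hL : 0 ≤ L) (t : I) :
    (fun s : I => (s : ℝ) * L) '' Icc 0 t = Icc 0 (t * L) := by
  apply Subset.antisymm
  · rintro _ ⟨s, hs, rfl⟩
    exact ⟨mul_nonneg s.2.1 hL, mul_le_mul_of_nonneg_right hs.2 hL⟩
  · simpa using intermediate_value_Icc (f := fun s : I => (s : ℝ) * L) unitInterval.nonneg'
      (Continuous.continuousOn (by fun_prop))

lemma eVariationOn_comp_mul {c : ℝ → E} {L : ℝ} (hL : 0 ≤ L) (t : I) :
    eVariationOn (fun t : I => c (t * L)) (Icc 0 t) = eVariationOn c (Icc 0 (t * L)) := by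
  have hmono : Monotone fun s : I => (s : ℝ) * L := fun a b hab =>
    mul_le_mul_of_nonneg_right hab hL
  rw [← image_mul_Icc_zero hL t]
  exact eVariationOn.comp_eq_of_monotoneOn c _ (hmono.monotoneOn _)

lemma variationOnFromTo_comp_mul {c : ℝ → E} {L : ℝ} (hL : 0 ≤ L) (t : I) :
    variationOnFromTo (fun t : I => c (t * L)) univ 0 t = variationOnFromTo c univ 0 (t * L) := by
  rw [variationOnFromTo.eq_of_le _ _ unitInterval.nonneg',
    variationOnFromTo.eq_of_le _ _ (mul_nonneg t.2.1 hL), univ_inter,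
    univ_inter, eVariationOn_comp_mul hL]

lemma boundedVariationOn_comp_mul {c : ℝ → E} (hc : LipschitzWith 1 c) {L : ℝ} (hL : 0 ≤ L) :
    BoundedVariationOn (fun t : I => c (t * L)) univ := by
  rw [BoundedVariationOn, ← Icc_zero_one_eq_univ, eVariationOn_comp_mul hL]
  exact ne_top_of_le_ne_top (by finiteness) (eVariationOn_Icc_le_of_lipschitzWith hc _ _)

end NaturalParameterization

section LineIntegral

variable {n : ℕ} {ρ : 𝔼 n → ℝ≥0∞} {g : I → 𝔼 n}

lemma weightedDist_le_lineIntegral (hgc : Continuous g) (hg : BoundedVariationOn g univ)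
    (s t : I) : weightedDist ρ (g s) (g t) ≤ lineIntegral ρ g := by
  wlog hst : s ≤ t generalizing s t
  · rw [weightedDist_comm]
    exact this t s (le_of_not_ge hst)
  have hmem : ∀ t, variationOnFromTo g univ 0 t ∈ Icc 0 (eVariationOn g univ).toReal :=
    fun t => range_variationOnFromTo hgc hg ▸ mem_range_self t
  have hsub := Icc_subset_Icc (hmem s).1 (hmem t).2
  have hle := weightedDist_le_setLIntegral (ρ := ρ)
    (variationOnFromTo.monotoneOn hg.locallyBoundedVariationOn (mem_univ 0) (mem_univ s)
      (mem_univ t) hst)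
    ((lipschitzOnWith_naturalParameterization hgc hg).mono hsub)
  simp only [naturalParameterization_variationOnFromTo hg] at hle
  exact hle.trans (lintegral_mono_set hsub)

lemma lineIntegral_comp_mul_le (hρ : Measurable ρ) {c : ℝ → 𝔼 n} (hc : LipschitzWith 1 c)
    {L : ℝ} (hL : 0 ≤ L) :
    lineIntegral ρ (fun t : I => c (t * L)) ≤ ∫⁻ s in Icc 0 L, ρ (c s) := by
  set g : I → 𝔼 n := fun t => c (t * L)
  set V := (eVariationOn g univ).toReal
  set v := variationOnFromTo c univ 0
  have hg : BoundedVariationOn g univ := boundedVariationOn_comp_mul hc hL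
  have hgc : Continuous g := hc.continuous.comp (by fun_prop)
  have hV : 0 ≤ V := ENNReal.toReal_nonneg
  have hv_zero : v 0 = 0 := variationOnFromTo.self _ _ _
  have hv_mul : ∀ t : I, v (t * L) = variationOnFromTo g univ 0 t := fun t =>
    (variationOnFromTo_comp_mul hL t).symm
  have hv_L : v L = V := by simpa [variationOnFromTo_zero_one] using hv_mul 1
  set N : ℝ → 𝔼 n := IccExtend hV ((Icc 0 V).domRestrict (naturalParameterization g univ 0))
  have hN_cont : Continuous N :=
    (lipschitzOnWith_naturalParameterization hgc hg).continuousOn.domRestrict.Icc_extend'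
  have hN : EqOn N (naturalParameterization g univ 0) (Icc 0 V) := fun s hs => by
    simp [N, IccExtend_of_mem hV _ hs]
  have hNv : EqOn (N ∘ v) c (Icc 0 L) := fun s hs => by
    obtain ⟨t, -, rfl⟩ : s ∈ (fun t : I => (t : ℝ) * L) '' Icc 0 1 := by
      simpa [image_mul_Icc_zero hL] using hs
    have hmem : variationOnFromTo g univ 0 t ∈ Icc 0 V :=
      range_variationOnFromTo hgc hg ▸ mem_range_self t
    rw [Function.comp_apply, hv_mul, hN hmem, naturalParameterization_variationOnFromTo hg]
  calc lineIntegral ρ g = ∫⁻ s in uIcc (v 0) (v L), ρ (N s) := by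
        rw [hv_zero, hv_L, uIcc_of_le hV]
        exact setLIntegral_congr_fun measurableSet_Icc fun s hs => congrArg ρ (hN hs).symm
    _ ≤ ∫⁻ s in Icc 0 L, ρ (N (v s)) :=
        setLIntegral_uIcc_le_setLIntegral_comp (lipschitzWith_variationOnFromTo hc 0) hL
          (hρ.comp hN_cont.measurable)
    _ = ∫⁻ s in Icc 0 L, ρ (c s) :=
        setLIntegral_congr_fun measurableSet_Icc fun s hs => congrArg ρ (hNv hs)

end LineIntegral

/-! ### Capacity -/

section Modulus

variable {n : ℕ} {ρ : 𝔼 n → ℝ≥0∞} {g : I → 𝔼 n} {G A B : Set (MobiusSpace n)}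

/-- Every curve from `A` to `C` has `ρ`-length at least `1`. -/
def Separates {X : Type*} [PseudoMetricSpace X] (ρ : X → ℝ≥0∞) (A C : Set X) : Prop :=
  ∀ p ∈ A, ∀ q ∈ C, 1 ≤ weightedDist ρ p q

/-- The modulus of the family of all curves from `A` to `C`, in terms of `weightedDist`. -/
def capacity (A C : Set (𝔼 n)) : ℝ≥0∞ :=
  ⨅ (ρ : 𝔼 n → ℝ≥0∞) (_ : Measurable ρ ∧ Separates ρ A C), ∫⁻ x, ρ x ^ n

/-- The Euclidean part of a subset of the Möbius space. -/
abbrev finitePart (A : Set (MobiusSpace n)) : Set (𝔼 n) := ((↑) : 𝔼 n → MobiusSpace n) ⁻¹' A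

lemma exists_first_exit {X : Type*} [TopologicalSpace X] {G : Set X} (hG : IsOpen G) {c : ℝ → X}
    (hc : Continuous c) {L : ℝ} (hL : 0 ≤ L) (h0 : c 0 ∈ G) (h1 : c L ∉ G) :
    ∃ s ∈ Ioc 0 L, c s ∈ frontier G ∧ ∀ t ∈ Ico 0 s, c t ∈ G := by
  set S : Set ℝ := Icc 0 L ∩ c ⁻¹' Gᶜ
  have hS : IsCompact S := isCompact_Icc.inter_right (hG.isClosed_compl.preimage hc)
  have hmem : sInf S ∈ S := hS.sInf_mem ⟨L, ⟨hL, le_rfl⟩, h1⟩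
  set s := sInf S
  have hbefore : ∀ t ∈ Ico 0 s, c t ∈ G := fun t ht => by
    by_contra hout
    exact ht.2.not_ge (csInf_le hS.bddBelow ⟨⟨ht.1, ht.2.le.trans hmem.1.2⟩, hout⟩)
  have hpos : 0 < s := hmem.1.1.lt_of_ne fun h => hmem.2 (h ▸ h0)
  have hclosure : s ∈ closure (Ico 0 s) := by
    rw [closure_Ico hpos.ne]
    exact right_mem_Icc.2 hpos.le
  refine ⟨s, ⟨hpos, hmem.1.2⟩, hG.frontier_eq ▸ ⟨?_, hmem.2⟩, hbefore⟩
  exact closure_mono (image_subset_iff.2 hbefore)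
    (image_closure_subset_closure_image hc ⟨s, hclosure, rfl⟩)

-- An admissible function only sees a curve up to its first exit from `G`.
lemma separates_of_admissible (hG : IsOpen G) (hA : A ⊆ G) (hB : frontier G ⊆ B)
    (hρ : Admissible (curvesJoining A B G) ρ) :
    Separates ρ (finitePart A) (finitePart Gᶜ) := by
  refine fun p hp q hq => le_weightedDist_iff.2 fun L c hL hc h0 h1 => ?_
  subst h0 h1
  obtain ⟨s, ⟨hs0, hsL⟩, hfrontier, hbefore⟩ :=
    exists_first_exit hG (OnePoint.continuous_coe.comp hc.continuous) hL (hA hp) hq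
  have hcont : Continuous fun t : I => c (t * s) := hc.continuous.comp (by fun_prop)
  set γ : C(I, MobiusSpace n) := ⟨fun t => c (t * s), OnePoint.continuous_coe.comp hcont⟩
  have hγ : γ ∈ curvesJoining A B G :=
    ⟨by simpa [γ] using hp, by simpa [γ] using hB hfrontier, fun t ht =>
      hbefore _ ⟨mul_nonneg t.2.1 hs0.le, mul_lt_of_lt_one_left hs0 ht.2⟩⟩
  calc 1 ≤ lineIntegral ρ fun t : I => c (t * s) :=
        hρ.2 γ hγ _ (fun _ => rfl) (boundedVariationOn_comp_mul hc hs0.le)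
    _ ≤ ∫⁻ s in Icc 0 s, ρ (c s) := lineIntegral_comp_mul_le hρ.1 hc hs0.le
    _ ≤ ∫⁻ s in Icc 0 L, ρ (c s) := lintegral_mono_set (Icc_subset_Icc_right hsL)

lemma continuous_of_coe_eq {γ : C(I, MobiusSpace n)} (hg : ∀ t, γ t = (g t : MobiusSpace n)) :
    Continuous g := by
  rw [OnePoint.isOpenEmbedding_coe.isInducing.continuous_iff]
  exact γ.continuous.congr hg

lemma admissible_of_separates (hB : B ⊆ Gᶜ) (hm : Measurable ρ)
    (hρ : Separates ρ (finitePart A) (finitePart Gᶜ)) : Admissible (curvesJoining A B G) ρ := by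
  refine ⟨hm, fun γ ⟨h0, h1, _⟩ g hg hvar => ?_⟩
  rw [hg] at h0 h1
  exact (hρ _ h0 _ (hB h1)).trans
    (weightedDist_le_lineIntegral (continuous_of_coe_eq hg) hvar 0 1)

lemma modulus_curvesJoining (hG : IsOpen G) (hA : A ⊆ G) (hB : frontier G ⊆ B) (hB' : B ⊆ Gᶜ) :
    modulus (curvesJoining A B G) = capacity (finitePart A) (finitePart Gᶜ) := by
  have hiff : ∀ ρ, Admissible (curvesJoining A B G) ρ ↔
      Measurable ρ ∧ Separates ρ (finitePart A) (finitePart Gᶜ) := fun ρ =>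
    ⟨fun hρ => ⟨hρ.1, separates_of_admissible hG hA hB hρ⟩,
      fun hρ => admissible_of_separates hB' hρ.1 hρ.2⟩
  simp only [modulus, capacity, hiff]

lemma frontier_subset_compl {X : Type*} [TopologicalSpace X] {G : Set X} (hG : IsOpen G) :
    frontier G ⊆ Gᶜ := fun _ hx => (hG.frontier_eq ▸ hx).2

end Modulus

section Capacity

variable {n : ℕ} {A A' C C' : Set (𝔼 n)}

lemma capacity_le (hm : Measurable ρ) (hρ : Separates ρ A C) : capacity A C ≤ ∫⁻ x, ρ x ^ n :=
  iInf₂_le_of_le ρ ⟨hm, hρ⟩ le_rfl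

lemma exists_of_capacity_lt {a : ℝ≥0∞} (h : capacity A C < a) :
    ∃ ρ : 𝔼 n → ℝ≥0∞, Measurable ρ ∧ Separates ρ A C ∧ ∫⁻ x, ρ x ^ n < a := by
  simpa only [capacity, iInf_lt_iff, exists_prop, and_assoc] using h

lemma capacity_mono (hA : A ⊆ A') (hC : C ⊆ C') : capacity A C ≤ capacity A' C' :=
  le_iInf₂ fun _ hρ => capacity_le hρ.1 fun p hp q hq => hρ.2 p (hA hp) q (hC hq)

lemma Separates.symm {X : Type*} [PseudoMetricSpace X] {ρ : X → ℝ≥0∞} {A C : Set X}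
    (h : Separates ρ A C) : Separates ρ C A := fun p hp q hq =>
  (h q hq p hp).trans_eq (weightedDist_comm ρ q p)

lemma capacity_comm (A C : Set (𝔼 n)) : capacity A C = capacity C A :=
  le_antisymm (le_iInf₂ fun _ hρ => capacity_le hρ.1 hρ.2.symm)
    (le_iInf₂ fun _ hρ => capacity_le hρ.1 hρ.2.symm)

lemma lintegral_max_pow_le {Ω : Type*} [MeasurableSpace Ω] {μ : Measure Ω} {f g : Ω → ℝ≥0∞}
    (hf : Measurable f) (k : ℕ) :
    ∫⁻ x, (max (f x) (g x)) ^ k ∂μ ≤ (∫⁻ x, f x ^ k ∂μ) + ∫⁻ x, g x ^ k ∂μ := by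
  rw [← lintegral_add_left (hf.pow_const k)]
  refine lintegral_mono fun x => ?_
  rcases le_total (f x) (g x) with h | h
  · simp [max_eq_right h]
  · simp [max_eq_left h]

lemma lintegral_max_indicator_pow_le {Ω : Type*} [MeasurableSpace Ω] {μ : Measure Ω}
    {f g : Ω → ℝ≥0∞} (hf : Measurable f) {F : Set Ω} (hF : MeasurableSet F) {k : ℕ} (hk : k ≠ 0) :
    ∫⁻ x, (max (F.indicator f x) (g x)) ^ k ∂μ ≤
      (∫⁻ x in F, f x ^ k ∂μ) + ∫⁻ x, g x ^ k ∂μ := by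
  refine (lintegral_max_pow_le (hf.indicator hF) k).trans_eq ?_
  rw [← lintegral_indicator hF]
  congr 2 with x
  by_cases hx : x ∈ F <;> simp [hx, hk]

lemma capacity_union_le : capacity (A ∪ A') C ≤ capacity A C + capacity A' C := by
  refine ENNReal.le_of_forall_pos_le_add fun ε hε hfin => ?_
  have hε2 : (ε : ℝ≥0∞) / 2 ≠ 0 := by simpa using hε.ne'
  obtain ⟨hA, hA'⟩ := ENNReal.add_lt_top.1 hfin
  obtain ⟨ρ, hm, hρ, hint⟩ := exists_of_capacity_lt (ENNReal.lt_add_right hA.ne hε2)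
  obtain ⟨ρ', hm', hρ', hint'⟩ := exists_of_capacity_lt (ENNReal.lt_add_right hA'.ne hε2)
  have hsep : Separates (fun x => max (ρ x) (ρ' x)) (A ∪ A') C := by
    rintro p (hp | hp) q hq
    · exact (hρ p hp q hq).trans (weightedDist_mono (fun x => le_max_left _ _) _ _)
    · exact (hρ' p hp q hq).trans (weightedDist_mono (fun x => le_max_right _ _) _ _)
  calc capacity (A ∪ A') C ≤ ∫⁻ x, max (ρ x) (ρ' x) ^ n := capacity_le (hm.max hm') hsep
    _ ≤ (∫⁻ x, ρ x ^ n) + ∫⁻ x, ρ' x ^ n := lintegral_max_pow_le hm n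
    _ ≤ (capacity A C + ε / 2) + (capacity A' C + ε / 2) := add_le_add hint.le hint'.le
    _ = _ := by rw [add_add_add_comm, ENNReal.add_halves]

/-- The set of points at `ρ`-distance at least `1 / 2` from `C`. It contains the `ρ`-balls of
radius `1 / 2` around the points that `ρ` separates from `C`, and `2 * ρ` separates it from `C`. -/
def farFrom {X : Type*} [PseudoMetricSpace X] (ρ : X → ℝ≥0∞) (C : Set X) : Set X :=
  {z | ∀ q ∈ C, 1 / 2 ≤ weightedDist ρ z q}

section FarFrom

variable {X : Type*} [PseudoMetricSpace X] {ρ : X → ℝ≥0∞} {A C : Set X}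

lemma separates_two_mul (ρ : X → ℝ≥0∞) (C : Set X) :
    Separates (fun z => 2 * ρ z) (farFrom ρ C) C := fun p hp q hq =>
  calc (1 : ℝ≥0∞) = 2 * (1 / 2) := by
        rw [one_div, ENNReal.mul_inv_cancel two_ne_zero ENNReal.ofNat_ne_top]
    _ ≤ 2 * weightedDist ρ p q := by
        gcongr
        exact hp q hq
    _ ≤ _ := const_mul_weightedDist_le ENNReal.ofNat_ne_top ρ p q

lemma mem_farFrom_of_weightedDist_le (h : Separates ρ A C) {p z : X} (hp : p ∈ A)
    (hz : weightedDist ρ p z ≤ 1 / 2) : z ∈ farFrom ρ C := by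
  intro q hq
  by_contra! hlt
  have hone : (1 : ℝ≥0∞) < 1 / 2 + 1 / 2 :=
    ((h p hp q hq).trans (weightedDist_triangle ρ p z q)).trans_lt
      (ENNReal.add_lt_add_of_le_of_lt (hz.trans_lt (by simp)).ne hz hlt)
  rw [ENNReal.add_halves] at hone
  exact hone.false

lemma Separates.subset_farFrom (h : Separates ρ A C) : A ⊆ farFrom ρ C := fun p hp =>
  mem_farFrom_of_weightedDist_le h hp (by simp [weightedDist_self])

lemma farFrom_subset_compl (ρ : X → ℝ≥0∞) (C : Set X) : farFrom ρ C ⊆ Cᶜ := fun z hz hzC => by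
  simpa [weightedDist_self] using hz z hzC

end FarFrom

end Capacity

/-! ### The maximum norm -/

section BoxNorm

variable {n : ℕ}

/-- The maximum norm on Euclidean space. -/
def boxNorm (z : 𝔼 n) : ℝ := ‖WithLp.ofLp z‖

lemma boxNorm_nonneg (z : 𝔼 n) : 0 ≤ boxNorm z := norm_nonneg _

lemma boxNorm_add_le (z w : 𝔼 n) : boxNorm (z + w) ≤ boxNorm z + boxNorm w := norm_add_le _ _

lemma boxNorm_smul (r : ℝ) (z : 𝔼 n) : boxNorm (r • z) = |r| * boxNorm z := by
  simp [boxNorm, norm_smul]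

lemma abs_apply_le_boxNorm (z : 𝔼 n) (i : Fin n) : |z i| ≤ boxNorm z :=
  norm_le_pi_norm (WithLp.ofLp z) i

lemma boxNorm_le_iff {z : 𝔼 n} {r : ℝ} (hr : 0 ≤ r) : boxNorm z ≤ r ↔ ∀ i, |z i| ≤ r := by
  simpa [boxNorm] using pi_norm_le_iff_of_nonneg (x := WithLp.ofLp z) hr

lemma boxNorm_le_norm (z : 𝔼 n) : boxNorm z ≤ ‖z‖ :=
  (boxNorm_le_iff (norm_nonneg _)).2 fun i => PiLp.norm_apply_le z i

lemma norm_le_mul_boxNorm (z : 𝔼 n) : ‖z‖ ≤ n * boxNorm z := by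
  have hnonneg := boxNorm_nonneg z
  rw [EuclideanSpace.norm_eq]
  refine Real.sqrt_le_iff.2 ⟨by positivity, ?_⟩
  calc ∑ i, ‖z i‖ ^ 2 ≤ ∑ _i : Fin n, boxNorm z ^ 2 := by
        gcongr with i
        exact abs_apply_le_boxNorm z i
    _ = n * boxNorm z ^ 2 := by simp
    _ ≤ n ^ 2 * boxNorm z ^ 2 := by
        gcongr
        exact_mod_cast Nat.le_self_pow two_ne_zero n
    _ = (n * boxNorm z) ^ 2 := (mul_pow _ _ _).symm

lemma exists_abs_apply_eq_boxNorm (hn : 0 < n) (z : 𝔼 n) : ∃ i, |z i| = boxNorm z := by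
  have : Nonempty (Fin n) := ⟨⟨0, hn⟩⟩
  obtain ⟨i, hi⟩ := Finite.exists_max fun i => |z i|
  exact ⟨i, le_antisymm (abs_apply_le_boxNorm z i) ((boxNorm_le_iff (abs_nonneg _)).2 hi)⟩

lemma lipschitzWith_boxNorm_sub (c : 𝔼 n) : LipschitzWith 1 fun z : 𝔼 n => boxNorm (z - c) := by
  refine LipschitzWith.of_dist_le_mul fun x y => ?_
  rw [NNReal.coe_one, one_mul, Real.dist_eq, dist_eq_norm]
  calc |boxNorm (x - c) - boxNorm (y - c)| ≤ boxNorm (x - y) := by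
        simpa [boxNorm] using abs_norm_sub_norm_le (WithLp.ofLp (x - c)) (WithLp.ofLp (y - c))
    _ ≤ ‖x - y‖ := boxNorm_le_norm _

lemma continuous_boxNorm_sub (c : 𝔼 n) : Continuous fun z : 𝔼 n => boxNorm (z - c) :=
  (lipschitzWith_boxNorm_sub c).continuous

lemma volume_boxNorm_sub_le (c : 𝔼 n) {r : ℝ} (hr : 0 ≤ r) :
    volume {z : 𝔼 n | boxNorm (z - c) ≤ r} = ENNReal.ofReal (2 * r) ^ n := by
  have hbox : {z : 𝔼 n | boxNorm (z - c) ≤ r} =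
      WithLp.ofLp ⁻¹' Metric.closedBall (WithLp.ofLp c) r := by
    ext z
    simp [boxNorm, dist_eq_norm]
  rw [hbox, (PiLp.volume_preserving_ofLp (Fin n)).measure_preimage
    measurableSet_closedBall.nullMeasurableSet, Real.volume_pi_closedBall _ hr,
    ENNReal.ofReal_pow (by positivity), Fintype.card_fin]

end BoxNorm

/-! ### Thick rings have small capacity -/

section RingProfile

variable {n : ℕ}

/-- The `k`-th dyadic interval above `r`. -/
def dyadicIoc (r : ℝ) (k : ℕ) : Set ℝ := Ioc (2 ^ k * r) (2 ^ (k + 1) * r)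

lemma measurableSet_dyadicIoc (r : ℝ) (k : ℕ) : MeasurableSet (dyadicIoc r k) :=
  measurableSet_Ioc

/-- The radial profile of a weight for which crossing `N` dyadic rings has length at least `1`:
each of the rings contributes `1 / N`. -/
def ringProfile (N : ℕ) (r : ℝ) (v : ℝ) : ℝ≥0∞ :=
  ∑ k ∈ Finset.range N, (dyadicIoc r k).indicator
    (fun _ => ENNReal.ofReal ((N * (2 ^ k * r))⁻¹)) v

lemma measurable_ringProfile (N : ℕ) (r : ℝ) : Measurable (ringProfile N r) :=
  Finset.measurable_sum _ fun _ _ => measurable_const.indicator (measurableSet_dyadicIoc r _)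

lemma dyadicIoc_subset_Icc {N k : ℕ} (hk : k < N) {r a b : ℝ} (hr : 0 < r) (ha : a ≤ r)
    (hb : 2 ^ N * r ≤ b) : dyadicIoc r k ⊆ Icc a b := by
  refine Ioc_subset_Icc_self.trans (Icc_subset_Icc ?_ ?_)
  · exact ha.trans (le_mul_of_one_le_left hr.le (one_le_pow₀ one_le_two))
  · refine le_trans ?_ hb
    gcongr
    exacts [one_le_two, hk]

lemma pairwise_disjoint_dyadicIoc {r : ℝ} (hr : 0 ≤ r) :
    Pairwise (Function.onFun Disjoint (dyadicIoc r)) := by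
  have hmono : Monotone fun k : ℕ => 2 ^ k * r := fun a b hab => by
    dsimp only
    gcongr
    exact one_le_two
  exact hmono.pairwise_disjoint_on_Ioc_succ

lemma one_le_lintegral_ringProfile {N : ℕ} (hN : N ≠ 0) {r a b : ℝ} (hr : 0 < r) (ha : a ≤ r)
    (hb : 2 ^ N * r ≤ b) : 1 ≤ ∫⁻ v in uIcc a b, ringProfile N r v := by
  have hring : ∀ k ∈ Finset.range N, ∫⁻ v in uIcc a b, (dyadicIoc r k).indicator
      (fun _ => ENNReal.ofReal ((N * (2 ^ k * r))⁻¹)) v = (N : ℝ≥0∞)⁻¹ := fun k hk => by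
    have hsub : dyadicIoc r k ⊆ uIcc a b :=
      (dyadicIoc_subset_Icc (Finset.mem_range.1 hk) hr ha hb).trans Icc_subset_uIcc
    rw [lintegral_indicator (measurableSet_dyadicIoc r _),
      Measure.restrict_restrict (measurableSet_dyadicIoc r k),
      inter_eq_left.2 hsub, setLIntegral_const, dyadicIoc, Real.volume_Ioc,
      ← ENNReal.ofReal_mul (by positivity), ← ENNReal.ofReal_natCast N,
      ← ENNReal.ofReal_inv_of_pos (by positivity)]
    congr 1
    field_simp
    ring
  simp only [ringProfile]
  rw [lintegral_finsetSum _ fun _ _ => measurable_const.indicator (measurableSet_dyadicIoc r _),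
    Finset.sum_congr rfl hring, Finset.sum_const, Finset.card_range, nsmul_eq_mul,
    ENNReal.mul_inv_cancel (Nat.cast_ne_zero.2 hN) (ENNReal.natCast_ne_top N)]

lemma sum_indicator_pow {ι α R : Type*} [Semiring R] {A : ι → Set α}
    (hA : Pairwise (Function.onFun Disjoint A)) (s : Finset ι) (a : ι → R) {k : ℕ} (hk : k ≠ 0)
    (x : α) :
    (∑ i ∈ s, (A i).indicator (fun _ => a i) x) ^ k =
      ∑ i ∈ s, (A i).indicator (fun _ => a i ^ k) x := by
  by_cases hx : ∃ i ∈ s, x ∈ A i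
  · obtain ⟨i, hi, hxi⟩ := hx
    have hzero : ∀ j ∈ s, j ≠ i → x ∉ A j := fun j _ hj hxj => disjoint_left.1 (hA hj) hxj hxi
    rw [Finset.sum_eq_single_of_mem i hi fun j hj h => indicator_of_notMem (hzero j hj h) _,
      Finset.sum_eq_single_of_mem i hi fun j hj h => indicator_of_notMem (hzero j hj h) _,
      indicator_of_mem hxi, indicator_of_mem hxi]
  · push Not at hx
    rw [Finset.sum_eq_zero fun i hi => indicator_of_notMem (hx i hi) _,
      Finset.sum_eq_zero fun i hi => indicator_of_notMem (hx i hi) _, zero_pow hk]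

lemma measurableSet_boxNorm_sub_mem_dyadicIoc (c : 𝔼 n) (r : ℝ) (k : ℕ) :
    MeasurableSet {z | boxNorm (z - c) ∈ dyadicIoc r k} :=
  (continuous_boxNorm_sub c).measurable (measurableSet_dyadicIoc r k)

lemma mul_volume_dyadic_ring_le {N : ℕ} (hN : N ≠ 0) {r : ℝ} (hr : 0 < r) (c : 𝔼 n) (k : ℕ) :
    ENNReal.ofReal ((N * (2 ^ k * r))⁻¹) ^ n * volume {z | boxNorm (z - c) ∈ dyadicIoc r k} ≤
      ENNReal.ofReal ((4 / N) ^ n) :=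
  calc ENNReal.ofReal ((N * (2 ^ k * r))⁻¹) ^ n * volume {z | boxNorm (z - c) ∈ dyadicIoc r k}
      ≤ ENNReal.ofReal ((N * (2 ^ k * r))⁻¹) ^ n * ENNReal.ofReal (2 * (2 ^ (k + 1) * r)) ^ n := by
        rw [← volume_boxNorm_sub_le c (by positivity)]
        gcongr
        exact fun hz => hz.2
    _ = ENNReal.ofReal ((4 / N) ^ n) := by
        rw [← mul_pow, ← ENNReal.ofReal_mul (by positivity), ← ENNReal.ofReal_pow (by positivity)]
        congr 2
        field_simp
        ring

lemma natCast_mul_div_pow_le {m : ℕ} (hm : 2 ≤ m) {N : ℕ} (hN : N ≠ 0) {a : ℝ} (ha : 0 ≤ a) :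
    N * (a / N) ^ m ≤ a ^ m / N := by
  have hN1 : (1 : ℝ) ≤ N := by exact_mod_cast Nat.one_le_iff_ne_zero.2 hN
  rw [div_pow, mul_div_assoc', div_le_div_iff₀ (by positivity) (by positivity)]
  calc N * a ^ m * N = a ^ m * (N : ℝ) ^ 2 := by ring
    _ ≤ a ^ m * N ^ m := by gcongr

lemma lintegral_ringProfile_boxNorm_le (hn : 2 ≤ n) {N : ℕ} (hN : N ≠ 0) {r : ℝ} (hr : 0 < r)
    (c : 𝔼 n) :
    ∫⁻ z, ringProfile N r (boxNorm (z - c)) ^ n ≤ ENNReal.ofReal (4 ^ n / N) := by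
  have hpow : ∀ z, ringProfile N r (boxNorm (z - c)) ^ n =
      ∑ k ∈ Finset.range N, {z | boxNorm (z - c) ∈ dyadicIoc r k}.indicator
        (fun _ => ENNReal.ofReal ((N * (2 ^ k * r))⁻¹) ^ n) z := fun z =>
    sum_indicator_pow (pairwise_disjoint_dyadicIoc hr.le) _ _ (by lia) _
  simp_rw [hpow]
  rw [lintegral_finsetSum _ fun k _ =>
    measurable_const.indicator (measurableSet_boxNorm_sub_mem_dyadicIoc c r k)]
  calc ∑ k ∈ Finset.range N, ∫⁻ z, {z | boxNorm (z - c) ∈ dyadicIoc r k}.indicator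
        (fun _ => ENNReal.ofReal ((N * (2 ^ k * r))⁻¹) ^ n) z
      ≤ ∑ _k ∈ Finset.range N, ENNReal.ofReal ((4 / N) ^ n) := by
        refine Finset.sum_le_sum fun k _ => ?_
        rw [lintegral_indicator_const (measurableSet_boxNorm_sub_mem_dyadicIoc c r k)]
        exact mul_volume_dyadic_ring_le hN hr c k
    _ = ENNReal.ofReal (N * (4 / N) ^ n) := by
        rw [Finset.sum_const, Finset.card_range, nsmul_eq_mul, ENNReal.ofReal_mul (by positivity),
          ENNReal.ofReal_natCast]
    _ ≤ ENNReal.ofReal (4 ^ n / N) :=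
        ENNReal.ofReal_le_ofReal (natCast_mul_div_pow_le hn hN (by norm_num))

lemma separates_ringProfile {N : ℕ} (hN : N ≠ 0) {r : ℝ} (hr : 0 < r) (c : 𝔼 n) :
    Separates (fun z => ringProfile N r (boxNorm (z - c)))
      {p | boxNorm (p - c) ≤ r} {q | 2 ^ N * r ≤ boxNorm (q - c)} := by
  refine fun p hp q hq => le_weightedDist_iff.2 fun L γ hL hγ h0 h1 => ?_
  subst h0 h1
  have hradius : LipschitzWith 1 fun s => boxNorm (γ s - c) := by
    simpa [Function.comp_def] using (lipschitzWith_boxNorm_sub c).comp hγ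
  exact (one_le_lintegral_ringProfile hN hr hp hq).trans
    (setLIntegral_uIcc_le_setLIntegral_comp hradius hL (measurable_ringProfile N r))

lemma exists_capacity_ring_le (hn : 2 ≤ n) {ε : ℝ≥0∞} (hε : ε ≠ 0) :
    ∃ N : ℕ, N ≠ 0 ∧ ∀ (c : 𝔼 n) {r : ℝ}, 0 < r →
      capacity {p | boxNorm (p - c) ≤ r} {q | 2 ^ N * r ≤ boxNorm (q - c)} ≤ ε := by
  have hlim : Tendsto (fun N : ℕ => ENNReal.ofReal (4 ^ n / N)) atTop (𝓝 0) := by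
    simpa [Function.comp_def] using (ENNReal.continuous_ofReal.tendsto 0).comp
      (tendsto_const_div_atTop_nhds_zero_nat (4 ^ n))
  obtain ⟨N, hNε, hN⟩ :=
    ((hlim.eventually (ge_mem_nhds (pos_iff_ne_zero.2 hε))).and (eventually_ne_atTop 0)).exists
  refine ⟨N, hN, fun c r hr => ?_⟩
  exact (capacity_le ((measurable_ringProfile N r).comp (continuous_boxNorm_sub c).measurable)
    (separates_ringProfile hN hr c)).trans
      ((lintegral_ringProfile_boxNorm_le hn hN hr c).trans hNε)

end RingProfile

/-! ### Joining points by segments in the supercritical dimension -/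

section Segments

lemma le_add_inv_pow_mul_pow {a : ℝ≥0∞} (ha : a ≠ 0) (ha' : a ≠ ∞) (m : ℕ) (x : ℝ≥0∞) :
    x ≤ a + (a ^ m)⁻¹ * x ^ (m + 1) := by
  rcases le_total x a with h | h
  · exact h.trans le_self_add
  calc x = (a ^ m)⁻¹ * (a ^ m * x) := by
        rw [← mul_assoc, ENNReal.inv_mul_cancel (pow_ne_zero _ ha) (ENNReal.pow_ne_top ha'),
          one_mul]
    _ ≤ (a ^ m)⁻¹ * (x ^ m * x) := by gcongr
    _ = (a ^ m)⁻¹ * x ^ (m + 1) := by rw [pow_succ]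
    _ ≤ _ := le_add_self

lemma setLIntegral_le_mul_add {X : Type*} [MeasurableSpace X] (μ : Measure X) (f : X → ℝ≥0∞)
    (Q : Set X) {a : ℝ≥0∞} (ha : a ≠ 0) (ha' : a ≠ ∞) (m : ℕ) :
    ∫⁻ x in Q, f x ∂μ ≤ a * μ Q + (a ^ m)⁻¹ * ∫⁻ x, f x ^ (m + 1) ∂μ := by
  calc ∫⁻ x in Q, f x ∂μ ≤ ∫⁻ x in Q, (a + (a ^ m)⁻¹ * f x ^ (m + 1)) ∂μ :=
        lintegral_mono fun x => le_add_inv_pow_mul_pow ha ha' m _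
    _ = a * μ Q + (a ^ m)⁻¹ * ∫⁻ x in Q, f x ^ (m + 1) ∂μ := by
        rw [lintegral_add_left measurable_const, setLIntegral_const, lintegral_const_mul']
        exact ENNReal.inv_ne_top.2 (pow_ne_zero _ ha)
    _ ≤ a * μ Q + (a ^ m)⁻¹ * ∫⁻ x, f x ^ (m + 1) ∂μ := by
        gcongr
        exact Measure.restrict_le_self

lemma mul_add_inv_pow_mul_le {a b x : ℝ≥0∞} (ha : a ≠ 0) (ha' : a ≠ ∞) {m : ℕ}
    (hx : x ≤ a ^ m * (a * b)) : a * b + (a ^ m)⁻¹ * x ≤ 2 * (a * b) := by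
  calc a * b + (a ^ m)⁻¹ * x ≤ a * b + (a ^ m)⁻¹ * (a ^ m * (a * b)) := by gcongr
    _ = 2 * (a * b) := by
        rw [ENNReal.inv_mul_cancel_left (pow_ne_zero _ ha) (ENNReal.pow_ne_top ha'), two_mul]

lemma lintegral_Icc_rpow_lt_top {a : ℝ} (ha : -1 < a) :
    ∫⁻ t in Icc (0 : ℝ) 1, ENNReal.ofReal (t ^ a) < ∞ := by
  rw [← restrict_Ioo_eq_restrict_Icc]
  exact ((intervalIntegral.integrableOn_Ioo_rpow_iff one_pos).2 ha).lintegral_lt_top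

/-- The Morrey constant: the factor by which averaging over segments to a set of positive measure
in dimension `m` can increase an `L^(m+1)` norm. -/
def morreyConst (m : ℕ) : ℝ≥0∞ :=
  ∫⁻ t in Icc (0 : ℝ) 1, ENNReal.ofReal (t ^ (-(m / (m + 1)) : ℝ))

lemma morreyConst_ne_top (m : ℕ) : morreyConst m ≠ ∞ := by
  refine (lintegral_Icc_rpow_lt_top ?_).ne
  rw [neg_lt_neg_iff, div_lt_one (by positivity)]
  exact lt_add_one _

lemma rpow_neg_div_succ_pow_mul_pow {t : ℝ} (ht : 0 < t) (m : ℕ) :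
    (t ^ (-(m / (m + 1)) : ℝ)) ^ (m + 1) * t ^ m = 1 := by
  have hexp : (-(m / (m + 1)) : ℝ) * ((m + 1 : ℕ) : ℝ) + m = 0 := by
    push_cast
    field_simp
    ring
  rw [← Real.rpow_natCast, ← Real.rpow_mul ht.le, ← Real.rpow_natCast t m, ← Real.rpow_add ht,
    hexp, Real.rpow_zero]

variable {V : Type*} [NormedAddCommGroup V] [NormedSpace ℝ V] [MeasurableSpace V] [BorelSpace V]
  {m : ℕ} {μ : Measure V} {f : V → ℝ≥0∞}

lemma measurable_lintegral_segment (hf : Measurable f) (p : V) :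
    Measurable fun w => ∫⁻ t in Icc (0 : ℝ) 1, f (p + t • (w - p)) :=
  Measurable.lintegral_prod_right' (f := fun x : V × ℝ => f (p + x.2 • (x.1 - p)))
    (hf.comp (Continuous.measurable (by fun_prop)))

lemma exists_mem_segments_le {B a : ℝ≥0∞} {Q : Set V} (hQ : μ Q ≠ 0) (hQ' : μ Q ≠ ∞)
    (hf : Measurable f)
    (hB : ∀ p, ∫⁻ w in Q, (∫⁻ t in Icc (0 : ℝ) 1, f (p + t • (w - p))) ∂μ ≤ B)
    (hBa : B + B ≤ a * μ Q) (p q : V) :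
    ∃ w ∈ Q, ∫⁻ t in Icc (0 : ℝ) 1, f (p + t • (w - p)) ≤ a ∧
      ∫⁻ t in Icc (0 : ℝ) 1, f (q + t • (w - q)) ≤ a := by
  obtain ⟨w, hwQ, hw⟩ := exists_le_setLAverage hQ hQ'
    ((measurable_lintegral_segment hf p).add (measurable_lintegral_segment hf q)).aemeasurable
  simp only [setLAverage_eq, Pi.add_apply] at hw
  rw [lintegral_add_left (measurable_lintegral_segment hf p)] at hw
  have hle := hw.trans (ENNReal.div_le_of_le_mul ((add_le_add (hB p) (hB q)).trans hBa))
  exact ⟨w, hwQ, le_self_add.trans hle, le_add_self.trans hle⟩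

variable [FiniteDimensional ℝ V] [μ.IsAddHaarMeasure]

lemma lintegral_comp_homothety (hm : Module.finrank ℝ V = m) (f : V → ℝ≥0∞) (p : V) {t : ℝ}
    (ht : 0 < t) :
    ∫⁻ w, f (p + t • (w - p)) ∂μ = ENNReal.ofReal ((t ^ m)⁻¹) * ∫⁻ z, f z ∂μ := by
  have hcenter : ∀ w, p + t • (w - p) = (p - t • p) + t • w := fun w => by
    rw [smul_sub]
    abel
  simp_rw [hcenter]
  rw [lintegral_comp_add_smul μ f _ ht.ne', hm, abs_of_pos (by positivity)]

lemma setLIntegral_comp_homothety_le (hm : Module.finrank ℝ V = m) (f : V → ℝ≥0∞) (p : V)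
    (Q : Set V) {κ : ℝ≥0∞} (hκ : κ ≠ 0) (hκ' : κ ≠ ∞) {t : ℝ} (ht : 0 < t) :
    ∫⁻ w in Q, f (p + t • (w - p)) ∂μ ≤
      ENNReal.ofReal (t ^ (-(m / (m + 1)) : ℝ)) *
        (κ * μ Q + (κ ^ m)⁻¹ * ∫⁻ z, f z ^ (m + 1) ∂μ) := by
  set x : ℝ := t ^ (-(m / (m + 1)) : ℝ)
  have hx : 0 < x := Real.rpow_pos_of_pos ht _
  have hxt : (x ^ m)⁻¹ * (t ^ m)⁻¹ = x := by
    rw [← mul_inv]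
    refine (eq_inv_of_mul_eq_one_left ?_).symm
    rw [← mul_assoc, ← pow_succ']
    exact rpow_neg_div_succ_pow_mul_pow ht m
  set l : ℝ≥0∞ := κ * ENNReal.ofReal x with hl
  have hl0 : l ≠ 0 := mul_ne_zero hκ (by simpa using hx)
  have hl_top : l ≠ ∞ := ENNReal.mul_ne_top hκ' ENNReal.ofReal_ne_top
  have hscale : (l ^ m)⁻¹ * ENNReal.ofReal ((t ^ m)⁻¹) = ENNReal.ofReal x * (κ ^ m)⁻¹ := by
    rw [hl, mul_pow, ENNReal.mul_inv (Or.inl (pow_ne_zero _ hκ))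
      (Or.inl (ENNReal.pow_ne_top hκ')), ← ENNReal.ofReal_pow hx.le,
      ← ENNReal.ofReal_inv_of_pos (by positivity), mul_assoc, ← ENNReal.ofReal_mul (by positivity),
      hxt, mul_comm]
  calc ∫⁻ w in Q, f (p + t • (w - p)) ∂μ
      ≤ l * μ Q + (l ^ m)⁻¹ * ∫⁻ w, f (p + t • (w - p)) ^ (m + 1) ∂μ :=
        setLIntegral_le_mul_add μ _ Q hl0 hl_top m
    _ = _ := by
        rw [lintegral_comp_homothety hm (fun z => f z ^ (m + 1)) p ht, ← mul_assoc, hscale, hl]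
        ring

lemma lintegral_segments_le (hm : Module.finrank ℝ V = m) (hf : Measurable f) (p : V)
    (Q : Set V) {κ : ℝ≥0∞} (hκ : κ ≠ 0) (hκ' : κ ≠ ∞) :
    ∫⁻ w in Q, (∫⁻ t in Icc (0 : ℝ) 1, f (p + t • (w - p))) ∂μ ≤
      morreyConst m * (κ * μ Q + (κ ^ m)⁻¹ * ∫⁻ z, f z ^ (m + 1) ∂μ) := by
  have hmeas : Measurable fun x : V × ℝ => f (p + x.2 • (x.1 - p)) :=
    hf.comp (Continuous.measurable (by fun_prop))
  rw [lintegral_lintegral_swap hmeas.aemeasurable, morreyConst,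
    ← lintegral_mul_const _ (by fun_prop), ← restrict_Ioc_eq_restrict_Icc]
  exact setLIntegral_mono' measurableSet_Ioc fun t ht =>
    setLIntegral_comp_homothety_le hm f p Q hκ hκ' ht.1

-- Morrey's inequality: the exponent `m + 1` exceeds the dimension `m`.
lemma exists_short_segments (hm : Module.finrank ℝ V = m) {Q : Set V} (hQ : μ Q ≠ 0)
    (hQ' : μ Q ≠ ∞) {ε : ℝ≥0∞} (hε : ε ≠ 0) :
    ∃ η : ℝ≥0∞, η ≠ 0 ∧ ∀ f : V → ℝ≥0∞, Measurable f → ∫⁻ z, f z ^ (m + 1) ∂μ ≤ η →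
      ∀ p q, ∃ w ∈ Q, ∫⁻ t in Icc (0 : ℝ) 1, f (p + t • (w - p)) ≤ ε ∧
        ∫⁻ t in Icc (0 : ℝ) 1, f (q + t • (w - q)) ≤ ε := by
  obtain ⟨δ, hδ0, hδε⟩ := ENNReal.lt_iff_exists_nnreal_btwn.1 (pos_iff_ne_zero.2 hε)
  set M := morreyConst m
  have hM0 : 4 * (M + 1) ≠ 0 := by simp
  have hM : 4 * (M + 1) ≠ ∞ :=
    ENNReal.mul_ne_top (by simp) (by simpa using morreyConst_ne_top m)
  set κ : ℝ≥0∞ := δ / (4 * (M + 1)) with hκ_def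
  have hκ0 : κ ≠ 0 := (ENNReal.div_pos hδ0.ne' hM).ne'
  have hκ : κ ≠ ∞ := (ENNReal.div_lt_top ENNReal.coe_ne_top hM0).ne
  refine ⟨κ ^ m * (κ * μ Q), mul_ne_zero (pow_ne_zero _ hκ0) (mul_ne_zero hκ0 hQ),
    fun f hf henergy p q => ?_⟩
  have hbound : ∀ p, ∫⁻ w in Q, (∫⁻ t in Icc (0 : ℝ) 1, f (p + t • (w - p))) ∂μ ≤
      M * (2 * (κ * μ Q)) := fun p => by
    refine (lintegral_segments_le hm hf p Q hκ0 hκ).trans ?_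
    gcongr
    exact mul_add_inv_pow_mul_le hκ0 hκ henergy
  refine exists_mem_segments_le hQ hQ' hf hbound ?_ p q
  calc M * (2 * (κ * μ Q)) + M * (2 * (κ * μ Q)) = (4 * M) * κ * μ Q := by ring
    _ ≤ (4 * (M + 1)) * κ * μ Q := by
        gcongr
        exact le_self_add
    _ = δ * μ Q := by rw [hκ_def, ENNReal.mul_div_cancel hM0 hM]
    _ ≤ ε * μ Q := by gcongr

end Segments

/-! ### Slices and diagonals -/

section Slices

variable {m : ℕ}

/-- The point with `i`-th coordinate `t` and remaining coordinates `y`. -/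
def slicePoint (i : Fin (m + 1)) (t : ℝ) (y : Fin m → ℝ) : 𝔼 (m + 1) :=
  WithLp.toLp 2 (i.insertNth t y)

lemma measurePreserving_slicePoint (i : Fin (m + 1)) :
    MeasurePreserving fun x : ℝ × (Fin m → ℝ) => slicePoint i x.1 x.2 :=
  (PiLp.volume_preserving_toLp (Fin (m + 1))).comp
    (volume_preserving_piFinSuccAbove (fun _ : Fin (m + 1) => ℝ) i).symm

lemma slicePoint_removeNth (i : Fin (m + 1)) (p : 𝔼 (m + 1)) :
    slicePoint i (p i) (i.removeNth (WithLp.ofLp p)) = p := by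
  simp [slicePoint]

lemma slicePoint_add_smul_sub (i : Fin (m + 1)) (t s : ℝ) (y w : Fin m → ℝ) :
    slicePoint i t y + s • (slicePoint i t w - slicePoint i t y) =
      slicePoint i t (y + s • (w - y)) := by
  ext j
  refine Fin.succAboveCases i ?_ (fun k => ?_) j <;> simp [slicePoint]

lemma boxNorm_slicePoint_sub_le (i : Fin (m + 1)) (t : ℝ) (y w : Fin m → ℝ) :
    boxNorm (slicePoint i t w - slicePoint i t y) ≤ ‖w - y‖ := by
  refine (boxNorm_le_iff (norm_nonneg _)).2 fun j => ?_
  refine Fin.succAboveCases i ?_ (fun k => ?_) j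
  · simp [slicePoint]
  · simpa [slicePoint] using norm_le_pi_norm (w - y) k

lemma norm_removeNth_le (i : Fin (m + 1)) (p : 𝔼 (m + 1)) :
    ‖i.removeNth (WithLp.ofLp p)‖ ≤ boxNorm p :=
  (pi_norm_le_iff_of_nonneg (boxNorm_nonneg p)).2 fun k => abs_apply_le_boxNorm p (i.succAbove k)

lemma exists_slice_energy_le {ρ : 𝔼 (m + 1) → ℝ≥0∞} (hρ : Measurable ρ) (i : Fin (m + 1)) (k : ℕ)
    {T : Set ℝ} {δ a : ℝ≥0∞} (hT : δ ≤ volume T) (h : ∫⁻ z, ρ z ^ k < a * δ) :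
    ∃ t ∈ T, ∫⁻ y, ρ (slicePoint i t y) ^ k ≤ a := by
  by_contra! hlarge
  have hslice := measurePreserving_slicePoint i
  have hmeas : Measurable fun x : ℝ × (Fin m → ℝ) => ρ (slicePoint i x.1 x.2) ^ k :=
    (hρ.comp hslice.measurable).pow_const _
  refine h.not_ge ?_
  calc a * δ ≤ a * volume {t | a ≤ ∫⁻ y, ρ (slicePoint i t y) ^ k} := by
        gcongr
        exact hT.trans (measure_mono fun t ht => (hlarge t ht).le)
    _ ≤ ∫⁻ t, ∫⁻ y, ρ (slicePoint i t y) ^ k :=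
        mul_meas_ge_le_lintegral (Measurable.lintegral_prod_right' hmeas) a
    _ = ∫⁻ z, ρ z ^ k := by
        rw [← hslice.lintegral_comp (hρ.pow_const _)]
        exact (lintegral_prod _ hmeas.aemeasurable).symm

lemma weightedDist_slicePoint_le (ρ : 𝔼 (m + 1) → ℝ≥0∞) (i : Fin (m + 1)) (t : ℝ)
    (y w : Fin m → ℝ) {R : ℝ} (hR : 0 < R) (h : ‖w - y‖ ≤ R) :
    weightedDist ρ (slicePoint i t y) (slicePoint i t w) ≤
      ENNReal.ofReal ((m + 1) * R) *
        ∫⁻ s in Icc (0 : ℝ) 1, ρ (slicePoint i t (y + s • (w - y))) := by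
  have hnorm : ‖slicePoint i t w - slicePoint i t y‖ ≤ (m + 1) * R := by
    refine (norm_le_mul_boxNorm _).trans ?_
    push_cast
    gcongr
    exact (boxNorm_slicePoint_sub_le i t y w).trans h
  simpa only [slicePoint_add_smul_sub] using weightedDist_le_segment (ρ := ρ) (by positivity) hnorm

lemma exists_slice_weightedDist_le (m : ℕ) {ε : ℝ≥0∞} (hε : ε ≠ 0) {H : ℝ} (hH : 0 < H) :
    ∃ η : ℝ≥0∞, η ≠ 0 ∧ ∀ ρ : 𝔼 (m + 1) → ℝ≥0∞, Measurable ρ →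
      ∀ (i : Fin (m + 1)) (t : ℝ), ∫⁻ y, ρ (slicePoint i t y) ^ (m + 1) ≤ η →
      ∀ p q : 𝔼 (m + 1), p i = t → q i = t → boxNorm p ≤ H → boxNorm q ≤ H →
        weightedDist ρ p q ≤ ε := by
  set K : ℝ≥0∞ := ENNReal.ofReal ((m + 1) * (1 + H))
  have hK : K ≠ 0 := (ENNReal.ofReal_pos.2 (by positivity)).ne'
  obtain ⟨η, hη, hshort⟩ := exists_short_segments (μ := volume) (V := Fin m → ℝ)
    (Module.finrank_fin_fun ℝ) (Metric.measure_closedBall_pos volume 0 one_pos).ne'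
    measure_closedBall_lt_top.ne
    (ENNReal.div_pos (ENNReal.half_pos hε).ne' ENNReal.ofReal_ne_top : 0 < ε / 2 / K).ne'
  refine ⟨η, hη, fun ρ hρ i t henergy p q hp hq hpH hqH => ?_⟩
  have hmeas : Measurable fun y => ρ (slicePoint i t y) :=
    (hρ.comp (measurePreserving_slicePoint i).measurable).comp measurable_prodMk_left
  obtain ⟨w, hw, hpw, hqw⟩ := hshort _ hmeas henergy (i.removeNth (WithLp.ofLp p))
    (i.removeNth (WithLp.ofLp q))
  have half : ∀ p : 𝔼 (m + 1), p i = t → boxNorm p ≤ H →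
      ∫⁻ s in Icc (0 : ℝ) 1, ρ (slicePoint i t (i.removeNth (WithLp.ofLp p) +
        s • (w - i.removeNth (WithLp.ofLp p)))) ≤ ε / 2 / K →
      weightedDist ρ p (slicePoint i t w) ≤ ε / 2 := fun p hp hpH hle => by
    have hnorm : ‖w - i.removeNth (WithLp.ofLp p)‖ ≤ 1 + H :=
      (norm_sub_le _ _).trans
        (add_le_add (mem_closedBall_zero_iff.1 hw) ((norm_removeNth_le i p).trans hpH))
    have hdist := weightedDist_slicePoint_le ρ i t _ w (by positivity) hnorm
    rw [← hp, slicePoint_removeNth, hp] at hdist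
    exact hdist.trans ((mul_le_mul_right hle _).trans_eq
      (ENNReal.mul_div_cancel hK ENNReal.ofReal_ne_top))
  calc weightedDist ρ p q ≤ _ := weightedDist_triangle_right ρ p q (slicePoint i t w)
    _ ≤ ε / 2 + ε / 2 := add_le_add (half p hp hpH hpw) (half q hq hqH hqw)
    _ = ε := ENNReal.add_halves ε

end Slices

section Lines

variable {V : Type*} [NormedAddCommGroup V] [NormedSpace ℝ V]

lemma weightedDist_add_smul_le (ρ : V → ℝ≥0∞) (y v : V) {s H : ℝ} (hs : |s| ≤ H) :
    weightedDist ρ y (y + s • v) ≤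
      ENNReal.ofReal (‖v‖ + 1) * ∫⁻ t in Icc (-H) H, ρ (y + t • v) := by
  obtain ⟨hsl, hsu⟩ := abs_le.1 hs
  have hline : ∀ a b : ℝ, dist (y + a • v) (y + b • v) ≤ (‖v‖ + 1) * dist a b := fun a b => by
    rw [dist_add_left, dist_eq_norm, ← sub_smul, norm_smul, mul_comm, dist_eq_norm a b]
    gcongr
    exact le_add_of_nonneg_right zero_le_one
  have hpos : 0 < ‖v‖ + 1 := by positivity
  rcases le_total 0 s with h | h
  · have hle := weightedDist_comp_line_le (ρ := ρ) hpos hline h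
    rw [zero_smul, add_zero] at hle
    refine hle.trans (mul_le_mul_right (lintegral_mono_set (Icc_subset_Icc ?_ hsu)) _)
    linarith
  · have hle := weightedDist_comp_line_le (ρ := ρ) hpos hline h
    rw [zero_smul, add_zero, weightedDist_comm] at hle
    refine hle.trans (mul_le_mul_right (lintegral_mono_set (Icc_subset_Icc hsl ?_)) _)
    linarith

variable [MeasurableSpace V] [BorelSpace V] {μ : Measure V} [μ.IsAddHaarMeasure] [SFinite μ]
  {f : V → ℝ≥0∞}

lemma lintegral_lines_le (hf : Measurable f) (v : V) (Q : Set V) (H : ℝ) {κ : ℝ≥0∞}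
    (hκ : κ ≠ 0) (hκ' : κ ≠ ∞) (m : ℕ) :
    ∫⁻ y in Q, (∫⁻ t in Icc (-H) H, f (y + t • v)) ∂μ ≤
      ENNReal.ofReal (2 * H) * (κ * μ Q + (κ ^ m)⁻¹ * ∫⁻ z, f z ^ (m + 1) ∂μ) := by
  have hmeas : Measurable fun x : V × ℝ => f (x.1 + x.2 • v) :=
    hf.comp (Continuous.measurable (by fun_prop))
  have hslice : ∀ t : ℝ, ∫⁻ y in Q, f (y + t • v) ∂μ ≤
      κ * μ Q + (κ ^ m)⁻¹ * ∫⁻ z, f z ^ (m + 1) ∂μ := fun t => by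
    rw [← lintegral_add_right_eq_self (fun z => f z ^ (m + 1)) (t • v)]
    exact setLIntegral_le_mul_add μ _ Q hκ hκ' m
  rw [lintegral_lintegral_swap hmeas.aemeasurable]
  refine (lintegral_mono hslice).trans_eq ?_
  rw [setLIntegral_const, Real.volume_Icc, mul_comm]
  congr 2
  ring

lemma exists_short_line (μ : Measure V) [μ.IsAddHaarMeasure] [SFinite μ] (v : V) {Q : Set V}
    (hQ : μ Q ≠ 0) (hQ' : μ Q ≠ ∞) (m : ℕ) {ε : ℝ≥0∞} (hε : ε ≠ 0) {H : ℝ} (hH : 0 < H) :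
    ∃ η : ℝ≥0∞, η ≠ 0 ∧ ∀ ρ : V → ℝ≥0∞, Measurable ρ → ∫⁻ z, ρ z ^ (m + 1) ∂μ ≤ η →
      ∃ y ∈ Q, ∀ s : ℝ, |s| ≤ H → weightedDist ρ y (y + s • v) ≤ ε := by
  obtain ⟨δ, hδ0, hδε⟩ := ENNReal.lt_iff_exists_nnreal_btwn.1 (pos_iff_ne_zero.2 hε)
  set K : ℝ≥0∞ := ENNReal.ofReal (‖v‖ + 1)
  set k : ℝ≥0∞ := 2 * (K * ENNReal.ofReal (2 * H))
  have hk0 : k ≠ 0 := mul_ne_zero two_ne_zero <| mul_ne_zero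
    (ENNReal.ofReal_pos.2 (by positivity)).ne' (ENNReal.ofReal_pos.2 (by positivity)).ne'
  have hk : k ≠ ∞ := ENNReal.mul_ne_top ENNReal.ofNat_ne_top
    (ENNReal.mul_ne_top ENNReal.ofReal_ne_top ENNReal.ofReal_ne_top)
  set κ : ℝ≥0∞ := δ / k with hκ_def
  have hκ0 : κ ≠ 0 := (ENNReal.div_pos hδ0.ne' hk).ne'
  have hκ : κ ≠ ∞ := (ENNReal.div_lt_top ENNReal.coe_ne_top hk0).ne
  refine ⟨κ ^ m * (κ * μ Q), mul_ne_zero (pow_ne_zero _ hκ0) (mul_ne_zero hκ0 hQ),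
    fun ρ hρ henergy => ?_⟩
  have hmeas : Measurable fun y => ∫⁻ t in Icc (-H) H, ρ (y + t • v) :=
    Measurable.lintegral_prod_right' (f := fun x : V × ℝ => ρ (x.1 + x.2 • v))
      (hρ.comp (Continuous.measurable (by fun_prop)))
  have hmean : ∫⁻ y in Q, (∫⁻ t in Icc (-H) H, ρ (y + t • v)) ∂μ ≤
      ENNReal.ofReal (2 * H) * (2 * κ) * μ Q := by
    rw [mul_assoc, mul_assoc]
    exact (lintegral_lines_le hρ v Q H hκ0 hκ m).trans
      (mul_le_mul_right (mul_add_inv_pow_mul_le hκ0 hκ henergy) _)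
  obtain ⟨y, hyQ, hy⟩ := exists_le_setLAverage hQ hQ' hmeas.aemeasurable
  rw [setLAverage_eq] at hy
  refine ⟨y, hyQ, fun s hs => ?_⟩
  calc weightedDist ρ y (y + s • v) ≤ K * ∫⁻ t in Icc (-H) H, ρ (y + t • v) :=
        weightedDist_add_smul_le ρ y v hs
    _ ≤ K * (ENNReal.ofReal (2 * H) * (2 * κ)) := by
        gcongr
        exact hy.trans (ENNReal.div_le_of_le_mul hmean)
    _ = k * κ := by ring
    _ = δ := by rw [hκ_def, ENNReal.mul_div_cancel hk0 hk]
    _ ≤ ε := hδε.le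

end Lines

section Diagonal

/-- The vector with all coordinates equal to `1`. -/
def diagonal (n : ℕ) : 𝔼 n := WithLp.toLp 2 fun _ => 1

lemma diagonal_apply {n : ℕ} (i : Fin n) : diagonal n i = 1 := rfl

lemma boxNorm_diagonal_le (n : ℕ) : boxNorm (diagonal n) ≤ 1 :=
  (boxNorm_le_iff zero_le_one).2 fun i => by simp [diagonal_apply]

lemma boxNorm_add_smul_diagonal_le {n : ℕ} {y : 𝔼 n} {s a b : ℝ} (hy : boxNorm y ≤ a)
    (hs : |s| ≤ b) : boxNorm (y + s • diagonal n) ≤ a + b := by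
  refine (boxNorm_add_le _ _).trans (add_le_add hy ?_)
  rw [boxNorm_smul]
  exact (mul_le_of_le_one_right (abs_nonneg s) (boxNorm_diagonal_le n)).trans hs

lemma exists_short_diagonal (m : ℕ) {ε : ℝ≥0∞} (hε : ε ≠ 0) {H : ℝ} (hH : 0 < H) :
    ∃ η : ℝ≥0∞, η ≠ 0 ∧ ∀ ρ : 𝔼 (m + 1) → ℝ≥0∞, Measurable ρ → ∫⁻ z, ρ z ^ (m + 1) ≤ η →
      ∃ y, boxNorm y ≤ 1 ∧ ∀ s : ℝ, |s| ≤ H → weightedDist ρ y (y + s • diagonal (m + 1)) ≤ ε := by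
  have hvol : volume {z : 𝔼 (m + 1) | boxNorm z ≤ 1} = ENNReal.ofReal (2 * 1) ^ (m + 1) := by
    simpa only [sub_zero] using volume_boxNorm_sub_le (0 : 𝔼 (m + 1)) zero_le_one
  have hvol0 : volume {z : 𝔼 (m + 1) | boxNorm z ≤ 1} ≠ 0 := by simp [hvol]
  exact exists_short_line volume (diagonal (m + 1)) hvol0
    (hvol ▸ ENNReal.pow_ne_top ENNReal.ofReal_ne_top) m hε hH

-- A diagonal segment meets every coordinate slice it passes, so any set with many slices is close
-- to it through one slice of small energy.
lemma exists_diagonal_near (m : ℕ) {ε δ : ℝ≥0∞} (hε : ε ≠ 0) (hδ : δ ≠ 0) {H : ℝ} (hH : 0 < H) :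
    ∃ η : ℝ≥0∞, η ≠ 0 ∧ ∀ ρ : 𝔼 (m + 1) → ℝ≥0∞, Measurable ρ → ∫⁻ z, ρ z ^ (m + 1) ≤ η →
      ∃ y : 𝔼 (m + 1), boxNorm y ≤ 1 ∧
        (∀ s : ℝ, |s| ≤ H + 1 → weightedDist ρ y (y + s • diagonal (m + 1)) < ε) ∧
        ∀ A : Set (𝔼 (m + 1)), (∀ p ∈ A, boxNorm p ≤ H) →
          ∀ i, δ ≤ volume ((fun p : 𝔼 (m + 1) => p i) '' A) → ∃ p ∈ A, weightedDist ρ y p < ε := by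
  obtain ⟨ε', hε'0, hε'ε⟩ := exists_between (pos_iff_ne_zero.2 hε)
  have hhalf : ε' / 2 ≠ 0 := (ENNReal.half_pos hε'0.ne').ne'
  obtain ⟨η₁, hη₁, hdiag⟩ := exists_short_diagonal m hhalf (H := H + 1) (by linarith)
  obtain ⟨η₂, hη₂, hslice⟩ := exists_slice_weightedDist_le m hhalf (H := 1 + (H + 1)) (by linarith)
  obtain ⟨η₃, hη₃, hη₃lt⟩ := exists_between (pos_iff_ne_zero.2 (mul_ne_zero hη₂ hδ))
  refine ⟨min η₁ η₃, (lt_min (pos_iff_ne_zero.2 hη₁) hη₃).ne', fun ρ hρ henergy => ?_⟩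
  obtain ⟨y, hy, hydiag⟩ := hdiag ρ hρ (henergy.trans (min_le_left _ _))
  refine ⟨y, hy, fun s hs => (hydiag s hs).trans_lt (ENNReal.half_le_self.trans_lt hε'ε),
    fun A hAH i hA => ?_⟩
  obtain ⟨t, ⟨p, hpA, hpt : p i = t⟩, ht⟩ := exists_slice_energy_le hρ i (m + 1) hA
    ((henergy.trans (min_le_right _ _)).trans_lt hη₃lt)
  have hpH := hAH p hpA
  have hs : |t - y i| ≤ H + 1 := (abs_sub _ _).trans <| add_le_add
    (hpt ▸ (abs_apply_le_boxNorm p i).trans hpH) ((abs_apply_le_boxNorm y i).trans hy)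
  set q := y + (t - y i) • diagonal (m + 1)
  have hq : q i = t := by simp [q, diagonal_apply]
  refine ⟨p, hpA, ?_⟩
  calc weightedDist ρ y p ≤ weightedDist ρ y q + weightedDist ρ q p := weightedDist_triangle ρ y q p
    _ ≤ ε' / 2 + ε' / 2 := add_le_add (hydiag _ hs) <| hslice ρ hρ i t ht q p hq hpt
        (boxNorm_add_smul_diagonal_le hy hs) (hpH.trans (by linarith))
    _ = ε' := ENNReal.add_halves ε'
    _ < ε := hε'ε

end Diagonal

/-! ### Hubs of rings -/

section Hub

variable {n : ℕ}

/-- A closed ring for the maximum norm. -/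
def boxRing (c : 𝔼 n) (a b : ℝ) : Set (𝔼 n) := {z | boxNorm (z - c) ∈ Icc a b}

lemma isClosed_boxRing (c : 𝔼 n) (a b : ℝ) : IsClosed (boxRing c a b) :=
  isClosed_Icc.preimage (continuous_boxNorm_sub c)

lemma mem_boxRing_zero {z : 𝔼 n} {a b : ℝ} : z ∈ boxRing 0 a b ↔ boxNorm z ∈ Icc a b := by
  rw [boxRing, mem_ofPred_eq, sub_zero]

lemma boxNorm_homothety_sub (c u : 𝔼 n) {r : ℝ} (hr : 0 ≤ r) :
    boxNorm (c + r • u - c) = r * boxNorm u := by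
  rw [add_sub_cancel_left, boxNorm_smul, abs_of_nonneg hr]

lemma preimage_homothety_boxRing (c : 𝔼 n) {r : ℝ} (hr : 0 < r) (a b : ℝ) :
    (fun u => c + r • u) ⁻¹' boxRing c (r * a) (r * b) = boxRing 0 a b := by
  ext u
  simp only [mem_preimage, mem_boxRing_zero]
  simp only [boxRing, mem_ofPred_eq, boxNorm_homothety_sub c u hr.le, mem_Icc,
    mul_le_mul_iff_right₀ hr]

/-- `A` is large at scale `r` around `c`: some coordinate takes many values on the part of `A` at
distance about `r` from `c`. -/
def IsLargeAt (c : 𝔼 n) (r : ℝ) (A : Set (𝔼 n)) : Prop :=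
  ∃ i, ENNReal.ofReal (r / (2 * n)) ≤
    volume ((fun p : 𝔼 n => p i) '' (A ∩ boxRing c (r / 10) (10 * r)))

lemma IsLargeAt.mono {c : 𝔼 n} {r : ℝ} {A B : Set (𝔼 n)} (hA : IsLargeAt c r A) (hAB : A ⊆ B) :
    IsLargeAt c r B := by
  obtain ⟨i, hi⟩ := hA
  exact ⟨i, hi.trans (measure_mono (image_mono (inter_subset_inter_left _ hAB)))⟩

lemma isLargeAt_preimage_homothety {c : 𝔼 n} {r : ℝ} (hr : 0 < r) {s : ℝ} {A : Set (𝔼 n)} :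
    IsLargeAt 0 s ((fun u => c + r • u) ⁻¹' A) ↔ IsLargeAt c (r * s) A := by
  have hsurj : Function.Surjective fun u : 𝔼 n => c + r • u := fun p =>
    ⟨r⁻¹ • (p - c), by simp [smul_inv_smul₀ hr.ne']⟩
  refine exists_congr fun i => ?_
  set T := (fun p : 𝔼 n => p i) '' (A ∩ boxRing c (r * s / 10) (10 * (r * s)))
  have himage : (fun u : 𝔼 n => u i) ''
      ((fun u => c + r • u) ⁻¹' A ∩ boxRing 0 (s / 10) (10 * s)) =
      (fun t => r * t) ⁻¹' ((fun t => c i + t) ⁻¹' T) := by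
    rw [← preimage_homothety_boxRing c hr, ← mul_div_assoc, mul_left_comm, ← preimage_inter]
    ext t
    constructor
    · rintro ⟨u, hu, rfl⟩
      exact ⟨_, hu, by simp⟩
    · rintro ⟨p, hp, hpt⟩
      obtain ⟨u, rfl⟩ := hsurj p
      exact ⟨u, hp, by simpa [hr.ne'] using hpt⟩
  have hr0 : ENNReal.ofReal r ≠ 0 := (ENNReal.ofReal_pos.2 hr).ne'
  rw [himage, Real.volume_preimage_mul_left hr.ne', measure_preimage_add,
    abs_of_pos (by positivity), ENNReal.ofReal_inv_of_pos hr, mul_comm _⁻¹, ← div_eq_mul_inv,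
    ENNReal.le_div_iff_mul_le (Or.inl hr0) (Or.inl ENNReal.ofReal_ne_top), mul_comm,
    ← ENNReal.ofReal_mul hr.le, mul_div_assoc]

lemma Icc_subset_iUnion_preimage_image (hn : 0 < n) {c : 𝔼 n} {A : Set (𝔼 n)} {a b : ℝ}
    (h : ∀ t ∈ Icc a b, ∃ p ∈ A, boxNorm (p - c) = t) :
    Icc a b ⊆ ⋃ i, ((fun t => c i + t) ⁻¹' ((fun p : 𝔼 n => p i) '' (A ∩ boxRing c a b)) ∪
      (fun t => c i - t) ⁻¹' ((fun p : 𝔼 n => p i) '' (A ∩ boxRing c a b))) := by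
  intro t ht
  obtain ⟨p, hpA, rfl⟩ := h t ht
  obtain ⟨i, hi⟩ := exists_abs_apply_eq_boxNorm hn (p - c)
  refine mem_iUnion.2 ⟨i, ?_⟩
  rcases abs_choice ((p - c) i) with habs | habs
  · refine Or.inl ⟨p, ⟨hpA, ht⟩, show p i = c i + boxNorm (p - c) from ?_⟩
    rw [← hi, habs, PiLp.sub_apply, add_sub_cancel]
  · refine Or.inr ⟨p, ⟨hpA, ht⟩, show p i = c i - boxNorm (p - c) from ?_⟩
    rw [← hi, habs, PiLp.sub_apply, sub_neg_eq_add, add_sub_cancel]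

lemma volume_preimage_add_union_preimage_sub_le (a : ℝ) (T : Set ℝ) :
    volume ((fun t => a + t) ⁻¹' T ∪ (fun t => a - t) ⁻¹' T) ≤ 2 * volume T := by
  refine (measure_union_le _ _).trans_eq ?_
  rw [measure_preimage_add, (Measure.measurePreserving_sub_left volume a).measure_preimage_emb
    (MeasurableEquiv.subLeft a).measurableEmbedding, two_mul]

lemma isLargeAt_of_forall_exists_boxNorm_eq (hn : 0 < n) {c : 𝔼 n} {r : ℝ} (hr : 0 < r)
    {A : Set (𝔼 n)} (h : ∀ t ∈ Icc r (2 * r), ∃ p ∈ A, boxNorm (p - c) = t) :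
    IsLargeAt c r A := by
  set T : Fin n → Set ℝ := fun i => (fun p : 𝔼 n => p i) '' (A ∩ boxRing c r (2 * r))
  have hcover : ENNReal.ofReal r ≤ ∑ i, 2 * volume (T i) :=
    calc ENNReal.ofReal r = volume (Icc r (2 * r)) := by
          rw [Real.volume_Icc]
          congr 1
          ring
      _ ≤ _ := (measure_mono (Icc_subset_iUnion_preimage_image hn h)).trans
          (measure_iUnion_fintype_le _ _)
      _ ≤ _ := Finset.sum_le_sum fun i _ => volume_preimage_add_union_preimage_sub_le (c i) (T i)
  have hsum : ∑ _i : Fin n, 2 * ENNReal.ofReal (r / (2 * n)) = ENNReal.ofReal r := by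
    rw [Finset.sum_const, Finset.card_univ, Fintype.card_fin, nsmul_eq_mul, ← mul_assoc,
      ← ENNReal.ofReal_natCast, ← ENNReal.ofReal_ofNat, ← ENNReal.ofReal_mul (by positivity),
      ← ENNReal.ofReal_mul (by positivity)]
    congr 1
    field_simp
  obtain ⟨i, hi⟩ : ∃ i, ENNReal.ofReal (r / (2 * n)) ≤ volume (T i) := by
    by_contra! hsmall
    have : (Finset.univ : Finset (Fin n)).Nonempty := ⟨⟨0, hn⟩, Finset.mem_univ _⟩
    refine hcover.not_gt ((ENNReal.sum_lt_sum_of_nonempty this fun i _ => ?_).trans_eq hsum)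
    exact ENNReal.mul_lt_mul_right two_ne_zero ENNReal.ofNat_ne_top (hsmall i)
  refine ⟨i, hi.trans (measure_mono (image_mono (inter_subset_inter_right _ fun p hp => ?_)))⟩
  exact Icc_subset_Icc (by linarith) (by linarith) hp

lemma lintegral_rescale_pow (ρ : 𝔼 n → ℝ≥0∞) (c : 𝔼 n) {r : ℝ} (hr : 0 < r) :
    ∫⁻ w, (ENNReal.ofReal r * ρ (c + r • w)) ^ n = ∫⁻ z, ρ z ^ n := by
  simp only [mul_pow]
  rw [lintegral_const_mul' _ _ (ENNReal.pow_ne_top ENNReal.ofReal_ne_top),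
    lintegral_comp_add_smul volume (fun z => ρ z ^ n) c hr.ne', finrank_euclideanSpace_fin,
    ← mul_assoc, ← ENNReal.ofReal_pow hr.le, abs_of_pos (by positivity),
    ← ENNReal.ofReal_mul (by positivity), mul_inv_cancel₀ (by positivity), ENNReal.ofReal_one,
    one_mul]

lemma weightedBall_rescale_subset (ρ : 𝔼 n → ℝ≥0∞) (c : 𝔼 n) {r : ℝ} (hr : 0 < r) (u : 𝔼 n)
    (ε : ℝ≥0∞) :
    weightedBall (fun w => ENNReal.ofReal r * ρ (c + r • w)) u ε ⊆
      (fun w => c + r • w) ⁻¹' weightedBall ρ (c + r • u) ε := fun w hw => by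
  refine (weightedDist_comp_le (φ := fun w => c + r • w) hr (fun x y => ?_) u w).trans_lt hw
  rw [dist_add_left, dist_smul₀, Real.norm_eq_abs, abs_of_pos hr]

lemma exists_unit_hub (m : ℕ) {ε : ℝ≥0∞} (hε : ε ≠ 0) :
    ∃ η : ℝ≥0∞, η ≠ 0 ∧ ∀ ρ : 𝔼 (m + 1) → ℝ≥0∞, Measurable ρ → ∫⁻ z, ρ z ^ (m + 1) ≤ η →
      ∃ u ∈ boxRing 0 2 4, (∀ s ∈ Icc (1 / 2 : ℝ) 2, IsLargeAt 0 s (weightedBall ρ u ε)) ∧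
        ∀ A, IsLargeAt 0 1 A → (A ∩ weightedBall ρ u ε).Nonempty := by
  have hδ : ENNReal.ofReal (1 / (2 * (m + 1 : ℕ))) ≠ 0 :=
    (ENNReal.ofReal_pos.2 (by positivity)).ne'
  obtain ⟨η, hη, hnear⟩ := exists_diagonal_near m (ENNReal.half_pos hε).ne' hδ (H := 10)
    (by norm_num)
  refine ⟨η, hη, fun ρ hρ henergy => ?_⟩
  obtain ⟨y, hy, hdiag, hnear⟩ := hnear ρ hρ henergy
  set u := y + (3 : ℝ) • diagonal (m + 1)
  have hy0 := abs_le.1 ((abs_apply_le_boxNorm y 0).trans hy)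
  have hball : ∀ z, weightedDist ρ y z < ε / 2 → z ∈ weightedBall ρ u ε := fun z hz =>
    (weightedDist_triangle_left ρ u z y).trans_lt <|
      (ENNReal.add_lt_add (hdiag 3 (by norm_num)) hz).trans_eq (ENNReal.add_halves ε)
  have happly : ∀ s : ℝ, (y + s • diagonal (m + 1)) 0 = y 0 + s := fun s => by
    simp [diagonal_apply]
  have hle_boxNorm : ∀ s : ℝ, y 0 + s ≤ boxNorm (y + s • diagonal (m + 1)) := fun s =>
    (happly s).symm.trans_le ((le_abs_self _).trans (abs_apply_le_boxNorm _ 0))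
  refine ⟨u, mem_boxRing_zero.2 ⟨?_, ?_⟩, fun s hs => ⟨0, ?_⟩, fun A hA => ?_⟩
  · exact le_trans (by linarith) (hle_boxNorm 3)
  · exact (boxNorm_add_smul_diagonal_le hy (abs_of_pos three_pos).le).trans (by norm_num)
  · have hsub : Icc 1 2 ⊆ (fun p : 𝔼 (m + 1) => p 0) ''
        (weightedBall ρ u ε ∩ boxRing 0 (s / 10) (10 * s)) := fun t ht => by
      have habs : |t - y 0| ≤ 3 := abs_le.2 ⟨by linarith [ht.1], by linarith [ht.2]⟩
      refine ⟨y + (t - y 0) • diagonal (m + 1), ⟨hball _ (hdiag _ (habs.trans (by norm_num))),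
        mem_boxRing_zero.2 ⟨?_, ?_⟩⟩, (happly _).trans (by ring)⟩
      · linarith [hle_boxNorm (t - y 0), hs.2, ht.1]
      · linarith [boxNorm_add_smul_diagonal_le hy habs, hs.1]
    refine le_trans ?_ (measure_mono hsub)
    rw [Real.volume_Icc]
    refine ENNReal.ofReal_le_ofReal ((div_le_iff₀ (by positivity)).2 ?_)
    push_cast
    nlinarith [hs.2, (Nat.cast_nonneg m : (0 : ℝ) ≤ m)]
  · obtain ⟨i, hi⟩ := hA
    obtain ⟨p, hp, hpy⟩ := hnear (A ∩ boxRing 0 (1 / 10) (10 * 1))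
      (fun p hp => (mem_boxRing_zero.1 hp.2).2.trans (by norm_num)) i hi
    exact ⟨p, hp.1, hball p hpy⟩

lemma exists_hub_of_lintegral_le (hn : 0 < n) {ε : ℝ≥0∞} (hε : ε ≠ 0) :
    ∃ η : ℝ≥0∞, η ≠ 0 ∧ ∀ (c : 𝔼 n) {r : ℝ}, 0 < r → ∀ ρ : 𝔼 n → ℝ≥0∞, Measurable ρ →
      ∫⁻ z, ρ z ^ n ≤ η → ∃ d ∈ boxRing c (2 * r) (4 * r),
        (∀ s ∈ Icc (r / 2) (2 * r), IsLargeAt c s (weightedBall ρ d ε)) ∧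
        ∀ A, IsLargeAt c r A → (A ∩ weightedBall ρ d ε).Nonempty := by
  obtain ⟨m, rfl⟩ := Nat.exists_eq_succ_of_ne_zero hn.ne'
  obtain ⟨η, hη, hunit⟩ := exists_unit_hub m hε
  refine ⟨η, hη, fun c r hr ρ hρ henergy => ?_⟩
  obtain ⟨u, hu, hlarge, hmeet⟩ := hunit (fun w => ENNReal.ofReal r * ρ (c + r • w))
    ((hρ.comp (Continuous.measurable (by fun_prop))).const_mul _)
    ((lintegral_rescale_pow ρ c hr).trans_le henergy)
  have hball := weightedBall_rescale_subset ρ c hr u ε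
  refine ⟨c + r • u, ?_, fun s hs => ?_, fun A hA => ?_⟩
  · rw [← preimage_homothety_boxRing c hr] at hu
    simpa only [mul_comm r, mem_preimage] using hu
  · have hs' : s / r ∈ Icc (1 / 2 : ℝ) 2 :=
      ⟨(le_div_iff₀ hr).2 (by linarith [hs.1]), (div_le_iff₀ hr).2 hs.2⟩
    have := isLargeAt_preimage_homothety hr |>.1 ((hlarge _ hs').mono hball)
    rwa [mul_div_cancel₀ _ hr.ne'] at this
  · rw [← mul_one r, ← isLargeAt_preimage_homothety hr] at hA
    obtain ⟨v, hvA, hv⟩ := hmeet _ hA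
    exact ⟨_, hvA, hball hv⟩

lemma exists_confining_weight (hn : 2 ≤ n) {η : ℝ≥0∞} (hη : η ≠ 0) :
    ∃ N : ℕ, ∀ (c : 𝔼 n) {r : ℝ}, 0 < r → ∃ ω : 𝔼 n → ℝ≥0∞, Measurable ω ∧ ∫⁻ z, ω z ^ n ≤ η ∧
      ∀ d ∈ boxRing c (2 * r) (4 * r), weightedBall ω d 1 ⊆ boxRing c (r / 2 ^ N) (2 ^ N * r) := by
  obtain ⟨δ, hδ0, hδη⟩ := exists_between (ENNReal.half_pos hη)
  obtain ⟨N, -, hcap⟩ := exists_capacity_ring_le hn hδ0.ne'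
  refine ⟨N + 2, fun c r hr => ?_⟩
  obtain ⟨ω₁, hω₁, hsep₁, hint₁⟩ := exists_of_capacity_lt
    ((hcap c (r := r / 2 ^ N) (by positivity)).trans_lt hδη)
  obtain ⟨ω₂, hω₂, hsep₂, hint₂⟩ := exists_of_capacity_lt
    ((hcap c (r := 4 * r) (by positivity)).trans_lt hδη)
  refine ⟨fun z => max (ω₁ z) (ω₂ z), hω₁.max hω₂, ?_, fun d hd z hz => ⟨?_, ?_⟩⟩
  · exact (lintegral_max_pow_le hω₁ n).trans
      ((add_le_add hint₁.le hint₂.le).trans_eq (ENNReal.add_halves η))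
  · by_contra! hlt
    have hle : r / 2 ^ (N + 2) ≤ r / 2 ^ N := by
      gcongr
      · exact one_le_two
      · exact Nat.le_add_right N 2
    have hsep := hsep₁ z (hlt.le.trans hle) d <| by
      rw [mem_ofPred_eq, mul_div_cancel₀ _ (by positivity)]
      linarith [hd.1]
    rw [weightedDist_comm] at hsep
    exact hz.not_ge (hsep.trans (weightedDist_mono (fun _ => le_max_left _ _) d z))
  · by_contra! hlt
    have hsep := hsep₂ d hd.2 z (le_trans (by rw [pow_add]; linarith) hlt.le)
    exact hz.not_ge (hsep.trans (weightedDist_mono (fun _ => le_max_right _ _) d z))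

/-- `d` is a hub of `R` at scale `r` around `c`: every set that is large at scale `r` is reached
from `d` by `ε`-short curves in `R`, and the set of all points reached in this way is itself large
at all scales comparable to `r`. -/
structure IsHub (ρ : 𝔼 n → ℝ≥0∞) (R : Set (𝔼 n)) (ε : ℝ≥0∞) (c : 𝔼 n) (r : ℝ) (d : 𝔼 n) :
    Prop where
  isLargeAt : ∀ s ∈ Icc (r / 2) (2 * r),
    IsLargeAt c s (pathComponentIn (R ∩ weightedBall ρ d ε) d)
  inter_nonempty : ∀ A, IsLargeAt c r A →
    (A ∩ pathComponentIn (R ∩ weightedBall ρ d ε) d).Nonempty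

-- The confining weight keeps the short curves supplied by `exists_hub_of_lintegral_le` inside the
-- ring, so only the energy of `ρ` in the ring matters.
lemma exists_hub (hn : 2 ≤ n) {ε : ℝ≥0∞} (hε : ε ≠ 0) :
    ∃ (N : ℕ) (η : ℝ≥0∞), η ≠ 0 ∧ ∀ (c : 𝔼 n) {r : ℝ}, 0 < r →
      ∀ ρ : 𝔼 n → ℝ≥0∞, Measurable ρ →
      ∫⁻ z in boxRing c (r / 2 ^ N) (2 ^ N * r), ρ z ^ n ≤ η →
      ∃ d, IsHub ρ (boxRing c (r / 2 ^ N) (2 ^ N * r)) ε c r d := by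
  obtain ⟨η, hη, hhub⟩ := exists_hub_of_lintegral_le (n := n) (by omega)
    (lt_min (pos_iff_ne_zero.2 hε) one_pos).ne'
  obtain ⟨N, hconfine⟩ := exists_confining_weight hn (ENNReal.half_pos hη).ne'
  refine ⟨N, η / 2, (ENNReal.half_pos hη).ne', fun c r hr ρ hρ henergy => ?_⟩
  set R := boxRing c (r / 2 ^ N) (2 ^ N * r)
  have hR : MeasurableSet R := (isClosed_boxRing _ _ _).measurableSet
  obtain ⟨ω, hω, hωint, hωR⟩ := hconfine c hr
  set ρ' : 𝔼 n → ℝ≥0∞ := fun z => max (R.indicator ρ z) (ω z)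
  have henergy' : ∫⁻ z, ρ' z ^ n ≤ η :=
    (lintegral_max_indicator_pow_le hρ hR (by omega)).trans
      ((add_le_add henergy hωint).trans_eq (ENNReal.add_halves η))
  obtain ⟨d, hd, hlarge, hmeet⟩ := hhub c hr ρ' ((hρ.indicator hR).max hω) henergy'
  have hball_R : weightedBall ρ' d (min ε 1) ⊆ R := fun z hz => hωR d hd <|
    (weightedDist_mono (fun _ => le_max_right _ _) d z).trans_lt (hz.trans_le (min_le_right _ _))
  have hle : ∀ z ∈ weightedBall ρ' d (min ε 1), ρ z ≤ ρ' z := fun z hz =>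
    (indicator_of_mem (hball_R hz) ρ).symm.trans_le (le_max_left _ _)
  have hball_ρ : weightedBall ρ' d (min ε 1) ⊆ weightedBall ρ d ε :=
    (weightedBall_subset_of_le_on hle).trans
      fun z (hz : weightedDist ρ d z < _) =>
        show weightedDist ρ d z < ε from hz.trans_le (min_le_left _ _)
  have hpath : weightedBall ρ' d (min ε 1) ⊆ pathComponentIn (R ∩ weightedBall ρ d ε) d :=
    fun z hz => (joinedIn_weightedBall hz).mono (subset_inter hball_R hball_ρ)
  exact ⟨d, fun s hs => (hlarge s hs).mono hpath,
    fun A hA => (hmeet A hA).mono (inter_subset_inter_right _ hpath)⟩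

end Hub

/-! ### Neighbourhoods in the Möbius space -/

section MobiusNeighborhoods

variable {n : ℕ}

open OnePoint

lemma nhds_hasBasis_boxNorm_lt (c : 𝔼 n) :
    (𝓝 c).HasBasis (fun a : ℝ => 0 < a) fun a => {z | boxNorm (z - c) < a} := by
  refine Metric.nhds_basis_ball.to_hasBasis (fun a ha => ⟨a / (n + 1), by positivity, ?_⟩)
    fun a ha => ⟨a, ha, fun z hz => (boxNorm_le_norm _).trans_lt (mem_ball_iff_norm.1 hz)⟩
  intro z (hz : boxNorm (z - c) < a / (n + 1))
  rw [lt_div_iff₀' (by positivity)] at hz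
  refine mem_ball_iff_norm.2 (lt_of_le_of_lt ?_ hz)
  linarith [norm_le_mul_boxNorm (z - c), boxNorm_nonneg (z - c)]

lemma cocompact_hasBasis_lt_boxNorm :
    (cocompact (𝔼 n)).HasBasis (fun a : ℝ => 0 < a) fun a => {z | a < boxNorm z} := by
  rw [← Metric.cobounded_eq_cocompact]
  refine (Metric.hasBasis_cobounded_compl_closedBall (0 : 𝔼 n)).to_hasBasis (fun a _ => ?_)
    fun a _ => ⟨n * a, trivial, fun z hz => ?_⟩
  · refine ⟨max a 1, by positivity, fun z (hz : max a 1 < boxNorm z) => ?_⟩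
    rw [mem_compl_iff, mem_closedBall_zero_iff, not_le]
    exact (le_max_left a 1).trans_lt (hz.trans_le (boxNorm_le_norm z))
  · rw [mem_compl_iff, mem_closedBall_zero_iff, not_le] at hz
    exact lt_of_mul_lt_mul_left (hz.trans_le (norm_le_mul_boxNorm z)) n.cast_nonneg

lemma nhds_coe_hasBasis (c : 𝔼 n) :
    (𝓝 (c : MobiusSpace n)).HasBasis (fun a : ℝ => 0 < a)
      fun a => (↑) '' {z : 𝔼 n | boxNorm (z - c) < a} := by
  rw [nhds_coe_eq]
  exact (nhds_hasBasis_boxNorm_lt c).map _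

lemma nhds_infty_hasBasis :
    (𝓝 (∞ : MobiusSpace n)).HasBasis (fun a : ℝ => 0 < a)
      fun a => (↑) '' {z : 𝔼 n | a < boxNorm z} ∪ {OnePoint.infty} := by
  rw [nhds_infty_eq, coclosedCompact_eq_cocompact]
  exact (cocompact_hasBasis_lt_boxNorm.map _).sup_pure _

instance instIsCountablyGeneratedNhds (x : MobiusSpace n) :
    (𝓝 x).IsCountablyGenerated := by
  induction x using OnePoint.rec with
  | infty =>
    rw [nhds_infty_eq, coclosedCompact_eq_cocompact, ← Metric.cobounded_eq_cocompact,
      ← comap_norm_atTop]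
    infer_instance
  | coe c => rw [nhds_coe_eq]; infer_instance

/-- The distance to `c` in the maximum norm, cut off at `M` so as to extend to `∞`. -/
def boxLevel (c : 𝔼 n) (M : ℝ) (x : MobiusSpace n) : ℝ :=
  x.elim M fun z => min (boxNorm (z - c)) M

lemma boxLevel_coe (c z : 𝔼 n) (M : ℝ) : boxLevel c M z = min (boxNorm (z - c)) M := rfl

lemma boxLevel_infty (c : 𝔼 n) (M : ℝ) : boxLevel c M ∞ = M := rfl

lemma boxNorm_sub_eq_boxLevel {c z : 𝔼 n} {M : ℝ} (h : boxLevel c M z < M) :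
    boxNorm (z - c) = boxLevel c M z :=
  (min_eq_left ((min_lt_iff.1 h).resolve_right (lt_irrefl M)).le).symm

lemma continuous_boxLevel (c : 𝔼 n) (M : ℝ) : Continuous (boxLevel c M) := by
  refine (continuous_iff _).2 ⟨?_, (continuous_boxNorm_sub c).min continuous_const⟩
  rw [coclosedCompact_eq_cocompact]
  refine tendsto_const_nhds.congr' ?_
  filter_upwards [(isCompact_closedBall c (n * |M|)).compl_mem_cocompact] with z hz
  rw [mem_compl_iff, mem_closedBall_iff_norm, not_le] at hz
  have hlt : |M| < boxNorm (z - c) :=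
    lt_of_mul_lt_mul_left (hz.trans_le (norm_le_mul_boxNorm (z - c))) n.cast_nonneg
  rw [boxLevel_infty, boxLevel_coe, min_eq_right ((le_abs_self M).trans hlt.le)]

lemma isLargeAt_of_boxLevel (hn : 0 < n) {c : 𝔼 n} {r : ℝ} (hr : 0 < r)
    {A : Set (MobiusSpace n)} (hA : IsPreconnected A) {u v : MobiusSpace n} (hu : u ∈ A)
    (hv : v ∈ A) (hur : boxLevel c (4 * r) u ≤ r) (hvr : 2 * r ≤ boxLevel c (4 * r) v) :
    IsLargeAt c r (finitePart A) := by
  refine isLargeAt_of_forall_exists_boxNorm_eq hn hr fun t ht => ?_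
  obtain ⟨w, hwA, hwt⟩ := hA.intermediate_value hu hv
    (continuous_boxLevel c (4 * r)).continuousOn ⟨hur.trans ht.1, ht.2.trans hvr⟩
  have hwlt : boxLevel c (4 * r) w < 4 * r := by linarith [ht.2]
  induction w using OnePoint.rec with
  | infty => exact absurd hwlt (lt_irrefl _)
  | coe z => exact ⟨z, hwA, (boxNorm_sub_eq_boxLevel hwlt).trans hwt⟩

/-- The boxes around `c` of radii `s ^ k` (if `s = 1 / 2`), or their complements (if `s = 2`),
shrink to the point `x` of the Möbius space; this allows to treat finite points and `∞` alike. -/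
structure IsScaleAt (x : MobiusSpace n) (c : 𝔼 n) (s : ℝ) : Prop where
  eq_or : s = 1 / 2 ∨ s = 2
  ring_subset : ∀ U ∈ 𝓝 x, ∀ N : ℕ, ∀ᶠ k : ℕ in atTop,
    boxRing c (s ^ k / 2 ^ N) (2 ^ N * s ^ k) ⊆ finitePart U
  ring_disjoint : ∀ k N : ℕ, ∀ᶠ V in (𝓝 x).smallSets,
    Disjoint (boxRing c (s ^ k / 2 ^ N) (2 ^ N * s ^ k)) (finitePart V)
  crosses : ∀ U ∈ 𝓝 x, ∀ᶠ k : ℕ in atTop, ∀ᶠ V in (𝓝 x).smallSets, ∀ A : Set (MobiusSpace n),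
    IsPreconnected A → (A ∩ Uᶜ).Nonempty → (A ∩ V).Nonempty → IsLargeAt c (s ^ k) (finitePart A)

lemma IsScaleAt.pos {x : MobiusSpace n} {c : 𝔼 n} {s : ℝ} (h : IsScaleAt x c s) : 0 < s := by
  rcases h.eq_or with rfl | rfl <;> norm_num

lemma isScaleAt_coe (hn : 0 < n) (c : 𝔼 n) : IsScaleAt (c : MobiusSpace n) c (1 / 2) := by
  have hlim : Tendsto (fun k : ℕ => (1 / 2 : ℝ) ^ k) atTop (𝓝 0) :=
    tendsto_pow_atTop_nhds_zero_of_lt_one (by norm_num) (by norm_num)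
  refine ⟨Or.inl rfl, fun U hU N => ?_, fun k N => ?_, fun U hU => ?_⟩
  · obtain ⟨a, ha, hUa⟩ := (nhds_coe_hasBasis c).mem_iff.1 hU
    filter_upwards [hlim.eventually_lt_const (div_pos ha (pow_pos two_pos N))] with k hk z hz
    exact hUa ⟨z, hz.2.trans_lt ((lt_div_iff₀' (by positivity)).1 hk), rfl⟩
  · refine eventually_smallSets.2 ⟨_, (nhds_coe_hasBasis c).mem_of_mem
      (show (0 : ℝ) < (1 / 2) ^ k / 2 ^ N by positivity), fun V hV => ?_⟩
    refine disjoint_left.2 fun z hz hzV => hz.1.not_gt ?_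
    simpa using hV hzV
  · obtain ⟨a, ha, hUa⟩ := (nhds_coe_hasBasis c).mem_iff.1 hU
    filter_upwards [hlim.eventually_lt_const (half_pos ha)] with k hk
    have hr : (0 : ℝ) < (1 / 2) ^ k := by positivity
    refine eventually_smallSets.2 ⟨_, (nhds_coe_hasBasis c).mem_of_mem hr, ?_⟩
    rintro V hV A hA ⟨v, hvA, hvU⟩ ⟨u, huA, huV⟩
    obtain ⟨u, hu, rfl⟩ := hV huV
    refine isLargeAt_of_boxLevel hn hr hA huA hvA ((min_le_left _ _).trans (le_of_lt hu)) ?_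
    induction v using OnePoint.rec with
    | infty => rw [boxLevel_infty]; linarith
    | coe z =>
      have hz : a ≤ boxNorm (z - c) := not_lt.1 fun hlt => hvU (hUa ⟨z, hlt, rfl⟩)
      exact le_min (by linarith) (by linarith)

lemma isScaleAt_infty (hn : 0 < n) : IsScaleAt (∞ : MobiusSpace n) 0 2 := by
  have hlim : Tendsto (fun k : ℕ => (2 : ℝ) ^ k) atTop atTop :=
    tendsto_pow_atTop_atTop_of_one_lt one_lt_two
  refine ⟨Or.inr rfl, fun U hU N => ?_, fun k N => ?_, fun U hU => ?_⟩
  · obtain ⟨a, -, hUa⟩ := nhds_infty_hasBasis.mem_iff.1 hU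
    filter_upwards [hlim.eventually_gt_atTop (a * 2 ^ N)] with k hk z hz
    refine hUa (Or.inl ⟨z, ((lt_div_iff₀ (by positivity)).2 hk).trans_le ?_, rfl⟩)
    simpa only [sub_zero] using hz.1
  · refine eventually_smallSets.2 ⟨_, nhds_infty_hasBasis.mem_of_mem
      (show (0 : ℝ) < 2 ^ N * 2 ^ k by positivity), fun V hV => ?_⟩
    refine disjoint_left.2 fun z hz hzV => hz.2.not_gt ?_
    simpa using hV hzV
  · obtain ⟨a, -, hUa⟩ := nhds_infty_hasBasis.mem_iff.1 hU
    filter_upwards [hlim.eventually_gt_atTop a] with k hk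
    have hr : (0 : ℝ) < 2 ^ k := by positivity
    have hmem : 2 * 2 ^ k < boxLevel (0 : 𝔼 n) (4 * 2 ^ k) ∞ := by rw [boxLevel_infty]; linarith
    refine eventually_smallSets.2
      ⟨_, (continuous_boxLevel _ _).continuousAt.eventually_const_lt hmem, ?_⟩
    rintro V hV A hA ⟨v, hvA, hvU⟩ ⟨u, huA, huV⟩
    refine isLargeAt_of_boxLevel hn hr hA hvA huA ?_ (le_of_lt (hV huV))
    induction v using OnePoint.rec with
    | infty => exact absurd (hUa (Or.inr rfl)) hvU
    | coe z =>
      have hz : boxNorm z ≤ a := not_lt.1 fun hlt => hvU (hUa (Or.inl ⟨z, hlt, rfl⟩))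
      exact (min_le_left _ _).trans (by rw [sub_zero]; linarith)

lemma exists_isScaleAt (hn : 0 < n) (x : MobiusSpace n) : ∃ c s, IsScaleAt x c s := by
  induction x using OnePoint.rec with
  | infty => exact ⟨0, 2, isScaleAt_infty hn⟩
  | coe c => exact ⟨c, 1 / 2, isScaleAt_coe hn c⟩

lemma exists_nhds_capacity_compl_le (hn : 2 ≤ n) {x : MobiusSpace n} {U : Set (MobiusSpace n)}
    (hU : U ∈ 𝓝 x) {ε : ℝ≥0∞} (hε : ε ≠ 0) :
    ∃ V ∈ 𝓝 x, capacity (finitePart V) (finitePart Uᶜ) ≤ ε := by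
  obtain ⟨N, -, hN⟩ := exists_capacity_ring_le hn hε
  induction x using OnePoint.rec with
  | infty =>
    obtain ⟨a, ha, hUa⟩ := nhds_infty_hasBasis.mem_iff.1 hU
    refine ⟨_, nhds_infty_hasBasis.mem_of_mem (show 0 < 2 ^ N * a by positivity), ?_⟩
    rw [capacity_comm]
    refine (capacity_mono (fun q hq => ?_) fun p hp => ?_).trans (hN 0 ha)
    · simpa only [mem_ofPred_eq, sub_zero] using
        not_lt.1 fun hlt => hq (hUa (Or.inl ⟨q, hlt, rfl⟩))
    · have : 2 ^ N * a < boxNorm p := by simpa using hp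
      simpa using this.le
  | coe c =>
    obtain ⟨a, ha, hUa⟩ := (nhds_coe_hasBasis c).mem_iff.1 hU
    have hr : 0 < a / 2 ^ N := by positivity
    refine ⟨_, (nhds_coe_hasBasis c).mem_of_mem hr, ?_⟩
    refine (capacity_mono (fun p hp => ?_) fun q hq => ?_).trans (hN c hr)
    · have : boxNorm (p - c) < a / 2 ^ N := by simpa using hp
      exact this.le
    · rw [mem_ofPred_eq, mul_div_cancel₀ _ (by positivity)]
      exact not_lt.1 fun hlt => hq (hUa ⟨q, hlt, rfl⟩)

lemma continuous_update_inv_smul {z : 𝔼 n} (hz : z ≠ 0) :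
    Continuous (Function.update (fun t : ℝ => ((t⁻¹ • z : 𝔼 n) : MobiusSpace n)) 0 ∞) := by
  refine continuous_iff_continuousAt.2 fun t => ?_
  rcases eq_or_ne t 0 with rfl | ht
  · rw [continuousAt_update_same]
    refine tendsto_coe_infty.comp ?_
    rw [coclosedCompact_eq_cocompact, ← Metric.cobounded_eq_cocompact,
      ← tendsto_norm_atTop_iff_cobounded]
    simp_rw [norm_smul]
    exact (tendsto_norm_atTop_iff_cobounded.2 tendsto_inv₀_nhdsNE_zero).atTop_mul_const
      (norm_pos_iff.2 hz)
  · rw [continuousAt_update_of_ne ht]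
    exact continuous_coe.continuousAt.comp ((continuousAt_inv₀ ht).smul continuousAt_const)

lemma joinedIn_infty_coe {z : 𝔼 n} {U : Set (MobiusSpace n)} (hz : z ≠ 0)
    (hU : (∞ : MobiusSpace n) ∈ U)
    (hzU : ∀ t : ℝ, 1 ≤ t → ((t • z : 𝔼 n) : MobiusSpace n) ∈ U) : JoinedIn U ∞ z := by
  refine JoinedIn.ofLine (continuous_update_inv_smul hz).continuousOn (by simp) (by simp) ?_
  rintro _ ⟨t, ht, rfl⟩
  rcases ht.1.eq_or_lt with rfl | hpos
  · simpa using hU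
  · simpa [hpos.ne'] using hzU t⁻¹ ((one_le_inv₀ hpos).2 ht.2)

lemma exists_nhds_joinedIn {x : MobiusSpace n} {U : Set (MobiusSpace n)} (hU : U ∈ 𝓝 x) :
    ∃ V ∈ 𝓝 x, ∀ y ∈ V, JoinedIn U x y := by
  induction x using OnePoint.rec with
  | infty =>
    obtain ⟨a, ha, hUa⟩ := nhds_infty_hasBasis.mem_iff.1 hU
    refine ⟨_, nhds_infty_hasBasis.mem_of_mem ha, ?_⟩
    rintro _ (⟨z, hz : a < boxNorm z, rfl⟩ | rfl)
    · have hz0 : z ≠ 0 := by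
        rintro rfl
        exact absurd hz (by simpa [boxNorm] using ha.le)
      refine joinedIn_infty_coe hz0 (hUa (Or.inr rfl)) fun t ht => hUa (Or.inl ⟨_, ?_, rfl⟩)
      rw [mem_ofPred_eq, boxNorm_smul, abs_of_pos (by linarith)]
      exact hz.trans_le (le_mul_of_one_le_left (boxNorm_nonneg z) ht)
    · exact JoinedIn.refl (hUa (Or.inr rfl))
  | coe c =>
    obtain ⟨a, ha, hUa⟩ := Metric.nhds_basis_ball.mem_iff.1 (continuous_coe.continuousAt hU)
    refine ⟨_, (isOpenEmbedding_coe.isOpenMap.image_mem_nhds (Metric.ball_mem_nhds c ha)), ?_⟩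
    rintro _ ⟨z, hz, rfl⟩
    have hsegment : segment ℝ c z ⊆ Metric.ball c a :=
      (convex_ball c a).segment_subset (Metric.mem_ball_self ha) hz
    obtain ⟨γ, hγ⟩ := JoinedIn.of_segment_subset hsegment
    exact ⟨γ.map continuous_coe, fun t => hUa (hγ t)⟩

end MobiusNeighborhoods

/-! ### Connecting sets across a ring of small energy -/

section Connects

variable {n : ℕ}

lemma disjoint_boxRing {c : 𝔼 n} {r r' : ℝ} (hr : 0 < r) {N : ℕ} (h : 2 ^ (2 * N + 1) * r ≤ r') :
    Disjoint (boxRing c (r / 2 ^ N) (2 ^ N * r)) (boxRing c (r' / 2 ^ N) (2 ^ N * r')) := by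
  refine disjoint_left.2 fun z hz hz' => ?_
  have hle : r' / 2 ^ N ≤ 2 ^ N * r := hz'.1.trans hz.2
  rw [div_le_iff₀ (by positivity)] at hle
  have hpow : 2 ^ (2 * N + 1) * r = 2 * (2 ^ N * r * 2 ^ N) := by ring
  have hpos : 0 < 2 ^ N * r * 2 ^ N := by positivity
  linarith

lemma pairwise_disjoint_boxRing (c : 𝔼 n) {s : ℝ} (hs : s = 1 / 2 ∨ s = 2) (N k₀ : ℕ) :
    Pairwise (Function.onFun Disjoint fun l : ℕ =>
      boxRing c (s ^ (k₀ + (2 * N + 1) * l) / 2 ^ N) (2 ^ N * s ^ (k₀ + (2 * N + 1) * l))) := by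
  rw [pairwise_disjoint_on]
  intro l l' hl
  obtain ⟨j, rfl⟩ := Nat.exists_eq_add_of_lt hl
  set k := k₀ + (2 * N + 1) * l
  have hk : k₀ + (2 * N + 1) * (l + j + 1) = k + (2 * N + 1) * (j + 1) := by ring
  have hpow : (2 : ℝ) ^ (2 * N + 1) ≤ 2 ^ ((2 * N + 1) * (j + 1)) :=
    pow_le_pow_right₀ one_le_two (Nat.le_mul_of_pos_right _ j.succ_pos)
  rw [hk]
  rcases hs with rfl | rfl
  · refine (disjoint_boxRing (by positivity) ?_).symm
    calc 2 ^ (2 * N + 1) * (1 / 2 : ℝ) ^ (k + (2 * N + 1) * (j + 1))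
        ≤ 2 ^ ((2 * N + 1) * (j + 1)) * (1 / 2 : ℝ) ^ (k + (2 * N + 1) * (j + 1)) := by gcongr
      _ = (1 / 2) ^ k := by
        rw [pow_add (1 / 2 : ℝ) k, mul_left_comm, ← mul_pow]
        norm_num
  · refine disjoint_boxRing (by positivity) ?_
    rw [pow_add _ k, mul_comm]
    exact mul_le_mul_of_nonneg_left hpow (by positivity)

lemma exists_setLIntegral_le_of_pairwise_disjoint {X : Type*} [MeasurableSpace X]
    {μ : Measure X} {f : X → ℝ≥0∞} {S : ℕ → Set X} (hS : ∀ l, MeasurableSet (S l))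
    (hdisj : Pairwise (Function.onFun Disjoint S)) {M : ℕ} {η : ℝ≥0∞}
    (hM : ∫⁻ x, f x ∂μ < M * η) : ∃ l ∈ Finset.range M, ∫⁻ x in S l, f x ∂μ ≤ η := by
  by_contra! hlt
  refine hM.not_ge ?_
  calc (M : ℝ≥0∞) * η = ∑ _l ∈ Finset.range M, η := by simp
    _ ≤ ∑ l ∈ Finset.range M, ∫⁻ x in S l, f x ∂μ :=
        Finset.sum_le_sum fun l hl => (hlt l hl).le
    _ = ∫⁻ x in ⋃ l ∈ Finset.range M, S l, f x ∂μ :=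
        (lintegral_biUnion_finset (hdisj.set_pairwise _) (fun l _ => hS l) f).symm
    _ ≤ ∫⁻ x, f x ∂μ := setLIntegral_le_lintegral _ _

/-- Any two connected sets that reach from outside `U` into `V` are joined by a curve in `U \ V`
that is `ε`-short with respect to any given weight of energy at most `R`. -/
def Connects (R ε : ℝ≥0∞) (U V : Set (MobiusSpace n)) : Prop :=
  ∀ ρ : 𝔼 n → ℝ≥0∞, Measurable ρ → ∫⁻ z, ρ z ^ n ≤ R →
    ∀ A B : Set (MobiusSpace n), IsPreconnected A → IsPreconnected B →
      (A ∩ Uᶜ).Nonempty → (A ∩ V).Nonempty → (B ∩ Uᶜ).Nonempty → (B ∩ V).Nonempty →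
      ∃ p ∈ finitePart A, ∃ q ∈ finitePart B,
        JoinedIn (finitePart (U \ V) ∩ weightedBall ρ p ε) p q

lemma Connects.anti {R ε : ℝ≥0∞} {U V V' : Set (MobiusSpace n)} (h : Connects R ε U V)
    (hV : V' ⊆ V) : Connects R ε U V' := by
  intro ρ hρ hR A B hA hB hAU hAV hBU hBV
  obtain ⟨p, hp, q, hq, hpq⟩ := h ρ hρ hR A B hA hB hAU
    (hAV.mono (inter_subset_inter_right _ hV)) hBU (hBV.mono (inter_subset_inter_right _ hV))
  exact ⟨p, hp, q, hq, hpq.mono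
    (inter_subset_inter_left _ (preimage_mono (sdiff_subset_sdiff_right hV)))⟩

-- Among sufficiently many disjoint rings of the same shape around `x`, every weight of energy at
-- most `R` has small energy on one of them, and both sets are close to the hub of that ring.
lemma exists_nhds_connects (hn : 2 ≤ n) {x : MobiusSpace n} {U : Set (MobiusSpace n)}
    (hU : U ∈ 𝓝 x) {R ε : ℝ≥0∞} (hR : R ≠ ∞) (hε : ε ≠ 0) : ∃ V ∈ 𝓝 x, Connects R ε U V := by
  obtain ⟨c, s, hs⟩ := exists_isScaleAt (by omega) x
  obtain ⟨N, η, hη, hhub⟩ := exists_hub hn (ENNReal.half_pos hε).ne'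
  obtain ⟨M, hM⟩ := ENNReal.exists_nat_mul_gt hη hR
  obtain ⟨k₀, hk₀⟩ := ((hs.ring_subset U hU N).and (hs.crosses U hU)).exists_forall_of_atTop
  set κ : ℕ → ℕ := fun l => k₀ + (2 * N + 1) * l
  set ring : ℕ → Set (𝔼 n) := fun l => boxRing c (s ^ κ l / 2 ^ N) (2 ^ N * s ^ κ l)
  have hring : ∀ l, ring l ⊆ finitePart U := fun l => (hk₀ (κ l) (Nat.le_add_right _ _)).1
  have hsmall : ∀ᶠ V in (𝓝 x).smallSets, ∀ l ∈ Finset.range M,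
      Disjoint (ring l) (finitePart V) ∧ ∀ A : Set (MobiusSpace n), IsPreconnected A →
        (A ∩ Uᶜ).Nonempty → (A ∩ V).Nonempty → IsLargeAt c (s ^ κ l) (finitePart A) :=
    (eventually_all_finset _).2 fun l _ =>
      (hs.ring_disjoint (κ l) N).and (hk₀ (κ l) (Nat.le_add_right _ _)).2
  obtain ⟨V, hV, hVsub⟩ := eventually_smallSets.1 hsmall
  refine ⟨V, hV, fun ρ hρ hint A B hA hB hAU hAV hBU hBV => ?_⟩
  obtain ⟨l, hl, hle⟩ := exists_setLIntegral_le_of_pairwise_disjoint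
    (fun l => (isClosed_boxRing c _ _).measurableSet)
    (pairwise_disjoint_boxRing c hs.eq_or N k₀) (hint.trans_lt hM)
  obtain ⟨hdisj, hlarge⟩ := hVsub V subset_rfl l hl
  obtain ⟨d, hd⟩ := hhub c (pow_pos hs.pos (κ l)) ρ hρ hle
  obtain ⟨p, hpA, hp⟩ := hd.inter_nonempty _ (hlarge A hA hAU hAV)
  obtain ⟨q, hqB, hq⟩ := hd.inter_nonempty _ (hlarge B hB hBU hBV)
  refine ⟨p, hpA, q, hqB, (hp.symm.trans hq).mono fun w hw => ⟨⟨hring l hw.1, ?_⟩, ?_⟩⟩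
  · exact disjoint_left.1 hdisj hw.1
  · exact (weightedDist_triangle_left ρ p w d).trans_lt
      ((ENNReal.add_lt_add hp.target_mem.2 hw.2).trans_eq (ENNReal.add_halves ε))

end Connects

/-! ### The modulus metric -/

section ModulusDist

variable {n : ℕ} {G : Set (MobiusSpace n)}

lemma modulusDist_le (hG : IsOpen G) {S : Set (MobiusSpace n)} (hS : S ⊆ G) {x y : G}
    (h : JoinedIn S (x : MobiusSpace n) y) :
    modulusDist G x y ≤ capacity (finitePart S) (finitePart Gᶜ) := by
  obtain ⟨γ, hγ⟩ := h
  have hγS : range γ ⊆ S := range_subset_iff.2 hγ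
  refine iInf₂_le_of_le (γ : C(I, MobiusSpace n)) ⟨by simp, by simp, fun t => hS (hγ t)⟩ ?_
  exact (modulus_curvesJoining hG (hγS.trans hS) subset_rfl (frontier_subset_compl hG)).trans_le
    (capacity_mono (preimage_mono hγS) subset_rfl)

lemma exists_of_modulusDist_lt (hG : IsOpen G) {x y : G} {a : ℝ≥0∞}
    (h : modulusDist G x y < a) :
    ∃ γ : Path (x : MobiusSpace n) y, range γ ⊆ G ∧
      capacity (finitePart (range γ)) (finitePart Gᶜ) < a := by
  simp only [modulusDist, iInf_lt_iff] at h
  obtain ⟨c, ⟨h0, h1, hc⟩, hlt⟩ := h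
  have hcG : range c ⊆ G := range_subset_iff.2 hc
  rw [modulus_curvesJoining hG hcG subset_rfl (frontier_subset_compl hG)] at hlt
  exact ⟨⟨c, h0, h1⟩, hcG, hlt⟩

lemma joinedIn_range {X : Type*} [TopologicalSpace X] {x y z : X} (γ : Path x y)
    (hz : z ∈ range γ) : JoinedIn (range γ) x z := by
  have : PathConnectedSpace I := isPathConnected_iff_pathConnectedSpace.1
    ((convex_Icc (0 : ℝ) 1).isPathConnected (nonempty_Icc.2 zero_le_one))
  exact (isPathConnected_range γ.continuous).joinedIn x γ.source_mem_range z hz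

lemma modulusDist_comm (hG : IsOpen G) (x y : G) : modulusDist G x y = modulusDist G y x := by
  suffices h : ∀ x y, modulusDist G x y ≤ modulusDist G y x from le_antisymm (h x y) (h y x)
  refine fun x y => le_of_forall_gt fun a ha => ?_
  obtain ⟨γ, hγ, hlt⟩ := exists_of_modulusDist_lt hG ha
  exact (modulusDist_le hG hγ (joinedIn_range γ γ.target_mem_range).symm).trans_lt hlt

lemma modulusDist_triangle (hG : IsOpen G) (x y z : G) :
    modulusDist G x z ≤ modulusDist G x y + modulusDist G y z := by
  refine ENNReal.le_of_forall_pos_le_add fun ε hε hfin => ?_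
  have hε2 : (ε : ℝ≥0∞) / 2 ≠ 0 := by simpa using hε.ne'
  obtain ⟨hxy, hyz⟩ := ENNReal.add_lt_top.1 hfin
  obtain ⟨γ₁, hγ₁, hcap₁⟩ := exists_of_modulusDist_lt hG (ENNReal.lt_add_right hxy.ne hε2)
  obtain ⟨γ₂, hγ₂, hcap₂⟩ := exists_of_modulusDist_lt hG (ENNReal.lt_add_right hyz.ne hε2)
  have hjoined : JoinedIn (range γ₁ ∪ range γ₂) (x : MobiusSpace n) z :=
    ((joinedIn_range γ₁ γ₁.target_mem_range).mono subset_union_left).trans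
      ((joinedIn_range γ₂ γ₂.target_mem_range).mono subset_union_right)
  calc modulusDist G x z
      ≤ capacity (finitePart (range γ₁ ∪ range γ₂)) (finitePart Gᶜ) :=
        modulusDist_le hG (union_subset hγ₁ hγ₂) hjoined
    _ ≤ _ := capacity_union_le
    _ ≤ (modulusDist G x y + ε / 2) + (modulusDist G y z + ε / 2) :=
        add_le_add hcap₁.le hcap₂.le
    _ = modulusDist G x y + modulusDist G y z + ε := by
        rw [add_add_add_comm, ENNReal.add_halves]

lemma exists_nhds_modulusDist_le (hn : 2 ≤ n) (hG : IsOpen G) (p : G) {ε : ℝ≥0∞} (hε : ε ≠ 0) :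
    ∃ V ∈ 𝓝 (p : MobiusSpace n), ∀ q : G, (q : MobiusSpace n) ∈ V → modulusDist G p q ≤ ε := by
  have hGp : G ∈ 𝓝 (p : MobiusSpace n) := hG.mem_nhds p.2
  obtain ⟨W, hW, hcap⟩ := exists_nhds_capacity_compl_le hn hGp hε
  obtain ⟨V, hV, hjoined⟩ := exists_nhds_joinedIn (inter_mem hGp hW)
  exact ⟨V, hV, fun q hq => (modulusDist_le hG inter_subset_left (hjoined q hq)).trans
    ((capacity_mono inter_subset_right subset_rfl).trans hcap)⟩

lemma modulusDist_self (hn : 2 ≤ n) (hG : IsOpen G) (p : G) : modulusDist G p p = 0 := by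
  by_contra hne
  obtain ⟨ε, hε, hlt⟩ := exists_between (pos_iff_ne_zero.2 hne)
  obtain ⟨V, hV, hle⟩ := exists_nhds_modulusDist_le hn hG p hε.ne'
  exact (hle p (mem_of_mem_nhds hV)).not_gt hlt

lemma modulusDist_lt_top (hn : 2 ≤ n) (hG : IsOpen G) (hGc : IsPreconnected G) (x y : G) :
    modulusDist G x y < ∞ := by
  have : PreconnectedSpace G := isPreconnected_iff_preconnectedSpace.1 hGc
  have hnear : ∀ y : G, ∀ᶠ z in 𝓝 y, modulusDist G y z < ∞ := fun y => by
    obtain ⟨V, hV, hle⟩ := exists_nhds_modulusDist_le hn hG y one_ne_zero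
    filter_upwards [continuous_subtype_val.continuousAt hV] with z hz
    exact (hle z hz).trans_lt ENNReal.one_lt_top
  have hclopen : IsClopen {y : G | modulusDist G x y < ∞} := by
    constructor
    · refine ⟨isOpen_iff_mem_nhds.2 fun y hy => ?_⟩
      filter_upwards [hnear y] with z hyz hxz
      rw [modulusDist_comm hG] at hyz
      exact hy ((modulusDist_triangle hG x z y).trans_lt (ENNReal.add_lt_top.2 ⟨hxz, hyz⟩))
    · refine isOpen_iff_mem_nhds.2 fun y hxy => ?_
      filter_upwards [hnear y] with z hyz
      exact (modulusDist_triangle hG x y z).trans_lt (ENNReal.add_lt_top.2 ⟨hxy, hyz⟩)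
  have hx : modulusDist G x x < ∞ := by simp [modulusDist_self hn hG]
  exact (hclopen.eq_univ ⟨x, hx⟩).ge (mem_univ y)

end ModulusDist

/-! ### Escaping curves of small modulus -/

section Escape

variable {n : ℕ} {G : Set (MobiusSpace n)}

lemma volume_image_apply_pos (i : Fin n) {O : Set (𝔼 n)} (hO : IsOpen O) (hne : O.Nonempty) :
    0 < volume ((fun p : 𝔼 n => p i) '' O) := by
  have hsurj : Function.Surjective (EuclideanSpace.proj i : 𝔼 n →L[ℝ] ℝ) := fun t =>
    ⟨EuclideanSpace.single i t, by simp⟩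
  exact ((ContinuousLinearMap.isOpenMap _ hsurj) O hO).measure_pos _ (hne.image _)

lemma exists_weightedDist_lt_of_isLargeAt (hn : 0 < n) (c : 𝔼 n) {r : ℝ} (hr : 0 < r)
    {O : Set (𝔼 n)} (hO : IsOpen O) (hne : O.Nonempty) {ε : ℝ≥0∞} (hε : ε ≠ 0) :
    ∃ η : ℝ≥0∞, η ≠ 0 ∧ ∀ ρ : 𝔼 n → ℝ≥0∞, Measurable ρ → ∫⁻ z, ρ z ^ n ≤ η →
      ∀ A, IsLargeAt c r A → ∃ p ∈ A, ∃ q ∈ O, weightedDist ρ p q < ε := by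
  obtain ⟨m, rfl⟩ := Nat.exists_eq_succ_of_ne_zero hn.ne'
  obtain ⟨w, hw⟩ := hne
  set O' : Set (𝔼 (m + 1)) := O ∩ {z | boxNorm (z - w) < 1}
  have hO' : 0 < volume ((fun p : 𝔼 (m + 1) => p 0) '' O') :=
    volume_image_apply_pos 0 (hO.inter (isOpen_lt (continuous_boxNorm_sub w) continuous_const))
      ⟨w, hw, by simp [boxNorm]⟩
  have hr' : 0 < ENNReal.ofReal (r / (2 * (m + 1 : ℕ))) := ENNReal.ofReal_pos.2 (by positivity)
  have hc := boxNorm_nonneg c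
  have hw' := boxNorm_nonneg w
  obtain ⟨η, hη, hnear⟩ := exists_diagonal_near m (ENNReal.half_pos hε).ne' (lt_min hr' hO').ne'
    (show 0 < boxNorm c + 10 * r + (boxNorm w + 1) by positivity)
  refine ⟨η, hη, fun ρ hρ henergy A hA => ?_⟩
  obtain ⟨y, -, -, hy⟩ := hnear ρ hρ henergy
  obtain ⟨i, hi⟩ := hA
  obtain ⟨p, ⟨hpA, -⟩, hp⟩ := hy _ (fun p hp => by
    have hpc := boxNorm_add_le (p - c) c
    rw [sub_add_cancel] at hpc
    linarith [hp.2.2]) i ((min_le_left _ _).trans hi)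
  obtain ⟨q, ⟨hqO, -⟩, hq⟩ := hy O' (fun q hq => by
    have hqw := boxNorm_add_le (q - w) w
    rw [sub_add_cancel] at hqw
    linarith [show boxNorm (q - w) < 1 from hq.2]) 0 (min_le_right _ _)
  exact ⟨p, hpA, q, hqO, (weightedDist_triangle_left ρ p q y).trans_lt
    ((ENNReal.add_lt_add hp hq).trans_eq (ENNReal.add_halves ε))⟩

lemma lintegral_two_mul_pow {Ω : Type*} [MeasurableSpace Ω] (μ : Measure Ω) (f : Ω → ℝ≥0∞)
    (k : ℕ) : ∫⁻ x, (2 * f x) ^ k ∂μ = 2 ^ k * ∫⁻ x, f x ^ k ∂μ := by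
  simp only [mul_pow]
  exact lintegral_const_mul' _ _ (ENNReal.pow_ne_top ENNReal.ofNat_ne_top)

lemma exists_modulusDist_le_two_pow_mul (hG : IsOpen G) {A : Set (MobiusSpace n)} (hA : A ⊆ G)
    {ρ : 𝔼 n → ℝ≥0∞} (hρ : Measurable ρ) (hsep : Separates ρ (finitePart A) (finitePart Gᶜ))
    {p : G} {p' q : 𝔼 n} (hj : JoinedIn A (p : MobiusSpace n) p')
    (hq : weightedDist ρ p' q < 1 / 2) :
    ∃ h : (q : MobiusSpace n) ∈ G, modulusDist G p ⟨q, h⟩ ≤ 2 ^ n * ∫⁻ z, ρ z ^ n := by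
  set B : Set (MobiusSpace n) := (↑) '' weightedBall ρ p' (1 / 2)
  have hfar : finitePart (A ∪ B) ⊆ farFrom ρ (finitePart Gᶜ) := by
    rintro w (hw | ⟨w, hw, hww⟩)
    · exact hsep.subset_farFrom hw
    · cases OnePoint.coe_injective hww
      exact mem_farFrom_of_weightedDist_le hsep hj.target_mem (le_of_lt hw)
  have hAB : A ∪ B ⊆ G := by
    refine union_subset hA ?_
    rintro _ ⟨w, hw, rfl⟩
    exact not_not.1 (farFrom_subset_compl _ _ (hfar (Or.inr ⟨w, hw, rfl⟩)))
  have hjoined : JoinedIn (A ∪ B) (p : MobiusSpace n) q :=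
    (hj.mono subset_union_left).trans
      (((joinedIn_weightedBall hq).map OnePoint.continuous_coe).mono subset_union_right)
  refine ⟨hAB hjoined.target_mem, (modulusDist_le hG hAB hjoined).trans ?_⟩
  exact (capacity_le (hρ.const_mul 2) fun w hw =>
    separates_two_mul ρ _ w (hfar hw)).trans_eq (lintegral_two_mul_pow volume ρ n)

-- A curve that leaves `W` is large at a fixed scale around `p`, so the optimal weight for a curve
-- of small modulus cannot keep it away from `V`.
lemma exists_modulusDist_le_of_escape (hn : 0 < n) (hG : IsOpen G) {p : G}
    {W : Set (MobiusSpace n)} (hW : W ∈ 𝓝 (p : MobiusSpace n))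
    (h : ∀ ε : ℝ≥0∞, ε ≠ 0 → ∃ q : G, (q : MobiusSpace n) ∉ W ∧ modulusDist G p q < ε)
    {V : Set (MobiusSpace n)} (hV : (interior V).Nonempty) {ε : ℝ≥0∞} (hε : ε ≠ 0) :
    ∃ z : G, (z : MobiusSpace n) ∈ V ∧ modulusDist G p z ≤ ε := by
  have : Nonempty (Fin n) := ⟨⟨0, hn⟩⟩
  obtain ⟨c, s, hs⟩ := exists_isScaleAt hn (p : MobiusSpace n)
  obtain ⟨k, hk⟩ := (hs.crosses W hW).exists
  obtain ⟨V₀, hV₀, hlarge⟩ := eventually_smallSets.1 hk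
  have hne : (finitePart (interior V)).Nonempty :=
    OnePoint.denseRange_coe.exists_mem_open isOpen_interior hV
  obtain ⟨η, hη, hnear⟩ := exists_weightedDist_lt_of_isLargeAt hn c (pow_pos hs.pos k)
    (isOpen_interior.preimage OnePoint.continuous_coe) hne (ε := 1 / 2) (by simp)
  have htwo : (2 : ℝ≥0∞) ^ n ≠ ∞ := ENNReal.pow_ne_top ENNReal.ofNat_ne_top
  obtain ⟨q, hqW, hq⟩ := h (min η (ε / 2 ^ n))
    (lt_min (pos_iff_ne_zero.2 hη) (ENNReal.div_pos hε htwo)).ne'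
  obtain ⟨γ, hγ, hcap⟩ := exists_of_modulusDist_lt hG hq
  obtain ⟨ρ, hρ, hsep, hi⟩ := exists_of_capacity_lt hcap
  have hγlarge : IsLargeAt c (s ^ k) (finitePart (range γ)) :=
    hlarge V₀ subset_rfl _ (isPreconnected_range γ.continuous) ⟨q, γ.target_mem_range, hqW⟩
      ⟨p, γ.source_mem_range, mem_of_mem_nhds hV₀⟩
  obtain ⟨p', hp', z, hzV, hz⟩ := hnear ρ hρ (hi.le.trans (min_le_left _ _)) _ hγlarge
  obtain ⟨hzG, hle⟩ :=
    exists_modulusDist_le_two_pow_mul hG hγ hρ hsep (joinedIn_range γ hp') hz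
  refine ⟨⟨z, hzG⟩, interior_subset hzV, hle.trans ?_⟩
  calc (2 : ℝ≥0∞) ^ n * ∫⁻ z, ρ z ^ n ≤ 2 ^ n * (ε / 2 ^ n) := by
        gcongr
        exact hi.le.trans (min_le_right _ _)
    _ = ε := ENNReal.mul_div_cancel (by simp) htwo

lemma modulusDist_eq_zero_of_escape (hn : 2 ≤ n) (hG : IsOpen G) {p : G}
    {W : Set (MobiusSpace n)} (hW : W ∈ 𝓝 (p : MobiusSpace n))
    (h : ∀ ε : ℝ≥0∞, ε ≠ 0 → ∃ q : G, (q : MobiusSpace n) ∉ W ∧ modulusDist G p q < ε) (q : G) :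
    modulusDist G p q = 0 := by
  refine le_antisymm (le_of_forall_gt fun ε hε => ?_) zero_le
  obtain ⟨δ, hδ, hδε⟩ := exists_between hε
  have hδ' : δ / 2 ≠ 0 := (ENNReal.half_pos hδ.ne').ne'
  obtain ⟨V, hV, hnear⟩ := exists_nhds_modulusDist_le hn hG q hδ'
  obtain ⟨z, hzV, hz⟩ := exists_modulusDist_le_of_escape (by omega) hG hW h
    ⟨q, mem_interior_iff_mem_nhds.2 hV⟩ hδ'
  calc modulusDist G p q ≤ modulusDist G p z + modulusDist G z q := modulusDist_triangle hG p z q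
    _ ≤ δ / 2 + δ / 2 := add_le_add hz ((modulusDist_comm hG z q).trans_le (hnear z hzV))
    _ = δ := ENNReal.add_halves δ
    _ < ε := hδε

end Escape

/-! ### Completeness implies the M-condition -/

section Localization

variable {n : ℕ}

lemma exists_setLIntegral_le_of_antitone {X : Type*} [MeasurableSpace X] {μ : Measure X}
    {f : X → ℝ≥0∞} (hf : ∫⁻ x, f x ∂μ ≠ ∞) {S : ℕ → Set X} (hS : Antitone S)
    (hSm : ∀ k, MeasurableSet (S k)) (h0 : μ (⋂ k, S k) = 0) {ε : ℝ≥0∞} (hε : ε ≠ 0) :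
    ∃ k, ∫⁻ x in S k, f x ∂μ ≤ ε := by
  have : IsFiniteMeasure (μ.withDensity f) := isFiniteMeasure_withDensity hf
  have hlim := tendsto_measure_iInter_atTop (μ := μ.withDensity f)
    (fun k => (hSm k).nullMeasurableSet) hS ⟨0, measure_ne_top _ _⟩
  rw [withDensity_absolutelyContinuous μ f h0] at hlim
  obtain ⟨k, hk⟩ := (hlim.eventually_le_const (pos_iff_ne_zero.2 hε)).exists
  exact ⟨k, by rwa [Function.comp_apply, withDensity_apply _ (hSm k)] at hk⟩

lemma exists_nhds_energy_le (hn : 0 < n) (x : MobiusSpace n) {ρ : 𝔼 n → ℝ≥0∞}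
    (hi : ∫⁻ z, ρ z ^ n ≠ ∞) {ε : ℝ≥0∞} (hε : ε ≠ 0) :
    ∃ U ∈ 𝓝 x, IsOpen U ∧ ∫⁻ z in finitePart U, ρ z ^ n ≤ ε := by
  have : Nonempty (Fin n) := ⟨⟨0, hn⟩⟩
  obtain ⟨U, hU, hbasis⟩ := (nhds_basis_opens x).exists_antitone_subbasis
  have hinter : ⋂ k, finitePart (U k) = finitePart {x} := by
    rw [← preimage_iInter, ← ker_nhds, hbasis.ker]
    simp only [iInter_true]
  have hnull : volume (⋂ k, finitePart (U k)) = 0 := by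
    rw [hinter]
    exact (subsingleton_singleton.preimage OnePoint.coe_injective).measure_zero _
  obtain ⟨k, hk⟩ := exists_setLIntegral_le_of_antitone hi
    (fun _ _ hkl => preimage_mono (hbasis.antitone hkl))
    (fun k => ((hU k).2.preimage OnePoint.continuous_coe).measurableSet) hnull hε
  exact ⟨U k, (hU k).2.mem_nhds (hU k).1, (hU k).2, hk⟩

lemma Separates.localize {X : Type*} [PseudoMetricSpace X] {ρ ω : X → ℝ≥0∞} {A C F : Set X}
    (hsep : Separates ρ A C) (hω : Separates ω A Fᶜ) :
    Separates (fun z => max (F.indicator ρ z) (ω z)) A C := by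
  intro p hp q hq
  by_contra! hlt
  refine (hsep p hp q hq).not_gt (weightedBall_subset_of_le_on (fun z hz => ?_) hlt)
  have hzF : z ∈ F := by
    by_contra hzF
    exact ((hω p hp z hzF).trans (weightedDist_mono (fun w => le_max_right _ _) p z)).not_gt hz
  rw [indicator_of_mem hzF]
  exact le_max_left _ _

lemma capacity_le_setLIntegral_add (hn : n ≠ 0) {ρ : 𝔼 n → ℝ≥0∞} (hρ : Measurable ρ)
    {A C F : Set (𝔼 n)} (hsep : Separates ρ A C) (hF : MeasurableSet F) :
    capacity A C ≤ (∫⁻ z in F, ρ z ^ n) + capacity A Fᶜ := by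
  refine ENNReal.le_of_forall_pos_le_add fun ε hε hfin => ?_
  obtain ⟨ω, hω, hωsep, hωi⟩ := exists_of_capacity_lt
    (ENNReal.lt_add_right (ENNReal.add_lt_top.1 hfin).2.ne (ENNReal.coe_ne_zero.2 hε.ne'))
  calc capacity A C ≤ ∫⁻ z, max (F.indicator ρ z) (ω z) ^ n :=
        capacity_le ((hρ.indicator hF).max hω) (hsep.localize hωsep)
    _ ≤ (∫⁻ z in F, ρ z ^ n) + ∫⁻ z, ω z ^ n := lintegral_max_indicator_pow_le hρ hF hn
    _ ≤ (∫⁻ z in F, ρ z ^ n) + (capacity A Fᶜ + ε) := by gcongr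
    _ = _ := (add_assoc _ _ _).symm

lemma exists_nhds_capacity_le (hn : 2 ≤ n) (x : MobiusSpace n) {ρ : 𝔼 n → ℝ≥0∞}
    (hρ : Measurable ρ) (hi : ∫⁻ z, ρ z ^ n ≠ ∞) {A C : Set (𝔼 n)}
    (hA : Separates ρ A C) {ε : ℝ≥0∞} (hε : ε ≠ 0) :
    ∃ V ∈ 𝓝 x, capacity (A ∩ finitePart V) C ≤ ε := by
  have hε2 : ε / 2 ≠ 0 := (ENNReal.half_pos hε).ne'
  obtain ⟨U, hU, hUo, hUi⟩ := exists_nhds_energy_le (by omega) x hi hε2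
  obtain ⟨V, hV, hcap⟩ := exists_nhds_capacity_compl_le hn hU hε2
  have hF : MeasurableSet (finitePart U) := (hUo.preimage OnePoint.continuous_coe).measurableSet
  refine ⟨V, hV, ?_⟩
  calc capacity (A ∩ finitePart V) C
      ≤ (∫⁻ z in finitePart U, ρ z ^ n) + capacity (A ∩ finitePart V) (finitePart U)ᶜ :=
        capacity_le_setLIntegral_add (by omega) hρ (fun p hp => hA p hp.1) hF
    _ ≤ ε / 2 + ε / 2 := add_le_add hUi ((capacity_mono inter_subset_right subset_rfl).trans hcap)
    _ = ε := ENNReal.add_halves ε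

end Localization

section HubChain

variable {n : ℕ} {ρ : 𝔼 n → ℝ≥0∞} {c : 𝔼 n} {x : MobiusSpace n} {s : ℝ}

lemma IsHub.joinedIn {R R' : Set (𝔼 n)} {ε : ℝ≥0∞} {r r' : ℝ} {d d' : 𝔼 n}
    (h : IsHub ρ R ε c r d) (h' : IsHub ρ R' ε c r' d') (hr : r ∈ Icc (r' / 2) (2 * r')) :
    JoinedIn (R ∩ weightedBall ρ d ε ∪ R' ∩ weightedBall ρ d' ε) d d' := by
  obtain ⟨p, hd', hd⟩ := h.inter_nonempty _ (h'.isLargeAt r hr)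
  exact (JoinedIn.mono hd subset_union_left).trans (JoinedIn.mono hd' subset_union_right).symm

lemma IsHub.inter_subset_farFrom {R A C : Set (𝔼 n)} {r : ℝ} {d : 𝔼 n}
    (h : IsHub ρ R (1 / 4) c r d) (hA : IsLargeAt c r A) (hsep : Separates ρ (A ∩ R) C) :
    R ∩ weightedBall ρ d (1 / 4) ⊆ farFrom ρ C := by
  intro w hw
  obtain ⟨p, hpA, hdp⟩ := h.inter_nonempty A hA
  have hp := JoinedIn.target_mem hdp
  have hquarter : (1 / 4 + 1 / 4 : ℝ≥0∞) = 1 / 2 := by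
    rw [ENNReal.div_add_div_same, one_add_one_eq_two, ENNReal.div_eq_div_iff] <;> norm_num
  exact mem_farFrom_of_weightedDist_le hsep ⟨hpA, hp.1⟩
    ((weightedDist_triangle_left ρ p w d).trans
      ((add_le_add (le_of_lt hp.2) (le_of_lt hw.2)).trans_eq hquarter))

lemma IsScaleAt.pow_mem_Icc (hs : IsScaleAt x c s) (k : ℕ) :
    s ^ k ∈ Icc (s ^ (k + 1) / 2) (2 * s ^ (k + 1)) := by
  have hpos := pow_pos hs.pos k
  rw [pow_succ]
  rcases hs.eq_or with rfl | rfl <;> constructor <;> linarith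

lemma IsScaleAt.eventually_exists_isHub (hs : IsScaleAt x c s) (hn : 2 ≤ n) (hρ : Measurable ρ)
    (hi : ∫⁻ z, ρ z ^ n ≠ ∞) {ε : ℝ≥0∞} (hε : ε ≠ 0) :
    ∃ N : ℕ, ∀ᶠ k : ℕ in atTop,
      ∃ d, IsHub ρ (boxRing c (s ^ k / 2 ^ N) (2 ^ N * s ^ k)) ε c (s ^ k) d := by
  obtain ⟨N, η, hη, hhub⟩ := exists_hub hn hε
  obtain ⟨U, hU, -, henergy⟩ := exists_nhds_energy_le (by omega) x hi hη
  refine ⟨N, (hs.ring_subset U hU N).mono fun k hk => ?_⟩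
  exact hhub c (pow_pos hs.pos k) ρ hρ ((lintegral_mono_set hk).trans henergy)

lemma IsScaleAt.eventually_isLargeAt (hs : IsScaleAt x c s) {K : Set (MobiusSpace n)}
    (hK : IsPreconnected K) (hnt : K.Nontrivial) (hx : x ∈ K) :
    ∀ᶠ k : ℕ in atTop, IsLargeAt c (s ^ k) (finitePart K) := by
  obtain ⟨y, hyK, hyx⟩ := hnt.exists_ne x
  filter_upwards [hs.crosses {y}ᶜ (isOpen_compl_singleton.mem_nhds hyx.symm)] with k hk
  obtain ⟨V, hV, hlarge⟩ := eventually_smallSets.1 hk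
  exact hlarge V subset_rfl K hK ⟨y, hyK, by simp⟩ ⟨x, hx, mem_of_mem_nhds hV⟩

lemma IsScaleAt.coe_ne_of_mem_boxRing (hs : IsScaleAt x c s) {k N : ℕ} {p : 𝔼 n}
    (hp : p ∈ boxRing c (s ^ k / 2 ^ N) (2 ^ N * s ^ k)) : (p : MobiusSpace n) ≠ x := by
  rintro rfl
  obtain ⟨V, hV, hdisj⟩ := eventually_smallSets.1 (hs.ring_disjoint k N)
  have hpV : (p : MobiusSpace n) ∈ V := mem_of_mem_nhds hV
  exact disjoint_left.1 (hdisj V subset_rfl) hp hpV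

lemma exists_seq_joinedIn_farFrom (hn : 2 ≤ n) {K : Set (MobiusSpace n)} (hK : IsPreconnected K)
    (hnt : K.Nontrivial) (hx : x ∈ K) (hρ : Measurable ρ) (hi : ∫⁻ z, ρ z ^ n ≠ ∞)
    {C : Set (𝔼 n)} (hsep : Separates ρ (finitePart (K \ {x})) C) :
    ∃ d : ℕ → 𝔼 n, (∀ j, d j ∈ farFrom ρ C) ∧ ∀ V ∈ 𝓝 x, ∀ᶠ j in atTop,
      JoinedIn (farFrom ρ C ∩ finitePart V) (d j) (d (j + 1)) := by
  obtain ⟨c, s, hs⟩ := exists_isScaleAt (by omega) x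
  obtain ⟨N, hhub⟩ := hs.eventually_exists_isHub hn hρ hi (ε := 1 / 4) (by simp)
  obtain ⟨k₀, hk₀⟩ := eventually_atTop.1 (hhub.and (hs.eventually_isLargeAt hK hnt hx))
  set R : ℕ → Set (𝔼 n) := fun k => boxRing c (s ^ k / 2 ^ N) (2 ^ N * s ^ k)
  choose d hd using fun j => (hk₀ (k₀ + j) (Nat.le_add_right k₀ j)).1
  have hfar : ∀ j, R (k₀ + j) ∩ weightedBall ρ (d j) (1 / 4) ⊆ farFrom ρ C := fun j =>
    (hd j).inter_subset_farFrom (hk₀ (k₀ + j) (Nat.le_add_right k₀ j)).2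
      fun p hp => hsep p ⟨hp.1, hs.coe_ne_of_mem_boxRing hp.2⟩
  have hjoin : ∀ j, JoinedIn (R (k₀ + j) ∩ weightedBall ρ (d j) (1 / 4) ∪
      R (k₀ + (j + 1)) ∩ weightedBall ρ (d (j + 1)) (1 / 4)) (d j) (d (j + 1)) := fun j =>
    (hd j).joinedIn (hd (j + 1)) (hs.pow_mem_Icc (k₀ + j))
  refine ⟨d, fun j => union_subset (hfar j) (hfar (j + 1)) (hjoin j).source_mem, fun V hV => ?_⟩
  obtain ⟨k₁, hk₁⟩ := eventually_atTop.1 (hs.ring_subset V hV N)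
  filter_upwards [eventually_ge_atTop k₁] with j hj
  exact (hjoin j).mono (union_subset
    (subset_inter (hfar j) (inter_subset_left.trans (hk₁ _ (by omega))))
    (subset_inter (hfar (j + 1)) (inter_subset_left.trans (hk₁ _ (by omega)))))

lemma joinedIn_of_joinedIn_succ {X : Type*} [TopologicalSpace X] {F : Set X} {u : ℕ → X} {k₀ : ℕ}
    (h : ∀ k ≥ k₀, JoinedIn F (u k) (u (k + 1))) {k l : ℕ} (hk : k₀ ≤ k) (hl : k₀ ≤ l) :
    JoinedIn F (u k) (u l) := by
  have hjoin : ∀ l ≥ k₀, JoinedIn F (u k₀) (u l) := fun l hl => by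
    induction l, hl using Nat.le_induction with
    | base => exact JoinedIn.refl (h k₀ le_rfl).source_mem
    | succ l hl ih => exact ih.trans (h l hl)
  exact (hjoin k hk).symm.trans (hjoin l hl)

end HubChain

section Completeness

variable {n : ℕ} {G : Set (MobiusSpace n)}

lemma capacity_le_modulus (hG : IsOpen G) (K : Set (MobiusSpace n)) :
    capacity (finitePart (K ∩ G)) (finitePart Gᶜ) ≤ modulus (curvesJoining K Gᶜ G) := by
  rw [← modulus_curvesJoining hG inter_subset_right (frontier_subset_compl hG) subset_rfl]
  exact le_iInf₂ fun ρ hρ =>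
    iInf₂_le_of_le ρ ⟨hρ.1, fun γ hγ => hρ.2 γ ⟨hγ.1.1, hγ.2⟩⟩ le_rfl

lemma modulusDist_coe_le (hG : IsOpen G) {A : Set (𝔼 n)} (hA : A ⊆ (finitePart Gᶜ)ᶜ) {p q : 𝔼 n}
    (hp : (p : MobiusSpace n) ∈ G) (hq : (q : MobiusSpace n) ∈ G) (h : JoinedIn A p q) :
    modulusDist G ⟨p, hp⟩ ⟨q, hq⟩ ≤ capacity A (finitePart Gᶜ) := by
  have hAG : ((↑) : 𝔼 n → MobiusSpace n) '' A ⊆ G :=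
    image_subset_iff.2 fun w hw => not_not.1 (hA hw)
  refine (modulusDist_le hG hAG (h.map OnePoint.continuous_coe)).trans_eq ?_
  rw [finitePart, preimage_image_eq _ OnePoint.coe_injective]

lemma exists_cauchy_of_continuumCriterion (hn : 2 ≤ n) (hG : IsOpen G) {x : MobiusSpace n}
    (h : ContinuumCriterion Gᶜ x) :
    ∃ u : ℕ → G, Tendsto (fun k => (u k : MobiusSpace n)) atTop (𝓝 x) ∧
      ∀ ε : ℝ≥0∞, ε ≠ 0 → ∃ k₀, ∀ k ≥ k₀, ∀ l ≥ k₀, modulusDist G (u k) (u l) ≤ ε := by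
  obtain ⟨K, ⟨-, hKconn, hKnt⟩, hxK, hKsub, hmod⟩ := h
  rw [compl_compl] at hKsub hmod
  obtain ⟨ρ, hρ, hsep, hi⟩ := exists_of_capacity_lt ((capacity_le_modulus hG K).trans_lt hmod)
  have hsep' : Separates ρ (finitePart (K \ {x})) (finitePart Gᶜ) := fun p hp =>
    hsep p ⟨hp.1, (hKsub hp.1).resolve_left hp.2⟩
  obtain ⟨d, hfar, hjoin⟩ :=
    exists_seq_joinedIn_farFrom hn hKconn.isPreconnected hKnt hxK hρ hi.ne hsep'
  have hcompl := farFrom_subset_compl ρ (finitePart Gᶜ)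
  refine ⟨fun j => ⟨d j, not_not.1 (hcompl (hfar j))⟩, tendsto_def.2 fun V hV => ?_, fun ε hε => ?_⟩
  · exact (hjoin V hV).mono fun j hj => hj.source_mem.2
  · have hi2 : ∫⁻ z, (2 * ρ z) ^ n ≠ ∞ := by
      rw [lintegral_two_mul_pow]
      exact ENNReal.mul_ne_top (ENNReal.pow_ne_top ENNReal.ofNat_ne_top) hi.ne
    obtain ⟨V, hV, hcap⟩ := exists_nhds_capacity_le hn x (hρ.const_mul 2) hi2
      (separates_two_mul ρ (finitePart Gᶜ)) hε
    obtain ⟨k₀, hk₀⟩ := eventually_atTop.1 (hjoin V hV)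
    exact ⟨k₀, fun k hk l hl => (modulusDist_coe_le hG (inter_subset_left.trans hcompl) _ _
      (joinedIn_of_joinedIn_succ hk₀ hk hl)).trans hcap⟩

lemma IsCompleteMetric.eq_of_eq_zero {X : Type*} {d : X → X → ℝ≥0∞} (h : IsCompleteMetric d)
    {x y : X} (hxy : d x y = 0) : x = y := by
  obtain ⟨_, hd, -⟩ := h
  exact edist_eq_zero.1 ((hd x y).trans hxy)

lemma IsCompleteMetric.exists_eventually_lt {X : Type*} {d : X → X → ℝ≥0∞}
    (h : IsCompleteMetric d) {u : ℕ → X}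
    (hu : ∀ ε : ℝ≥0∞, ε ≠ 0 → ∃ k₀, ∀ k ≥ k₀, ∀ l ≥ k₀, d (u k) (u l) ≤ ε) :
    ∃ p, ∀ ε : ℝ≥0∞, ε ≠ 0 → ∀ᶠ k in atTop, d p (u k) < ε := by
  obtain ⟨_, hd, _⟩ := h
  have hcauchy : CauchySeq u := EMetric.cauchySeq_iff.2 fun ε hε => by
    obtain ⟨δ, hδ, hlt⟩ := exists_between hε
    obtain ⟨k₀, hk₀⟩ := hu δ hδ.ne'
    exact ⟨k₀, fun k hk l hl => ((hd _ _).trans_le (hk₀ k hk l hl)).trans_lt hlt⟩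
  obtain ⟨p, hp⟩ := cauchySeq_tendsto_of_complete hcauchy
  refine ⟨p, fun ε hε => ?_⟩
  filter_upwards [EMetric.tendsto_nhds.1 hp ε (pos_iff_ne_zero.2 hε)] with k hk
  rwa [← hd, edist_comm]

theorem isMDomain_of_isCompleteMetric (hn : 2 ≤ n) (hG : IsOpen G)
    (h : IsCompleteMetric (modulusDist G)) : IsMDomain G := by
  intro x hx hcrit
  obtain ⟨u, hux, hu⟩ := exists_cauchy_of_continuumCriterion hn hG hcrit
  obtain ⟨p, hp⟩ := h.exists_eventually_lt hu
  have hpx : (p : MobiusSpace n) ≠ x := fun hpx => frontier_subset_compl hG hx (hpx ▸ p.2)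
  obtain ⟨W, V, hW, hV, hpW, hxV, hWV⟩ := t2_separation hpx
  have hout : ∀ᶠ k in atTop, (u k : MobiusSpace n) ∉ W :=
    (hux.eventually_mem (hV.mem_nhds hxV)).mono fun k hk hkW => disjoint_left.1 hWV hkW hk
  have hescape : ∀ ε : ℝ≥0∞, ε ≠ 0 → ∃ q : G, (q : MobiusSpace n) ∉ W ∧ modulusDist G p q < ε :=
    fun ε hε => by
      obtain ⟨k, hkW, hk⟩ := (hout.and (hp ε hε)).exists
      exact ⟨u k, hkW, hk⟩
  obtain ⟨k, hkW⟩ := hout.exists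
  have hzero := modulusDist_eq_zero_of_escape hn hG (hW.mem_nhds hpW) hescape (u k)
  exact hkW (h.eq_of_eq_zero hzero ▸ hpW)

end Completeness

/-! ### Countable subadditivity of the capacity -/

section CountableSubadditivity

variable {ι : Type*} [Countable ι]

lemma exists_pow_lintegral_eq_tsum {Ω : Type*} [MeasurableSpace Ω] (μ : Measure Ω) {k : ℕ}
    (hk : k ≠ 0) {τ : ι → Ω → ℝ≥0∞} (hτ : ∀ i, Measurable (τ i)) :
    ∃ ρ : Ω → ℝ≥0∞, Measurable ρ ∧ (∀ i, τ i ≤ ρ) ∧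
      ∫⁻ z, ρ z ^ k ∂μ = ∑' i, ∫⁻ z, τ i z ^ k ∂μ := by
  have hpow : ∀ y : ℝ≥0∞, (y ^ ((k : ℝ)⁻¹)) ^ k = y := fun y => by
    rw [← ENNReal.rpow_mul_natCast, inv_mul_cancel₀ (Nat.cast_ne_zero.2 hk), ENNReal.rpow_one]
  refine ⟨fun z => (∑' i, τ i z ^ k) ^ ((k : ℝ)⁻¹), ?_, fun i z => ?_, ?_⟩
  · exact (Measurable.tsum fun i => (hτ i).pow_const k).pow_const _
  · rw [← ENNReal.pow_le_pow_left_iff hk, hpow]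
    exact ENNReal.le_tsum (f := fun i => τ i z ^ k) i
  · simp only [hpow]
    exact lintegral_tsum fun i => ((hτ i).pow_const k).aemeasurable

lemma capacity_iUnion_le {n : ℕ} (hn : n ≠ 0) (A : ι → Set (𝔼 n)) (C : Set (𝔼 n)) :
    capacity (⋃ i, A i) C ≤ ∑' i, capacity (A i) C := by
  refine ENNReal.le_of_forall_pos_le_add fun ε hε hfin => ?_
  obtain ⟨δ, hδ, hsum⟩ := ENNReal.exists_pos_sum_of_countable (ENNReal.coe_ne_zero.2 hε.ne') ι
  choose τ hτ hsep hτi using fun i => exists_of_capacity_lt (ENNReal.lt_add_right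
    (ENNReal.ne_top_of_tsum_ne_top hfin.ne i) (ENNReal.coe_ne_zero.2 (hδ i).ne'))
  obtain ⟨ρ, hρ, hle, hρi⟩ := exists_pow_lintegral_eq_tsum volume hn hτ
  have hρsep : Separates ρ (⋃ i, A i) C := fun p hp q hq => by
    obtain ⟨i, hi⟩ := mem_iUnion.1 hp
    exact (hsep i p hi q hq).trans (weightedDist_mono (hle i) p q)
  calc capacity (⋃ i, A i) C ≤ ∑' i, ∫⁻ z, τ i z ^ n := (capacity_le hρ hρsep).trans_eq hρi
    _ ≤ ∑' i, (capacity (A i) C + δ i) := ENNReal.tsum_le_tsum fun i => (hτi i).le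
    _ = (∑' i, capacity (A i) C) + ∑' i, (δ i : ℝ≥0∞) := ENNReal.tsum_add
    _ ≤ _ := by gcongr

variable {n : ℕ} {G A : Set (MobiusSpace n)} {x : MobiusSpace n}

lemma capacity_singleton_compl (hn : 2 ≤ n) (x : MobiusSpace n) :
    capacity (finitePart {x}) (finitePart {x}ᶜ) = 0 := by
  obtain ⟨U, hU⟩ := (𝓝 x).exists_antitone_basis
  have hcompl : finitePart {x}ᶜ = ⋃ k, finitePart (U k)ᶜ := by
    have hker : ⋂ k, U k = {x} := by
      rw [← ker_nhds, hU.1.ker]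
      simp only [iInter_true]
    rw [← preimage_iUnion, ← compl_iInter, hker]
  have hzero : ∀ k, capacity (finitePart (U k)ᶜ) (finitePart {x}) = 0 := fun k => by
    refine le_antisymm (le_of_forall_gt fun ε hε => ?_) zero_le
    obtain ⟨δ, hδ, hδε⟩ := exists_between hε
    obtain ⟨V, hV, hcap⟩ := exists_nhds_capacity_compl_le hn (hU.mem k) hδ.ne'
    rw [capacity_comm]
    exact ((capacity_mono (preimage_mono (singleton_subset_iff.2 (mem_of_mem_nhds hV)))
      subset_rfl).trans hcap).trans_lt hδε
  rw [capacity_comm, hcompl]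
  refine le_antisymm ((capacity_iUnion_le (by omega) _ _).trans_eq ?_) zero_le
  simp only [hzero, tsum_zero]

lemma admissible_insert (hx : x ∉ G) {ρ ω : 𝔼 n → ℝ≥0∞} (hρ : Measurable ρ) (hω : Measurable ω)
    (hsep : Separates ρ (finitePart A) (finitePart Gᶜ))
    (hωsep : Separates ω (finitePart {x}) (finitePart {x}ᶜ)) :
    Admissible (curvesJoining (insert x A) Gᶜ G) fun z => max (ρ z) (ω z) := by
  refine ⟨hρ.max hω, fun γ ⟨h0, h1, hG⟩ g hg hvar => ?_⟩
  have hline := weightedDist_le_lineIntegral (ρ := fun z => max (ρ z) (ω z))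
    (continuous_of_coe_eq hg) hvar
  rcases h0 with h0 | h0
  · set t : I := ⟨1 / 2, by norm_num, by norm_num⟩
    have ht : γ t ∈ G :=
      hG t ⟨Subtype.mk_lt_mk.2 (by norm_num), Subtype.mk_lt_mk.2 (by norm_num)⟩
    rw [hg] at h0 ht
    have hone : 1 ≤ weightedDist ω (g 0) (g t) :=
      hωsep _ h0 _ fun hxt => hx (mem_singleton_iff.1 hxt ▸ ht)
    exact (hone.trans (weightedDist_mono (fun z => le_max_right _ _) _ _)).trans (hline 0 t)
  · rw [hg] at h0 h1
    exact ((hsep _ h0 _ h1).trans (weightedDist_mono (fun z => le_max_left _ _) _ _)).trans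
      (hline 0 1)

lemma modulus_insert_le (hn : 2 ≤ n) (hx : x ∉ G) (A : Set (MobiusSpace n)) :
    modulus (curvesJoining (insert x A) Gᶜ G) ≤ capacity (finitePart A) (finitePart Gᶜ) := by
  refine ENNReal.le_of_forall_pos_le_add fun ε hε hfin => ?_
  have hε2 : (ε / 2 : ℝ≥0∞) ≠ 0 := (ENNReal.half_pos (ENNReal.coe_ne_zero.2 hε.ne')).ne'
  obtain ⟨ρ, hρ, hsep, hρi⟩ := exists_of_capacity_lt (ENNReal.lt_add_right hfin.ne hε2)
  obtain ⟨ω, hω, hωsep, hωi⟩ := exists_of_capacity_lt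
    ((capacity_singleton_compl hn x).trans_lt (pos_iff_ne_zero.2 hε2))
  calc modulus (curvesJoining (insert x A) Gᶜ G) ≤ ∫⁻ z, max (ρ z) (ω z) ^ n :=
        iInf₂_le _ (admissible_insert hx hρ hω hsep hωsep)
    _ ≤ (∫⁻ z, ρ z ^ n) + ∫⁻ z, ω z ^ n := lintegral_max_pow_le hρ n
    _ ≤ capacity (finitePart A) (finitePart Gᶜ) + ε / 2 + ε / 2 := add_le_add hρi.le hωi.le
    _ = _ := by rw [add_assoc, ENNReal.add_halves]

end CountableSubadditivity

/-! ### Chains of continua -/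

section Chain

lemma isCompact_insert_iUnion {X : Type*} [TopologicalSpace X] {x : X} {Q : ℕ → Set X}
    (hQ : ∀ i, IsCompact (Q i)) (hlim : ∀ W ∈ 𝓝 x, ∀ᶠ i in atTop, Q i ⊆ W) :
    IsCompact (insert x (⋃ i, Q i)) := by
  refine isCompact_iff_ultrafilter_le_nhds'.2 fun f hf => ?_
  by_cases hex : ∃ i, Q i ∈ f
  · obtain ⟨i, hi⟩ := hex
    obtain ⟨z, hz, hfz⟩ := isCompact_iff_ultrafilter_le_nhds'.1 (hQ i) f hi
    exact ⟨z, Or.inr (mem_iUnion.2 ⟨i, hz⟩), hfz⟩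
  · refine ⟨x, mem_insert _ _, fun W hW => ?_⟩
    obtain ⟨i, hi⟩ := eventually_atTop.1 (hlim W hW)
    have hcover : insert x (⋃ i, Q i) ⊆ W ∪ ⋃ k ∈ Iio i, Q k := by
      refine insert_subset (Or.inl (mem_of_mem_nhds hW)) (iUnion_subset fun k => ?_)
      rcases lt_or_ge k i with hki | hki
      · exact (subset_biUnion_of_mem (u := Q) (mem_Iio.2 hki)).trans subset_union_right
      · exact (hi k hki).trans subset_union_left
    refine (Ultrafilter.union_mem_iff.1 (mem_of_superset hf hcover)).resolve_right fun hmem => ?_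
    obtain ⟨k, -, hk⟩ := (Ultrafilter.finite_biUnion_mem_iff (finite_Iio i)).1 hmem
    exact hex ⟨k, hk⟩

lemma isConnected_insert_iUnion {X : Type*} [TopologicalSpace X] {x : X} {Q : ℕ → Set X}
    (hQ : ∀ i, IsConnected (Q i)) (hchain : ∀ i, (Q i ∩ Q (i + 1)).Nonempty)
    (hlim : ∀ W ∈ 𝓝 x, ∀ᶠ i in atTop, Q i ⊆ W) : IsConnected (insert x (⋃ i, Q i)) := by
  refine (IsConnected.iUnion_of_chain hQ hchain).subset_closure (subset_insert _ _)
    (insert_subset (mem_closure_iff_nhds.2 fun W hW => ?_) subset_closure)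
  obtain ⟨i, hi⟩ := (hlim W hW).exists
  obtain ⟨z, hz⟩ := (hQ i).nonempty
  exact ⟨z, hi hz, mem_iUnion.2 ⟨i, hz⟩⟩

variable {n : ℕ} {G : Set (MobiusSpace n)} {x : MobiusSpace n}

lemma continuumCriterion_of_chain (hn : 2 ≤ n) (hx : x ∉ G) {Q : ℕ → Set (MobiusSpace n)}
    (hQc : ∀ i, IsCompact (Q i)) (hQ : ∀ i, IsConnected (Q i)) (hQG : ∀ i, Q i ⊆ G)
    (hchain : ∀ i, (Q i ∩ Q (i + 1)).Nonempty) (hlim : ∀ W ∈ 𝓝 x, ∀ᶠ i in atTop, Q i ⊆ W)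
    (hcap : ∑' i, capacity (finitePart (Q i)) (finitePart Gᶜ) ≠ ∞) :
    ContinuumCriterion Gᶜ x := by
  refine ⟨insert x (⋃ i, Q i), ⟨isCompact_insert_iUnion hQc hlim,
    isConnected_insert_iUnion hQ hchain hlim, ?_⟩, mem_insert _ _, ?_, ?_⟩
  · obtain ⟨z, hz⟩ := (hQ 0).nonempty
    exact ⟨x, mem_insert _ _, z, Or.inr (mem_iUnion.2 ⟨0, hz⟩), fun hxz => hx (hxz ▸ hQG 0 hz)⟩
  · rw [compl_compl]
    exact insert_subset (Or.inl rfl) (iUnion_subset fun i => (hQG i).trans subset_union_right)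
  · rw [compl_compl]
    refine (modulus_insert_le hn hx _).trans_lt (lt_of_le_of_lt ?_ hcap.lt_top)
    rw [finitePart, preimage_iUnion]
    exact capacity_iUnion_le (by omega) _ _

end Chain

/-! ### Chains of neighbourhoods -/

section NhdsChain

variable {n : ℕ} {x : MobiusSpace n} {R : ℝ≥0∞} {U : ℕ → Set (MobiusSpace n)}

/-- A neighbourhood basis of `x` consisting of nested open sets, in which the capacities of
consecutive members are summable and connected sets that cross from one member to the next are
joined by short curves with respect to every weight of energy at most `R`. -/
structure NhdsChain (x : MobiusSpace n) (R : ℝ≥0∞) (U : ℕ → Set (MobiusSpace n)) : Prop where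
  isOpen : ∀ i, IsOpen (U i)
  mem : ∀ i, x ∈ U i
  closure_subset : ∀ i, closure (U (i + 1)) ⊆ U i
  exists_subset : ∀ W ∈ 𝓝 x, ∃ i, U i ⊆ W
  capacity_le : ∀ i, capacity (finitePart (U (i + 1))) (finitePart (U i)ᶜ) ≤ 2⁻¹ ^ i
  connects : ∀ i, Connects R (1 / 2) (U i) (U (i + 1))

lemma exists_nhds_closure_subset_capacity_le_connects (hn : 2 ≤ n) {S B : Set (MobiusSpace n)}
    (hS : S ∈ 𝓝 x) (hB : B ∈ 𝓝 x) (hR : R ≠ ∞) {ε δ : ℝ≥0∞} (hε : ε ≠ 0) (hδ : δ ≠ 0) :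
    ∃ V ∈ 𝓝 x, IsOpen V ∧ closure V ⊆ S ∧ V ⊆ B ∧
      capacity (finitePart V) (finitePart Sᶜ) ≤ ε ∧ Connects R δ S V := by
  obtain ⟨V₁, hV₁, hcap⟩ := exists_nhds_capacity_compl_le hn hS hε
  obtain ⟨V₂, hV₂, hcon⟩ := exists_nhds_connects hn hS hR hδ
  obtain ⟨F, hF, hFc, hFsub⟩ := exists_mem_nhds_isClosed_subset
    (inter_mem (inter_mem hV₁ hV₂) (inter_mem hS hB))
  have hsub := interior_subset.trans hFsub
  exact ⟨interior F, interior_mem_nhds.2 hF, isOpen_interior,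
    (closure_minimal interior_subset hFc).trans fun z hz => (hFsub hz).2.1,
    fun z hz => (hsub hz).2.2,
    (capacity_mono (preimage_mono fun z hz => (hsub hz).1.1) subset_rfl).trans hcap,
    hcon.anti fun z hz => (hsub hz).1.2⟩

lemma exists_nhdsChain (hn : 2 ≤ n) {W : Set (MobiusSpace n)} (hW : W ∈ 𝓝 x) (hR : R ≠ ∞) :
    ∃ U, NhdsChain x R U ∧ U 0 ⊆ W := by
  obtain ⟨B, hB⟩ := (𝓝 x).exists_antitone_basis
  choose! next hmem hopen hclosure hbasis hcap hcon using fun (i : ℕ) (S : Set (MobiusSpace n))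
      (hS : S ∈ 𝓝 x) => exists_nhds_closure_subset_capacity_le_connects hn hS (hB.mem i) hR
    (pow_ne_zero i (by simp) : (2⁻¹ : ℝ≥0∞) ^ i ≠ 0) (by simp : (1 / 2 : ℝ≥0∞) ≠ 0)
  let U : ℕ → Set (MobiusSpace n) := fun i => Nat.rec (interior W) next i
  have hU : ∀ i, U i ∈ 𝓝 x := fun i => by
    induction i with
    | zero => exact interior_mem_nhds.2 hW
    | succ i ih => exact hmem i _ ih
  refine ⟨U, ⟨fun i => ?_, fun i => mem_of_mem_nhds (hU i), fun i => hclosure i _ (hU i),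
    fun S hS => ?_, fun i => hcap i _ (hU i), fun i => hcon i _ (hU i)⟩, interior_subset⟩
  · cases i with
    | zero => exact isOpen_interior
    | succ i => exact hopen i _ (hU i)
  · obtain ⟨i, -, hi⟩ := hB.1.mem_iff.1 hS
    exact ⟨i + 1, (hbasis i _ (hU i)).trans hi⟩

lemma NhdsChain.antitone (h : NhdsChain x R U) : Antitone U :=
  antitone_nat_of_succ_le fun i => subset_closure.trans (h.closure_subset i)

lemma NhdsChain.measurableSet_finitePart (h : NhdsChain x R U) (i : ℕ) :
    MeasurableSet (finitePart (U i)) :=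
  ((h.isOpen i).preimage OnePoint.continuous_coe).measurableSet

lemma NhdsChain.eventually_subset (h : NhdsChain x R U) {W : Set (MobiusSpace n)}
    (hW : W ∈ 𝓝 x) : ∀ᶠ i in atTop, U i ⊆ W := by
  obtain ⟨i, hi⟩ := h.exists_subset W hW
  exact eventually_atTop.2 ⟨i, fun k hk => (h.antitone hk).trans hi⟩

lemma NhdsChain.capacity_le_of_subset (h : NhdsChain x R U) (hn : n ≠ 0) {ρ : 𝔼 n → ℝ≥0∞}
    (hρ : Measurable ρ) {A C : Set (𝔼 n)} (hA : A ⊆ farFrom ρ C) {i k : ℕ}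
    (hAU : A ⊆ finitePart (U (i + 1) \ U (i + k))) :
    capacity A C ≤ 2 ^ n * (∫⁻ z in finitePart (U i) \ finitePart (U (i + (k + 1))), ρ z ^ n) +
      (2⁻¹ ^ i + 2⁻¹ ^ i) := by
  set F : Set (𝔼 n) := finitePart (U i) \ finitePart (U (i + (k + 1)))
  have hF : MeasurableSet F := (h.measurableSet_finitePart i).diff (h.measurableSet_finitePart _)
  have hFc : Fᶜ = finitePart (U i)ᶜ ∪ finitePart (U (i + k + 1)) :=
    compl_sdiff.trans (union_comm _ _)
  have houter : capacity (finitePart (U i)ᶜ) A ≤ 2⁻¹ ^ i := by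
    rw [capacity_comm]
    exact (capacity_mono (hAU.trans (preimage_mono sdiff_subset)) subset_rfl).trans
      (h.capacity_le i)
  have hinner : capacity (finitePart (U (i + k + 1))) A ≤ 2⁻¹ ^ i :=
    calc capacity (finitePart (U (i + k + 1))) A
        ≤ capacity (finitePart (U (i + k + 1))) (finitePart (U (i + k))ᶜ) :=
          capacity_mono subset_rfl (hAU.trans (preimage_mono fun z hz => hz.2))
      _ ≤ 2⁻¹ ^ (i + k) := h.capacity_le (i + k)
      _ ≤ 2⁻¹ ^ i := pow_le_pow_right_of_le_one' (by simp) (Nat.le_add_right i k)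
  calc capacity A C ≤ (∫⁻ z in F, (2 * ρ z) ^ n) + capacity A Fᶜ :=
        capacity_le_setLIntegral_add hn (hρ.const_mul 2)
          (fun p hp => separates_two_mul ρ C p (hA hp)) hF
    _ ≤ _ := by
        rw [lintegral_two_mul_pow, capacity_comm, hFc]
        gcongr
        exact capacity_union_le.trans (add_le_add houter hinner)

end NhdsChain

/-! ### Diagonal choice of weights -/

section Diagonal

-- The limits of the rows along a nonprincipal ultrafilter have sum at most `M`.
lemma exists_diagonal_tsum_le {f : ℕ → ℕ → ℝ≥0∞} {M : ℝ≥0∞}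
    (hf : ∀ j m, ∑ i ∈ Finset.range m, f i j ≤ M) (k : ℕ) :
    ∃ J : ℕ → ℕ, (∀ i, i + k ≤ J i) ∧ ∑' i, f i (J i) ≤ M + 2 := by
  by_cases hM : M = ∞
  · exact ⟨fun i => i + k, fun i => le_rfl, by simp [hM]⟩
  have hlim : ∀ i, ∃ L, Tendsto (f i) (hyperfilter ℕ : Filter ℕ) (𝓝 L) := fun i => by
    obtain ⟨L, -, hL⟩ := isCompact_iff_ultrafilter_le_nhds'.1 (isCompact_univ (X := ℝ≥0∞))
      ((hyperfilter ℕ).map (f i)) univ_mem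
    exact ⟨L, hL⟩
  choose L hL using hlim
  have hsum : ∀ m, ∑ i ∈ Finset.range m, L i ≤ M := fun m =>
    le_of_tendsto' (tendsto_finsetSum _ fun i _ => hL i) fun j => hf j m
  have hLtop : ∀ i, L i ≠ ∞ := fun i => ne_top_of_le_ne_top hM
    ((Finset.single_le_sum (fun _ _ => zero_le) (Finset.self_mem_range_succ i)).trans
      (hsum (i + 1)))
  have hJ : ∀ i, ∃ j, i + k ≤ j ∧ f i j < L i + 2⁻¹ ^ i := fun i =>
    (((eventually_ge_atTop (i + k)).filter_mono Nat.hyperfilter_le_atTop).and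
      ((hL i).eventually_lt_const
        (ENNReal.lt_add_right (hLtop i) (pow_ne_zero _ (by simp))))).exists
  choose J hJk hJ using hJ
  refine ⟨J, hJk, ?_⟩
  calc ∑' i, f i (J i) ≤ ∑' i, (L i + 2⁻¹ ^ i) := ENNReal.tsum_le_tsum fun i => (hJ i).le
    _ = (∑' i, L i) + 2 := by rw [ENNReal.tsum_add, ENNReal.tsum_geometric_two]
    _ ≤ M + 2 := add_le_add_left (ENNReal.tsum_le_of_sum_range_le hsum) 2

variable {Ω : Type*} [MeasurableSpace Ω] {μ : Measure Ω} {S : ℕ → Set Ω}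

lemma sum_setLIntegral_sdiff_succ_le (hS : ∀ i, MeasurableSet (S i)) (hanti : Antitone S)
    (f : Ω → ℝ≥0∞) (m : ℕ) :
    ∑ i ∈ Finset.range m, ∫⁻ z in S i \ S (i + 1), f z ∂μ ≤ ∫⁻ z, f z ∂μ := by
  have hdisj : Pairwise (Function.onFun Disjoint fun i => S i \ S (i + 1)) :=
    (pairwise_disjoint_on _).2 fun i j hij =>
      disjoint_sdiff_left.mono_right (sdiff_subset.trans (hanti hij))
  rw [← lintegral_biUnion_finset (hdisj.set_pairwise _)
    fun i _ => (hS i).diff (hS (i + 1))]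
  exact setLIntegral_le_lintegral _ _

lemma sum_setLIntegral_sdiff_le (hS : ∀ i, MeasurableSet (S i)) (hanti : Antitone S)
    (f : Ω → ℝ≥0∞) (k m : ℕ) :
    ∑ i ∈ Finset.range m, ∫⁻ z in S i \ S (i + k), f z ∂μ ≤ k * ∫⁻ z, f z ∂μ := by
  induction k with
  | zero => simp
  | succ k ih =>
    have hsplit : ∀ i, ∫⁻ z in S i \ S (i + (k + 1)), f z ∂μ ≤
        (∫⁻ z in S i \ S (i + k), f z ∂μ) + ∫⁻ z in S (i + k) \ S (i + 1 + k), f z ∂μ :=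
      fun i => (lintegral_mono_set (by
        rw [add_right_comm i 1 k]
        exact sdiff_triangle _ _ _)).trans (lintegral_union_le _ _ _)
    calc ∑ i ∈ Finset.range m, ∫⁻ z in S i \ S (i + (k + 1)), f z ∂μ
        ≤ (∑ i ∈ Finset.range m, ∫⁻ z in S i \ S (i + k), f z ∂μ) +
          ∑ i ∈ Finset.range m, ∫⁻ z in S (i + k) \ S (i + 1 + k), f z ∂μ := by
          rw [← Finset.sum_add_distrib]
          exact Finset.sum_le_sum fun i _ => hsplit i
      _ ≤ k * (∫⁻ z, f z ∂μ) + ∫⁻ z, f z ∂μ := add_le_add ih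
          (sum_setLIntegral_sdiff_succ_le (S := fun i => S (i + k)) (fun i => hS (i + k))
            (fun i j hij => hanti (Nat.add_le_add_right hij k)) f m)
      _ = _ := by rw [Nat.cast_succ, add_one_mul]

lemma NhdsChain.exists_diagonal {n : ℕ} {x : MobiusSpace n} {R E : ℝ≥0∞}
    {U : ℕ → Set (MobiusSpace n)} (h : NhdsChain x R U) {ρ : ℕ → 𝔼 n → ℝ≥0∞}
    (hρ : ∀ j, ∫⁻ z, ρ j z ^ n ≤ E) (k : ℕ) : ∃ J : ℕ → ℕ, (∀ i, i + k ≤ J i) ∧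
      ∑' i, ∫⁻ z in finitePart (U i) \ finitePart (U (i + k)), ρ (J i) z ^ n ≤ k * E + 2 :=
  exists_diagonal_tsum_le (fun j m => (sum_setLIntegral_sdiff_le h.measurableSet_finitePart
    (fun _ _ hij => preimage_mono (h.antitone hij)) (fun z => ρ j z ^ n) k m).trans
      (mul_le_mul_right (hρ j) _)) k

end Diagonal

/-! ### The M-condition implies properness -/

section Crossing

lemma exists_subcurve {X : Type*} [TopologicalSpace X] {γ : I → X} (hγ : Continuous γ)
    {A B : Set X} (hA : IsClosed A) (hB : IsClosed B) (hAB : Disjoint A B) (h0 : γ 0 ∈ A)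
    (h1 : γ 1 ∈ B) : ∃ P ⊆ range γ, IsCompact P ∧ IsConnected P ∧ (P ∩ A).Nonempty ∧
      (P ∩ B).Nonempty ∧ P ⊆ closure Aᶜ ∧ P ⊆ closure Bᶜ := by
  obtain ⟨s, hsA, hs⟩ := (hA.preimage hγ).isCompact.exists_isGreatest ⟨0, h0⟩
  obtain ⟨t, ⟨htB, hst⟩, ht⟩ := ((hB.preimage hγ).inter isClosed_Ici).isCompact.exists_isLeast
    (⟨1, h1, unitInterval.le_one'⟩ : (γ ⁻¹' B ∩ Ici s).Nonempty)
  have hlt : s < t := lt_of_le_of_ne hst fun h => disjoint_left.1 hAB hsA (h ▸ htB)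
  have himage : γ '' Icc s t ⊆ closure (γ '' Ioo s t) := by
    rw [← closure_Ioo hlt.ne]
    exact image_closure_subset_closure_image hγ
  refine ⟨γ '' Icc s t, image_subset_range _ _, isCompact_Icc.image hγ,
    ⟨⟨γ s, s, left_mem_Icc.2 hst, rfl⟩, isPreconnected_Icc.image γ hγ.continuousOn⟩,
    ⟨γ s, ⟨s, left_mem_Icc.2 hst, rfl⟩, hsA⟩, ⟨γ t, ⟨t, right_mem_Icc.2 hst, rfl⟩, htB⟩,
    himage.trans (closure_mono ?_), himage.trans (closure_mono ?_)⟩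
  · rintro _ ⟨u, hu, rfl⟩ huA
    exact not_le.2 hu.1 (hs huA)
  · rintro _ ⟨u, hu, rfl⟩ huB
    exact not_le.2 hu.2 (ht ⟨huB, hu.1.le⟩)

variable {n : ℕ} {x : MobiusSpace n} {R : ℝ≥0∞} {U : ℕ → Set (MobiusSpace n)} {i : ℕ}
  {G P P' : Set (MobiusSpace n)}

/-- A continuum in the ring `U (i + 1) \ U (i + 5)` that crosses the ring `U (i + 2) \ U (i + 4)`.
The offsets are chosen so that crossings of index `i` and `i + 1` both cross the ring
`U (i + 3) \ U (i + 4)`. -/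
structure IsCrossing (U : ℕ → Set (MobiusSpace n)) (i : ℕ) (P : Set (MobiusSpace n)) : Prop where
  isCompact : IsCompact P
  isConnected : IsConnected P
  inter_compl : (P ∩ (U (i + 2))ᶜ).Nonempty
  inter : (P ∩ U (i + 4)).Nonempty
  subset : P ⊆ U (i + 1) \ U (i + 5)

lemma NhdsChain.exists_isCrossing (h : NhdsChain x R U) {a q : MobiusSpace n} (γ : Path a q)
    (ha : a ∉ U (i + 2)) (hq : q ∈ U (i + 5)) : ∃ P ⊆ range γ, IsCrossing U i P := by
  have hclosure : closure (U (i + 5)) ⊆ U (i + 4) := h.closure_subset (i + 4)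
  obtain ⟨P, hPγ, hPc, hPconn, hPA, hPB, hPA', hPB'⟩ := exists_subcurve γ.continuous
    (h.isOpen (i + 2)).isClosed_compl (isClosed_closure (s := U (i + 5)))
    (disjoint_compl_left_iff_subset.2 (hclosure.trans (h.antitone (by omega))))
    (by simpa only [Path.source, mem_compl_iff] using ha)
    (by simpa only [Path.target] using subset_closure hq)
  rw [compl_compl] at hPA'
  have hPcompl : P ⊆ (U (i + 5))ᶜ := hPB'.trans
    (closure_minimal (compl_subset_compl.2 subset_closure) (h.isOpen _).isClosed_compl)
  exact ⟨P, hPγ, hPc, hPconn, hPA, hPB.mono (inter_subset_inter_right _ hclosure),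
    fun z hz => ⟨h.closure_subset (i + 1) (hPA' hz), hPcompl hz⟩⟩

lemma IsCrossing.exists_link (hP : IsCrossing U i P) (hP' : IsCrossing U (i + 1) P')
    (h : NhdsChain x R U) {ρ : 𝔼 n → ℝ≥0∞} (hρ : Measurable ρ) (hi : ∫⁻ z, ρ z ^ n ≤ R)
    (hPG : P ⊆ G) (hsep : Separates ρ (finitePart P) (finitePart Gᶜ)) :
    ∃ Q ⊆ G, IsCrossing U i Q ∧ P ⊆ Q ∧ (Q ∩ P').Nonempty ∧
      finitePart Q ⊆ farFrom ρ (finitePart Gᶜ) := by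
  have hle : (U (i + 2))ᶜ ⊆ (U (i + 3))ᶜ := compl_subset_compl.2 (h.antitone (by omega))
  obtain ⟨p, hp, r, hr, η, hη⟩ := h.connects (i + 3) ρ hρ hi P P' hP.isConnected.isPreconnected
    hP'.isConnected.isPreconnected (hP.inter_compl.mono (inter_subset_inter_right _ hle)) hP.inter
    hP'.inter_compl (hP'.inter.mono (inter_subset_inter_right _ (h.antitone (by omega))))
  set T : Set (MobiusSpace n) := (↑) '' range η
  have hring : T ⊆ U (i + 1) \ U (i + 5) := by
    rintro _ ⟨_, ⟨t, rfl⟩, rfl⟩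
    exact ⟨h.antitone (by omega) (hη t).1.1, fun h5 => (hη t).1.2 (h.antitone (by omega) h5)⟩
  have hfar : range η ⊆ farFrom ρ (finitePart Gᶜ) := range_subset_iff.2 fun t =>
    mem_farFrom_of_weightedDist_le hsep hp (hη t).2.le
  have hTG : T ⊆ G := image_subset_iff.2 fun w hw =>
    not_not.1 (farFrom_subset_compl _ _ (hfar hw))
  have hconn : IsConnected (P ∪ T) := hP.isConnected.union ⟨p, hp, p, η.source_mem_range, rfl⟩
    ((isConnected_range η.continuous).image _ OnePoint.continuous_coe.continuousOn)
  refine ⟨P ∪ T, union_subset hPG hTG,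
    ⟨hP.isCompact.union ((isCompact_range η.continuous).image OnePoint.continuous_coe), hconn,
      hP.inter_compl.mono (inter_subset_inter_left _ subset_union_left),
      hP.inter.mono (inter_subset_inter_left _ subset_union_left), union_subset hP.subset hring⟩,
    subset_union_left, ⟨r, Or.inr ⟨r, η.target_mem_range, rfl⟩, hr⟩, ?_⟩
  rw [finitePart, preimage_union, preimage_image_eq _ OnePoint.coe_injective]
  exact union_subset hsep.subset_farFrom hfar

lemma NhdsChain.continuumCriterion_of_paths (h : NhdsChain x R U) (hn : 2 ≤ n) (hR : R ≠ ∞)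
    (hx : x ∉ G) {a : MobiusSpace n} (ha : a ∉ U 0) {q : ℕ → MobiusSpace n} (hq : ∀ j, q j ∈ U j)
    {γ : ∀ j, Path a (q j)} (hγ : ∀ j, range (γ j) ⊆ G)
    (hcap : ∀ j, capacity (finitePart (range (γ j))) (finitePart Gᶜ) < R) :
    ContinuumCriterion Gᶜ x := by
  choose ρ hρ hsep hρR using fun j => exists_of_capacity_lt (hcap j)
  obtain ⟨J, hJ, hsum⟩ := h.exists_diagonal (fun j => (hρR j).le) 6
  choose P hPγ hP using fun i => h.exists_isCrossing (i := i) (γ (J i))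
    (fun hmem => ha (h.antitone (Nat.zero_le _) hmem))
    (h.antitone (by have := hJ i; omega) (hq (J i)))
  choose Q hQG hQ hPQ hQP hfar using fun i => (hP i).exists_link (hP (i + 1)) h (hρ (J i))
    (hρR (J i)).le ((hPγ i).trans (hγ (J i))) fun p hp => hsep (J i) p (hPγ i hp)
  have hcapQ : ∀ i, capacity (finitePart (Q i)) (finitePart Gᶜ) ≤
      2 ^ n * (∫⁻ z in finitePart (U i) \ finitePart (U (i + 6)), ρ (J i) z ^ n) +
        (2⁻¹ ^ i + 2⁻¹ ^ i) := fun i =>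
    h.capacity_le_of_subset (by omega) (hρ (J i)) (hfar i) (preimage_mono (hQ i).subset)
  refine continuumCriterion_of_chain hn hx (fun i => (hQ i).isCompact)
    (fun i => (hQ i).isConnected) hQG
    (fun i => (hQP i).mono (inter_subset_inter_right _ (hPQ (i + 1))))
    (fun W hW => (h.eventually_subset hW).mono fun i hi =>
      ((hQ i).subset.trans sdiff_subset).trans ((h.antitone (Nat.le_succ i)).trans hi))
    (ne_top_of_le_ne_top ?_ (ENNReal.tsum_le_tsum hcapQ))
  rw [ENNReal.tsum_add, ENNReal.tsum_add, ENNReal.tsum_mul_left, ENNReal.tsum_geometric_two]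
  exact ENNReal.add_ne_top.2 ⟨ENNReal.mul_ne_top (ENNReal.pow_ne_top ENNReal.ofNat_ne_top)
    (ne_top_of_le_ne_top (by finiteness) hsum), by finiteness⟩

end Crossing

section Properness

variable {n : ℕ} {G : Set (MobiusSpace n)}

lemma exists_nhds_lt_modulusDist (hn : 2 ≤ n) (hG : IsOpen G) {x : MobiusSpace n} (hx : x ∉ G)
    (hM : MCondition G x) (a : G) {R : ℝ≥0∞} (hR : R ≠ ∞) :
    ∃ V ∈ 𝓝 x, ∀ q : G, (q : MobiusSpace n) ∈ V → R < modulusDist G a q := by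
  by_contra! hclose
  have hxa : x ≠ a := fun hxa => hx (hxa ▸ a.2)
  have hR1 : R + 1 ≠ ∞ := ENNReal.add_ne_top.2 ⟨hR, ENNReal.one_ne_top⟩
  obtain ⟨U, hU, hUa⟩ := exists_nhdsChain hn (isOpen_compl_singleton.mem_nhds hxa) hR1
  choose q hqU hq using fun j => hclose (U j) ((hU.isOpen j).mem_nhds (hU.mem j))
  choose γ hγ hcap using fun j =>
    exists_of_modulusDist_lt hG ((hq j).trans_lt (ENNReal.lt_add_right hR one_ne_zero))
  exact hM (hU.continuumCriterion_of_paths hn hR1 hx (fun haU => hUa haU rfl) hqU hγ hcap)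

lemma isProperMetric_of_ultrafilter {X : Type*} {d : X → X → ℝ≥0∞} (hself : ∀ x, d x x = 0)
    (hcomm : ∀ x y, d x y = d y x) (htri : ∀ x y z, d x z ≤ d x y + d y z)
    (hfin : ∀ x y, d x y ≠ ∞) (heq : ∀ x y, d x y = 0 → x = y)
    (hlim : ∀ (a : X) (R : ℝ≥0∞), R ≠ ∞ → ∀ f : Ultrafilter X, {y | d a y ≤ R} ∈ f →
      ∃ p, ∀ ε : ℝ≥0∞, ε ≠ 0 → {y | d p y ≤ ε} ∈ f) : IsProperMetric d := by
  let _ : EMetricSpace X :=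
    { edist := d, edist_self := hself, edist_comm := hcomm, edist_triangle := htri,
      eq_of_edist_eq_zero := fun {x y} h => heq x y h }
  let _ : MetricSpace X := EMetricSpace.toMetricSpace hfin
  refine ⟨inferInstance, fun x y => rfl,
    ⟨fun a r => isCompact_iff_ultrafilter_le_nhds'.2 fun f hf => ?_⟩⟩
  have hball : {y | d a y ≤ ENNReal.ofReal r} ∈ f := mem_of_superset hf fun y hy => by
    rw [Metric.mem_closedBall, dist_comm] at hy
    exact (edist_dist a y).trans_le (ENNReal.ofReal_le_ofReal hy)
  obtain ⟨p, hp⟩ := hlim a _ ENNReal.ofReal_ne_top f hball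
  have hfp : (f : Filter X) ≤ 𝓝 p := Metric.nhds_basis_closedEBall.ge_iff.2 fun ε hε =>
    mem_of_superset (hp ε hε.ne') fun y hy => (hcomm y p).trans_le hy
  exact ⟨p, isClosed_iff_ultrafilter.1 Metric.isClosed_closedBall p f hfp hf, hfp⟩

lemma eq_of_modulusDist_eq_zero (hn : 2 ≤ n) (hG : IsOpen G) (hne : (frontier G).Nonempty)
    (hM : IsMDomain G) (p q : G) (h : modulusDist G p q = 0) : p = q := by
  by_contra hpq
  obtain ⟨y, hy⟩ := hne
  have hpq' : (p : MobiusSpace n) ≠ q := fun h => hpq (Subtype.ext h)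
  obtain ⟨V, hV, hfar⟩ := exists_nhds_lt_modulusDist hn hG (frontier_subset_compl hG hy) (hM y hy)
    p ENNReal.one_ne_top
  obtain ⟨z, hzV, hz⟩ := exists_modulusDist_le_of_escape (by omega) hG
    (isOpen_compl_singleton.mem_nhds hpq')
    (fun ε hε => ⟨q, not_not.2 rfl, h.trans_lt (pos_iff_ne_zero.2 hε)⟩)
    ⟨y, mem_interior_iff_mem_nhds.2 hV⟩ one_ne_zero
  exact (hfar z hzV).not_ge hz

theorem isProperMetric_of_isMDomain (hn : 2 ≤ n) (hG : IsOpen G) (hGc : IsConnected G)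
    (hne : (frontier G).Nonempty) (hM : IsMDomain G) : IsProperMetric (modulusDist G) := by
  refine isProperMetric_of_ultrafilter (modulusDist_self hn hG) (modulusDist_comm hG)
    (modulusDist_triangle hG) (fun x y => (modulusDist_lt_top hn hG hGc.isPreconnected x y).ne)
    (eq_of_modulusDist_eq_zero hn hG hne hM) fun a R hR f hf => ?_
  obtain ⟨p, -, hp⟩ := isCompact_iff_ultrafilter_le_nhds'.1 (isCompact_univ (X := MobiusSpace n))
    (f.map Subtype.val) univ_mem
  have hpG : p ∈ G := by
    by_contra hpG
    have hpclosure : p ∈ closure G := mem_closure_iff_ultrafilter.2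
      ⟨f.map Subtype.val, Ultrafilter.mem_map.2 (mem_of_superset univ_mem fun z _ => z.2), hp⟩
    have hpfrontier : p ∈ frontier G := ⟨hpclosure, fun h => hpG (interior_subset h)⟩
    obtain ⟨V, hV, hfar⟩ := exists_nhds_lt_modulusDist hn hG hpG (hM p hpfrontier) a hR
    obtain ⟨z, hz, hzV⟩ := f.nonempty_of_mem (inter_mem hf (hp hV))
    exact (hfar z hzV).not_ge hz
  refine ⟨⟨p, hpG⟩, fun ε hε => ?_⟩
  obtain ⟨V, hV, hnear⟩ := exists_nhds_modulusDist_le hn hG ⟨p, hpG⟩ hε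
  exact mem_of_superset (hp hV) fun z hz => hnear z hz

theorem IsProperMetric.isCompleteMetric {X : Type*} {d : X → X → ℝ≥0∞} (h : IsProperMetric d) :
    IsCompleteMetric d := by
  obtain ⟨inst, hd, hproper⟩ := h
  exact ⟨inst, hd, inferInstance⟩

end Properness

end ModulusMetric

end

theorem mainTheorem1 (n : ℕ) (hn : 2 ≤ n) (G : Set (ModulusMetric.MobiusSpace n))
    (hGo : IsOpen G) (hGc : IsConnected G) (hG : (frontier G).Nonempty) :
    List.TFAE [
      ModulusMetric.IsProperMetric (ModulusMetric.modulusDist G),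
      ModulusMetric.IsCompleteMetric (ModulusMetric.modulusDist G),
      ModulusMetric.IsMDomain G] := by
  tfae_have 1 → 2 := ModulusMetric.IsProperMetric.isCompleteMetric
  tfae_have 2 → 3 := ModulusMetric.isMDomain_of_isCompleteMetric hn hGo
  tfae_have 3 → 1 := ModulusMetric.isProperMetric_of_isMDomain hn hGo hGc hG
  tfae_finish
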